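/- Let $M$ be a connected smooth manifold (Hausdorff, second countable, without boundary) of dimension $n\ge 3$, let $c=\{e^{2s}g: s\in C^\infty(M)\}$ be a conformal class of Riemannian metrics on $M$, let $v\in\mathcal E[1]$ be a positive density of weight one (a positive smooth function $v_g$ for each $g\in c$, with $v_{e^{2s}g}=e^{s}v_g$), let $m\in\mathbb R\setminus\{-n,1-n,2-n\}$ and $\mu\in\mathbb R$. **Tractors.** A standard tractor $I\in\mathcal T$ (a section of the standard tractor bundle $\mathbb T$) is, for each scale $g\in c$, a smooth section $(\sigma,\omega,\rho)$ of $\mathbb R\oplus TM\oplus\mathbb R$; under $g\mapsto e^{2s}g$ it changes to $$\bigl(e^{s}\sigma,\; e^{-s}(\omega+\sigma\nabla s),\; e^{-s}(\rho-\langle\nabla s,\omega\rangle-\tfrac12|\nabla s|^2\sigma)\bigr),$$ with gradients and norms taken with respect to $g$. The tractor metric is the polarization of $2\sigma\rho+|\omega|^2$. **Weighted curvatures.** Fix any scale $g\in c$, write $v=v_g$, and let $\mathrm{Ric}$, $R$ be the Ricci tensor and scalar curvature of $g$. Put $$\mathrm{Ric}_\phi^m=\mathrm{Ric}-\frac mv\nabla^2v,\qquad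 R_\phi^m=R-\frac{2m}{v}\Delta v-\frac{m(m-1)}{v^{2}}|\nabla v|^2,$$ $$\mathrm J^W=\frac{R_\phi^m+m\mu v^{-2}}{2(m+n-1)},\qquad P^W=\frac{\mathrm{Ric}_\phi^m-\mathrm J^Wg}{m+n-2}.$$ **The bundle $\mathbb T^W$ and the connection $\nabla^W$.** In the notation $(\sigma,\omega,\rho)$ above let $X=(0,0,1)$, $$J=\tfrac1n\mathbb Dv=\Bigl(v,\nabla v,-\tfrac1n\bigl(\Delta v+\tfrac{R}{2(n-1)}v\bigr)\Bigr),\qquad \tilde J=J+\frac{(m+2n-2)\bigl(\mu-(m-1)|J|^2\bigr)}{2(m+n-1)(m+n-2)\langle X,J\rangle}X.$$ Let $\mathbb T^W=\tilde J^{\perp}\subset\mathbb T$, and let $\nabla^W$ be the connection on $\mathbb T$ given by $$\nabla^W(\sigma,\omega,\rho)=\bigl(\nabla\sigma-\omega,\;\nabla\omega+\sigma P^W+\rho g,\;\nabla\rho-P^W(\omega)\bigr).$$ Let $\mathcal Q^W$ be the real vector space of $\nabla^W$-parallel sections of $\mathbb T^W$, i.e. of the tractors $I\in\mathcal T$ with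 $\langle I,\tilde J\rangle=0$ and $\nabla^WI=0$. **Theorem.** For every scale $g\in c$ used to compute these objects: 1. $\dim\mathcal Q^W\le n+1$, and if equality holds, then $\nabla^W$ is flat (its curvature on $\mathbb T$ vanishes). 2. If $m\neq0$, $\nabla^W$ is flat and $M$ is simply connected, then $\dim\mathcal Q^W=n+1$. -/

import Mathlib

open Bundle Manifold
open scoped ContDiff

noncomputable section
namespace Tractor

/-- Smooth Riemannian metrics on the `n`-manifold `M`. -/
abbrev RMetric (n : ℕ) (M : Type*) [TopologicalSpace M] [ChartedSpace (EuclideanSpace ℝ (Fin n)) M]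
    [IsManifold (𝓡 n) ∞ M] :=
  ContMDiffRiemannianMetric (𝓡 n) ∞ (EuclideanSpace ℝ (Fin n))
    (fun p : M => TangentSpace (𝓡 n) p)

variable {n : ℕ} {M : Type*} [TopologicalSpace M] [ChartedSpace (EuclideanSpace ℝ (Fin n)) M]
  [IsManifold (𝓡 n) ∞ M]

/-- The coordinate basis of `T_p M` given by the preferred chart at `p`. -/
def tangentBasis (p : M) : Module.Basis (Fin n) ℝ (TangentSpace (𝓡 n) p) :=
  (EuclideanSpace.basisFun (Fin n) ℝ).toBasis

instance (p : M) : FiniteDimensional ℝ (TangentSpace (𝓡 n) p) :=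
  inferInstanceAs (FiniteDimensional ℝ (EuclideanSpace ℝ (Fin n)))

instance (p : M) : T2Space (TangentSpace (𝓡 n) p) :=
  inferInstanceAs (T2Space (EuclideanSpace ℝ (Fin n)))

/-- The matrix `g_ij` of `g` at `p`. -/
def gram (g : RMetric n M) (p : M) : Matrix (Fin n) (Fin n) ℝ :=
  Matrix.of fun i j => g.inner p (tangentBasis p i) (tangentBasis p j)

/-- Raising an index: `g^{ij} ℓ(e_i) e_j`; for a linear form `ℓ` this is the vector dual to it. -/
def sharp (g : RMetric n M) (p : M) (ℓ : TangentSpace (𝓡 n) p → ℝ) : TangentSpace (𝓡 n) p :=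
  ∑ i, ∑ j, ((gram g p)⁻¹ i j * ℓ (tangentBasis p i)) • tangentBasis p j

/-- `g^{ij} B(e_i, e_j)`, the trace with respect to `g` of a bilinear form `B` on `T_p M`. -/
def metricTrace (g : RMetric n M) (p : M)
    (B : TangentSpace (𝓡 n) p → TangentSpace (𝓡 n) p → ℝ) : ℝ :=
  ∑ i, ∑ j, (gram g p)⁻¹ i j * B (tangentBasis p i) (tangentBasis p j)

theorem isUnit_gram (g : RMetric n M) (p : M) : IsUnit (gram g p).det := by
  rw [isUnit_iff_ne_zero]
  intro h
  obtain ⟨v, hv, hv0⟩ := Matrix.exists_mulVec_eq_zero_iff.2 h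
  set V : TangentSpace (𝓡 n) p := ∑ i, v i • tangentBasis p i with hV
  have hVne : V ≠ 0 := by
    intro h0
    exact hv (funext fun i =>
      (Fintype.linearIndependent_iff.1 (tangentBasis p).linearIndependent v h0 i))
  have h1 : g.inner p V V = ∑ i, v i * ((gram g p).mulVec v) i := by
    conv_lhs => rw [hV]
    simp only [gram, Matrix.mulVec, dotProduct, map_sum, map_smul, Finset.mul_sum,
      FunLike.coe_sum, Finset.sum_apply, FunLike.coe_smul, Pi.smul_apply, smul_eq_mul,
      Matrix.of_apply]
    rw [Finset.sum_comm]
    exact Finset.sum_congr rfl fun i _ => Finset.sum_congr rfl fun j _ => by ring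
  have := g.pos p V hVne
  rw [h1, hv0] at this
  simp at this

theorem sharp_inner (g : RMetric n M) (p : M) (w : TangentSpace (𝓡 n) p) :
    sharp g p (fun z => g.inner p w z) = w := by
  have hw := (tangentBasis p).sum_repr w
  set c := (tangentBasis p).repr w
  have h1 : ∀ i, g.inner p w (tangentBasis p i) = ∑ k, c k * gram g p k i := by
    intro i
    conv_lhs => rw [← hw]
    simp [gram, map_sum, map_smul]
  have h2 : ∀ k j, ∑ i, gram g p k i * (gram g p)⁻¹ i j = if k = j then 1 else 0 := by
    intro k j
    have := congrFun (congrFun (Matrix.mul_nonsing_inv _ (isUnit_gram g p)) k) j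
    rwa [Matrix.mul_apply, Matrix.one_apply] at this
  conv_rhs => rw [← hw]
  unfold sharp
  rw [Finset.sum_comm]
  refine Finset.sum_congr rfl fun j _ => ?_
  rw [← Finset.sum_smul]
  congr 1
  simp only [h1, Finset.mul_sum]
  rw [Finset.sum_comm]
  calc ∑ k, ∑ i, (gram g p)⁻¹ i j * (c k * gram g p k i)
      = ∑ k, c k * ∑ i, gram g p k i * (gram g p)⁻¹ i j := by
        refine Finset.sum_congr rfl fun k _ => ?_
        rw [Finset.mul_sum]
        exact Finset.sum_congr rfl fun i _ => by ring
    _ = c j := by simp [h2]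

theorem sharp_add (g : RMetric n M) (p : M) (ℓ ℓ' : TangentSpace (𝓡 n) p → ℝ) :
    sharp g p (fun z => ℓ z + ℓ' z) = sharp g p ℓ + sharp g p ℓ' := by
  simp only [sharp, mul_add, add_smul, Finset.sum_add_distrib]

theorem sharp_smul (g : RMetric n M) (p : M) (c : ℝ) (ℓ : TangentSpace (𝓡 n) p → ℝ) :
    sharp g p (fun z => c * ℓ z) = c • sharp g p ℓ := by
  simp only [sharp, Finset.smul_sum, smul_smul]
  refine Finset.sum_congr rfl fun i _ => Finset.sum_congr rfl fun j _ => ?_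
  congr 1; ring

/-- The field `X` of tangent vectors is differentiable at `p`. -/
abbrev DiffAt (X : ∀ p : M, TangentSpace (𝓡 n) p) (p : M) : Prop :=
  MDifferentiableAt (𝓡 n) (𝓡 n).tangent (fun q => (⟨q, X q⟩ : TangentBundle (𝓡 n) M)) p

theorem mdiff_inner (g : RMetric n M) {X Y : ∀ p : M, TangentSpace (𝓡 n) p} {p : M}
    (hX : DiffAt X p) (hY : DiffAt Y p) :
    MDifferentiableAt (𝓡 n) 𝓘(ℝ) (fun q => g.inner q (X q) (Y q)) p := by
  let _ : RiemannianBundle (fun p : M => TangentSpace (𝓡 n) p) := ⟨g.toRiemannianMetric⟩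
  have : IsContMDiffRiemannianBundle (𝓡 n) 1 (EuclideanSpace ℝ (Fin n))
    (fun p : M => TangentSpace (𝓡 n) p) :=
    IsContMDiffRiemannianBundle.of_le (n := ∞) (by simp)
  exact MDifferentiableAt.inner_bundle hX hY

/-- Half the right-hand side of the Koszul formula. -/
def koszul (g : RMetric n M) (X Y Z : ∀ p : M, TangentSpace (𝓡 n) p) (p : M) : ℝ :=
  (mvfderiv (𝓡 n) (fun q => g.inner q (Y q) (Z q)) p (X p)
    + mvfderiv (𝓡 n) (fun q => g.inner q (X q) (Z q)) p (Y p)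
    - mvfderiv (𝓡 n) (fun q => g.inner q (X q) (Y q)) p (Z p)
    + g.inner p (VectorField.mlieBracket (𝓡 n) X Y p) (Z p)
    - g.inner p (VectorField.mlieBracket (𝓡 n) X Z p) (Y p)
    - g.inner p (VectorField.mlieBracket (𝓡 n) Y Z p) (X p)) / 2

section
variable (g : RMetric n M) {X X' Y Y' Z : ∀ p : M, TangentSpace (𝓡 n) p} {p : M} {f : M → ℝ}

theorem deriv_inner_smul (hf : MDifferentiableAt (𝓡 n) 𝓘(ℝ) f p) (hX : DiffAt X p)
    (hY : DiffAt Y p) :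
    mvfderiv (𝓡 n) (fun q => g.inner q ((f • X) q) (Y q)) p
      = f p • mvfderiv (𝓡 n) (fun q => g.inner q (X q) (Y q)) p
        + g.inner p (X p) (Y p) • mvfderiv (𝓡 n) f p := by
  rw [← mvfderiv_fun_mul hf (mdiff_inner g hX hY)]
  simp [Pi.smul_apply']

theorem deriv_inner_add (hX : DiffAt X p) (hX' : DiffAt X' p) (hY : DiffAt Y p) :
    mvfderiv (𝓡 n) (fun q => g.inner q ((X + X') q) (Y q)) p
      = mvfderiv (𝓡 n) (fun q => g.inner q (X q) (Y q)) p
        + mvfderiv (𝓡 n) (fun q => g.inner q (X' q) (Y q)) p := by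
  rw [← mvfderiv_fun_add (mdiff_inner g hX hY) (mdiff_inner g hX' hY)]
  simp

theorem koszul_smul_left (hf : MDifferentiableAt (𝓡 n) 𝓘(ℝ) f p) (hX : DiffAt X p)
    (hY : DiffAt Y p) (hZ : DiffAt Z p) :
    koszul g (f • X) Y Z p = f p * koszul g X Y Z p := by
  simp only [koszul, deriv_inner_smul g hf hX hY, deriv_inner_smul g hf hX hZ,
    VectorField.mlieBracket_smul_left hf hX]
  simp [g.symm p (X p)]
  ring

theorem koszul_add_left (hX : DiffAt X p) (hX' : DiffAt X' p) (hY : DiffAt Y p)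
    (hZ : DiffAt Z p) : koszul g (X + X') Y Z p = koszul g X Y Z p + koszul g X' Y Z p := by
  simp only [koszul, deriv_inner_add g hX hX' hY, deriv_inner_add g hX hX' hZ,
    VectorField.mlieBracket_add_left hX hX']
  simp
  ring

theorem koszul_smul_mid (hf : MDifferentiableAt (𝓡 n) 𝓘(ℝ) f p) (hX : DiffAt X p)
    (hY : DiffAt Y p) (hZ : DiffAt Z p) :
    koszul g X (f • Y) Z p
      = f p * koszul g X Y Z p + mvfderiv (𝓡 n) f p (X p) * g.inner p (Y p) (Z p) := by
  simp only [koszul, deriv_inner_smul g hf hY hZ, fun q => g.symm q (X q) ((f • Y) q),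
    fun q => g.symm q (X q) (Y q), deriv_inner_smul g hf hY hX,
    VectorField.mlieBracket_smul_left hf hY, VectorField.mlieBracket_smul_right hf hY]
  simp [g.symm p (Y p) (X p)]
  ring

theorem koszul_add_mid (hX : DiffAt X p) (hY : DiffAt Y p) (hY' : DiffAt Y' p)
    (hZ : DiffAt Z p) : koszul g X (Y + Y') Z p = koszul g X Y Z p + koszul g X Y' Z p := by
  simp only [koszul, deriv_inner_add g hY hY' hZ, fun q => g.symm q (X q) ((Y + Y') q),
    fun q => g.symm q (X q) (Y q), fun q => g.symm q (X q) (Y' q), deriv_inner_add g hY hY' hX,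
    VectorField.mlieBracket_add_left hY hY', VectorField.mlieBracket_add_right hY hY']
  simp
  ring

/-- The extension of a tangent vector at `p` to a vector field, constant in the chart at `p`. -/
abbrev extendVec (p : M) (u : TangentSpace (𝓡 n) p) : ∀ q : M, TangentSpace (𝓡 n) q :=
  FiberBundle.extend (EuclideanSpace ℝ (Fin n)) u

theorem diffAt_extendVec (p : M) (u : TangentSpace (𝓡 n) p) : DiffAt (extendVec p u) p :=
  FiberBundle.mdifferentiableAt_extend _ _ u

theorem diffAt_add (hX : DiffAt X p) (hX' : DiffAt X' p) : DiffAt (X + X') p :=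
  mdifferentiableAt_add_section hX hX'

theorem diffAt_smul (hf : MDifferentiableAt (𝓡 n) 𝓘(ℝ) f p) (hX : DiffAt X p) :
    DiffAt (f • X) p :=
  MDifferentiableAt.smul_section hf hX

theorem tensorialAt_koszul (hY : DiffAt Y p) (hZ : DiffAt Z p) :
    TensorialAt (𝓡 n) (EuclideanSpace ℝ (Fin n)) (fun X => koszul g X Y Z p) p where
  smul hf hX := koszul_smul_left g hf hX hY hZ
  add hX hX' := koszul_add_left g hX hX' hY hZ

/-- `∇Y` at `p`, for `Y` differentiable at `p`, by the Koszul formula: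
`g (∇_u Y, z) = koszul g U Y Z p` for extensions `U`, `Z` of `u`, `z`. -/
def leviCivitaAt (g : RMetric n M) (p : M) (Y : ∀ p : M, TangentSpace (𝓡 n) p) (h : DiffAt Y p) :
    TangentSpace (𝓡 n) p →L[ℝ] TangentSpace (𝓡 n) p :=
  LinearMap.toContinuousLinearMap
    { toFun := fun u => sharp g p fun z => koszul g (extendVec p u) Y (extendVec p z) p
      map_add' := fun u u' => by
        rw [← sharp_add]
        congr 1
        funext z
        have hz := diffAt_extendVec p z
        rw [← koszul_add_left g (diffAt_extendVec p u) (diffAt_extendVec p u') h hz]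
        exact (tensorialAt_koszul g h hz).pointwise (diffAt_extendVec p _)
          (diffAt_add (diffAt_extendVec p u) (diffAt_extendVec p u')) (by simp [extendVec])
      map_smul' := fun c u => by
        rw [RingHom.id_apply, ← sharp_smul]
        congr 1
        funext z
        have hz := diffAt_extendVec p z
        have hc : MDifferentiableAt (𝓡 n) 𝓘(ℝ) (fun _ : M => c) p := mdifferentiableAt_const
        rw [← koszul_smul_left g hc (diffAt_extendVec p u) h hz]
        exact (tensorialAt_koszul g h hz).pointwise (diffAt_extendVec p _)
          (diffAt_smul hc (diffAt_extendVec p u)) (by simp [extendVec]) }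

theorem leviCivitaAt_apply (h : DiffAt Y p) (u : TangentSpace (𝓡 n) p) :
    leviCivitaAt g p Y h u = sharp g p fun z => koszul g (extendVec p u) Y (extendVec p z) p := rfl

theorem leviCivitaAt_add (h : DiffAt Y p) (h' : DiffAt Y' p) (h'' : DiffAt (Y + Y') p) :
    leviCivitaAt g p (Y + Y') h'' = leviCivitaAt g p Y h + leviCivitaAt g p Y' h' := by
  ext1 u
  rw [FunLike.coe_add, Pi.add_apply, leviCivitaAt_apply, leviCivitaAt_apply, leviCivitaAt_apply, ← sharp_add]
  congr 1
  funext z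
  exact koszul_add_mid g (diffAt_extendVec p u) h h' (diffAt_extendVec p z)

theorem leviCivitaAt_smul (hf : MDifferentiableAt (𝓡 n) 𝓘(ℝ) f p) (h : DiffAt Y p)
    (h' : DiffAt (f • Y) p) :
    leviCivitaAt g p (f • Y) h'
      = f p • leviCivitaAt g p Y h + (mvfderiv (𝓡 n) f p).smulRight (Y p) := by
  ext1 u
  rw [FunLike.coe_add, Pi.add_apply, FunLike.coe_smul, Pi.smul_apply, leviCivitaAt_apply, leviCivitaAt_apply,
    ContinuousLinearMap.smulRight_apply, ← sharp_smul]
  conv_rhs => rw [← sharp_inner g p (Y p)]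
  rw [← sharp_smul, ← sharp_add]
  congr 1
  funext z
  rw [koszul_smul_mid g hf (diffAt_extendVec p u) h (diffAt_extendVec p z)]
  simp [extendVec]

end

open Classical in
/-- The Levi-Civita connection of `g` (with value `0` at points where the field is not
differentiable). -/
def leviCivita (g : RMetric n M) :
    CovariantDerivative (𝓡 n) (EuclideanSpace ℝ (Fin n)) (fun p : M => TangentSpace (𝓡 n) p) where
  toFun Y p := if h : DiffAt Y p then leviCivitaAt g p Y h else 0
  isCovariantDerivativeOnUniv :=
    { add := by
        intro Y Y' p hY hY' _
        rw [dif_pos hY, dif_pos hY', dif_pos (diffAt_add hY hY'), leviCivitaAt_add]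
      leibniz := by
        intro Y f p hY hf _
        rw [dif_pos hY, dif_pos (diffAt_smul hf hY), leviCivitaAt_smul g hf] }

/-- The gradient of `f`. -/
def grad (g : RMetric n M) (f : M → ℝ) (p : M) : TangentSpace (𝓡 n) p :=
  sharp g p fun z => mvfderiv (𝓡 n) f p z

/-- The Hessian `∇²f (u, w) = g (∇_u ∇f, w)`. -/
def hess (g : RMetric n M) (f : M → ℝ) (p : M) (u w : TangentSpace (𝓡 n) p) : ℝ :=
  g.inner p (leviCivita g (grad g f) p u) w

/-- The Laplacian `Δf = tr_g ∇²f`. -/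
def laplacian (g : RMetric n M) (f : M → ℝ) (p : M) : ℝ :=
  metricTrace g p fun a b => hess g f p a b

/-- The covariant derivative `∇_X Y` as a vector field. -/
def nabla (g : RMetric n M) (X Y : ∀ p : M, TangentSpace (𝓡 n) p) (p : M) : TangentSpace (𝓡 n) p :=
  leviCivita g Y p (X p)

/-- The Riemann curvature `R(X,Y)Z = ∇_X ∇_Y Z - ∇_Y ∇_X Z - ∇_[X,Y] Z` of vectors at `p`. -/
def riemann (g : RMetric n M) (p : M) (u w z : TangentSpace (𝓡 n) p) : TangentSpace (𝓡 n) p :=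
  nabla g (extendVec p u) (nabla g (extendVec p w) (extendVec p z)) p
    - nabla g (extendVec p w) (nabla g (extendVec p u) (extendVec p z)) p
    - nabla g (VectorField.mlieBracket (𝓡 n) (extendVec p u) (extendVec p w)) (extendVec p z) p

/-- The Ricci tensor `Ric(u, w) = tr (a ↦ R(a, u) w)`. -/
def ricci (g : RMetric n M) (p : M) (u w : TangentSpace (𝓡 n) p) : ℝ :=
  metricTrace g p fun a b => g.inner p (riemann g p a u w) b

/-- The scalar curvature. -/
def scal (g : RMetric n M) (p : M) : ℝ := metricTrace g p fun a b => ricci g p a b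

/-- The trace `J = R / (2 (n - 1))` of the Schouten tensor `P = (Ric - J g) / (n - 2)`. -/
def schoutenTrace (g : RMetric n M) (p : M) : ℝ := scal g p / (2 * ((n : ℝ) - 1))

/-! ### Conformal classes, densities and tractors -/

/-- `h = e^{2s} g` for the smooth function `s`. -/
structure IsRescaling (g h : RMetric n M) (s : M → ℝ) : Prop where
  smooth : ContMDiff (𝓡 n) 𝓘(ℝ) ∞ s
  eq : ∀ p u w, h.inner p u w = Real.exp (2 * s p) * g.inner p u w

variable (n M) in
/-- A Riemannian conformal class `c = [g] = {h : h = e^{2s} g}`. Its elements are the scales. -/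
structure ConformalClass where
  scales : Set (RMetric n M)
  exists_eq : ∃ g, scales = {h | ∃ s, IsRescaling g h s}

/-- Smooth sections of the density bundle `E[w]`: a smooth function in each scale, with
`σ_h = e^{ws} σ_g` when `h = e^{2s} g`. -/
structure Density (c : ConformalClass n M) (w : ℝ) where
  inScale : c.scales → M → ℝ
  smooth : ∀ g, ContMDiff (𝓡 n) 𝓘(ℝ) ∞ (inScale g)
  transform : ∀ (g h : c.scales) (s : M → ℝ), IsRescaling g.1 h.1 s →
    ∀ p, inScale h p = Real.exp (w * s p) * inScale g p

/-- The components `(σ, ω, ρ)` of a standard tractor at `p` in a scale. -/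
abbrev TractorComp (n : ℕ) {M : Type*} [TopologicalSpace M] [ChartedSpace (EuclideanSpace ℝ (Fin n)) M]
    (p : M) := ℝ × TangentSpace (𝓡 n) p × ℝ

/-- The transformation law of standard tractors at `p` from the scale `g` to `e^{2s} g`. -/
def changeScale (g : RMetric n M) (s : M → ℝ) (p : M) (I : TractorComp n p) : TractorComp n p :=
  (Real.exp (s p) * I.1,
   Real.exp (-s p) • (I.2.1 + I.1 • grad g s p),
   Real.exp (-s p) * (I.2.2 - g.inner p (grad g s p) I.2.1
      - g.inner p (grad g s p) (grad g s p) * I.1 / 2))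

/-- Smoothness of a section of `ℝ ⊕ TM ⊕ ℝ`. -/
structure SmoothComp (I : ∀ p : M, TractorComp n p) : Prop where
  top : ContMDiff (𝓡 n) 𝓘(ℝ) ∞ (fun p => (I p).1)
  mid : ContMDiff (𝓡 n) (𝓡 n).tangent ∞ (fun p => (⟨p, (I p).2.1⟩ : TangentBundle (𝓡 n) M))
  bot : ContMDiff (𝓡 n) 𝓘(ℝ) ∞ (fun p => (I p).2.2)

/-- The space `𝒯` of standard tractors, the smooth sections of the standard tractor bundle: in each
scale a smooth section of `ℝ ⊕ TM ⊕ ℝ`, subject to the transformation law. -/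
def tractors (c : ConformalClass n M) :
    Submodule ℝ (c.scales → ∀ p : M, TractorComp n p) where
  carrier := {I | (∀ g, SmoothComp (I g)) ∧
    ∀ (g h : c.scales) (s : M → ℝ), IsRescaling g.1 h.1 s →
      ∀ p, I h p = changeScale g.1 s p (I g p)}
  zero_mem' := by
    refine ⟨fun g => ⟨contMDiff_const, contMDiff_zeroSection _ _, contMDiff_const⟩, ?_⟩
    intro g h s _ p
    simp [changeScale]
    rfl
  add_mem' := by
    rintro I I' ⟨hI, hI2⟩ ⟨hI', hI2'⟩
    refine ⟨fun g => ⟨(hI g).top.add (hI' g).top, (hI g).mid.add_section (hI' g).mid,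
      (hI g).bot.add (hI' g).bot⟩, ?_⟩
    intro g h s hs p
    simp only [Pi.add_apply, hI2 g h s hs p, hI2' g h s hs p, changeScale]
    refine Prod.ext ?_ (Prod.ext ?_ ?_)
    · simp; ring
    · simp; module
    · simp; ring
  smul_mem' := by
    rintro a I ⟨hI, hI2⟩
    refine ⟨fun g => ⟨contMDiff_const.mul (hI g).top, ?_,
      contMDiff_const.mul (hI g).bot⟩, ?_⟩
    · exact ContMDiff.const_smul_section (hI g).mid
    intro g h s hs p
    simp only [Pi.smul_apply, hI2 g h s hs p, changeScale]
    refine Prod.ext ?_ (Prod.ext ?_ ?_)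
    · simp; ring
    · simp; module
    · simp; ring

/-- The tractor metric, the polarization of `2 σ ρ + |ω|²`, in the scale `g`. -/
def tractorMetric (g : RMetric n M) (p : M) (I J : TractorComp n p) : ℝ :=
  I.1 * J.2.2 + I.2.2 * J.1 + g.inner p I.2.1 J.2.1

/-- The projector `X = (σ, ω, ρ) = (0, 0, 1)`. -/
def projector (p : M) : TractorComp n p := (0, 0, 1)

/-- The tractor-D operator on `E[w]` in the scale `g`. -/
def tractorD (g : RMetric n M) (w : ℝ) (u : M → ℝ) (p : M) : TractorComp n p :=
  (w * (n + 2 * w - 2) * u p,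
   ((n : ℝ) + 2 * w - 2) • grad g u p,
   -(laplacian g u p + w * schoutenTrace g p * u p))

/-! ### Smooth metric measure spaces -/

/-- The Bakry-Emery Ricci tensor of `(M, g, v^m dvol)`. -/
def bakryEmery (g : RMetric n M) (v : M → ℝ) (m : ℝ) (p : M) (u w : TangentSpace (𝓡 n) p) : ℝ :=
  ricci g p u w - m * (v p)⁻¹ * hess g v p u w

/-- The weighted scalar curvature of `(M, g, v^m dvol)`. -/
def weightedScal (g : RMetric n M) (v : M → ℝ) (m : ℝ) (p : M) : ℝ :=
  scal g p - 2 * m * (v p)⁻¹ * laplacian g v p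
    - m * (m - 1) * (v p)⁻¹ ^ 2 * g.inner p (grad g v p) (grad g v p)

/-- The weighted Schouten scalar `J^W`. -/
def weightedSchoutenScalar (g : RMetric n M) (v : M → ℝ) (m μ : ℝ) (p : M) : ℝ :=
  (weightedScal g v m p + m * μ * (v p)⁻¹ ^ 2) / (2 * (m + n - 1))

/-- The weighted Schouten tensor `P^W`. -/
def weightedSchouten (g : RMetric n M) (v : M → ℝ) (m μ : ℝ) (p : M)
    (u w : TangentSpace (𝓡 n) p) : ℝ :=
  (bakryEmery g v m p u w - weightedSchoutenScalar g v m μ p * g.inner p u w) / (m + n - 2)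

/-- `P^W` regarded as an endomorphism of `T_p M`: `g (P^W(u), w) = P^W(u, w)`. -/
def weightedSchoutenSharp (g : RMetric n M) (v : M → ℝ) (m μ : ℝ) (p : M)
    (u : TangentSpace (𝓡 n) p) : TangentSpace (𝓡 n) p :=
  sharp g p fun w => weightedSchouten g v m μ p u w

variable (n M) in
/-- A smooth conformal measure space `(M, c, v^m dν)`: a conformal class `c`, a positive density
`v` of weight one and a dimensional parameter `m`. -/
structure SCMS where
  conf : ConformalClass n M
  v : Density conf 1
  v_pos : ∀ g p, 0 < v.inScale g p
  m : ℝ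

namespace SCMS

variable (S : SCMS n M) (μ : ℝ)

/-- The scale tractor `J = (1/n) D v` in the scale `g`. -/
def scaleTractor (g : S.conf.scales) (p : M) : TractorComp n p :=
  (1 / (n : ℝ)) • tractorD g.1 1 (S.v.inScale g) p

/-- The tractor `J~ = J + (m+2n-2)(μ - (m-1)|J|²) / (2(m+n-1)(m+n-2)⟨X,J⟩) X` in the scale `g`. -/
def scaleTractorTilde (g : S.conf.scales) (p : M) : TractorComp n p :=
  let J := S.scaleTractor g p
  J + ((S.m + 2 * n - 2) * (μ - (S.m - 1) * tractorMetric g.1 p J J)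
      / (2 * (S.m + n - 1) * (S.m + n - 2) * tractorMetric g.1 p (projector p) J)) • projector p

/-- The `W`-tractor connection in the scale `g`: the components of `∇^W_u I` at `p`, for a section
`I = (σ, ω, ρ)`. -/
def nablaW (g : S.conf.scales) (I : ∀ p : M, TractorComp n p) (p : M) (u : TangentSpace (𝓡 n) p) :
    TractorComp n p :=
  let P := weightedSchoutenSharp g.1 (S.v.inScale g) S.m μ p u
  (mvfderiv (𝓡 n) (fun q => (I q).1) p u - g.1.inner p (I p).2.1 u,
   leviCivita g.1 (fun q => (I q).2.1) p u + (I p).1 • P + (I p).2.2 • u,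
   mvfderiv (𝓡 n) (fun q => (I q).2.2) p u - g.1.inner p P (I p).2.1)

/-- The curvature `R^W(X, Z) I = -∇^W_X ∇^W_Z I + ∇^W_Z ∇^W_X I + ∇^W_[X,Z] I` in the scale `g`. -/
def curvatureW (g : S.conf.scales) (X Z : ∀ p : M, TangentSpace (𝓡 n) p)
    (I : ∀ p : M, TractorComp n p) (p : M) : TractorComp n p :=
  -S.nablaW μ g (fun q => S.nablaW μ g I q (Z q)) p (X p)
    + S.nablaW μ g (fun q => S.nablaW μ g I q (X q)) p (Z p)
    + S.nablaW μ g I p (VectorField.mlieBracket (𝓡 n) X Z p)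

/-- `∇^W` is flat: `R^W(X, Z) I = 0` for all smooth vector fields `X`, `Z` and all tractors `I`. -/
def IsFlatW (g : S.conf.scales) : Prop :=
  ∀ X Z : ∀ p : M, TangentSpace (𝓡 n) p,
    ContMDiff (𝓡 n) (𝓡 n).tangent ∞ (fun p => (⟨p, X p⟩ : TangentBundle (𝓡 n) M)) →
    ContMDiff (𝓡 n) (𝓡 n).tangent ∞ (fun p => (⟨p, Z p⟩ : TangentBundle (𝓡 n) M)) →
    ∀ I ∈ tractors S.conf, ∀ p, S.curvatureW μ g X Z (I g) p = 0

variable {S μ} in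
theorem nablaW_add {g : S.conf.scales} {I I' : ∀ p : M, TractorComp n p} (hI : SmoothComp I)
    (hI' : SmoothComp I') (p : M) (u : TangentSpace (𝓡 n) p) :
    S.nablaW μ g (I + I') p u = S.nablaW μ g I p u + S.nablaW μ g I' p u := by
  have h1 := mvfderiv_fun_add (x := p) (hI.top.mdifferentiableAt (by simp))
    (hI'.top.mdifferentiableAt (by simp))
  have h2 := (leviCivita g.1).isCovariantDerivativeOnUniv.add (x := p)
    (hI.mid.mdifferentiableAt (by simp)) (hI'.mid.mdifferentiableAt (by simp)) trivial
  have h3 := mvfderiv_fun_add (x := p) (hI.bot.mdifferentiableAt (by simp))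
    (hI'.bot.mdifferentiableAt (by simp))
  have h2' : leviCivita g.1 (fun q => ((I + I') q).2.1) p u
      = leviCivita g.1 (fun q => (I q).2.1) p u + leviCivita g.1 (fun q => (I' q).2.1) p u :=
    congrArg (fun A => A u) h2
  refine Prod.ext ?_ (Prod.ext ?_ ?_)
  · simp [nablaW, h1]; ring
  · simp only [nablaW, Prod.snd_add, Prod.fst_add, h2']
    simp only [Pi.add_apply, Prod.snd_add, Prod.fst_add]
    module
  · simp [nablaW, h3]; ring

variable {S μ} in
theorem nablaW_smul {g : S.conf.scales} {I : ∀ p : M, TractorComp n p} (hI : SmoothComp I) (a : ℝ)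
    (p : M) (u : TangentSpace (𝓡 n) p) :
    S.nablaW μ g (a • I) p u = a • S.nablaW μ g I p u := by
  have hc : MDifferentiableAt (𝓡 n) 𝓘(ℝ) (fun _ : M => a) p := mdifferentiableAt_const
  have h1 := mvfderiv_fun_mul hc (hI.top.mdifferentiableAt (by simp))
  have h2 := (leviCivita g.1).isCovariantDerivativeOnUniv.leibniz
    (hI.mid.mdifferentiableAt (by simp)) hc trivial
  have h3 := mvfderiv_fun_mul hc (hI.bot.mdifferentiableAt (by simp))
  have h2' : leviCivita g.1 (fun q => ((a • I) q).2.1) p u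
      = a • leviCivita g.1 (fun q => (I q).2.1) p u := by
    refine (congrArg (fun A => A u) h2).trans ?_
    simp [mvfderiv_const]
  refine Prod.ext ?_ (Prod.ext ?_ ?_)
  · simp [nablaW, h1, mvfderiv_const]; ring
  · simp only [nablaW, Prod.smul_snd, Prod.smul_fst, h2']
    simp only [Pi.smul_apply, Prod.smul_snd, Prod.smul_fst]
    module
  · simp [nablaW, h3, mvfderiv_const]; ring

/-- The space `Q^W` of `∇^W`-parallel sections of the subbundle `T^W`, the orthogonal complement of
`J~` with respect to the tractor metric. -/
def parallelSections (g : S.conf.scales) : Submodule ℝ (tractors S.conf) where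
  carrier := {I | (∀ p, tractorMetric g.1 p (I.1 g p) (S.scaleTractorTilde μ g p) = 0) ∧
    ∀ p u, S.nablaW μ g (I.1 g) p u = 0}
  add_mem' := by
    rintro I I' ⟨h1, h2⟩ ⟨h1', h2'⟩
    refine ⟨fun p => ?_, fun p u => ?_⟩
    · refine Eq.trans ?_ ((congrArg₂ (· + ·) (h1 p) (h1' p)).trans (add_zero 0))
      simp [tractorMetric]
      ring
    · exact (nablaW_add (I.2.1 g) (I'.2.1 g) p u).trans (by rw [h2, h2', add_zero])
  zero_mem' := by
    have h0 : SmoothComp (0 : ∀ p : M, TractorComp n p) := (tractors S.conf).zero_mem.1 g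
    refine ⟨fun p => by simp [tractorMetric], fun p u => ?_⟩
    have h := nablaW_smul (μ := μ) (g := g) h0 0 p u
    rw [zero_smul, zero_smul] at h
    exact h
  smul_mem' := by
    rintro a I ⟨h1, h2⟩
    refine ⟨fun p => ?_, fun p u => ?_⟩
    · refine Eq.trans ?_ ((congrArg (a * ·) (h1 p)).trans (mul_zero a))
      simp [tractorMetric]
      ring
    · exact (nablaW_smul (I.2.1 g) a p u).trans (by rw [h2, smul_zero])

end SCMS

end Tractor

end

noncomputable section
namespace Tractor

/-! The connection `∇^W` has the shape `tractorConn g P` for a field of endomorphisms `P`. Every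
such connection preserves the tractor metric, whatever `P` is. A section parallel near a point
solves a linear equation `dY = -Γ Y` in coordinates, so on a connected manifold it is determined by
its value at one point. The fibre of `T^W` is the kernel of the pairing with `J~`. This pairing is
nonzero because `⟨X, J~⟩ = v > 0`, so the fibre has dimension `n + 1`, and evaluation at a point
(`SCMS.evalAt_injective`) bounds the dimension of the space of parallel sections.

If the bound is attained, every vector of every fibre of `T^W` extends to a parallel section. The
top component of the curvature of `tractorConn` is `σ` times the skew part of `P`
(`tractorCurv_top`). A parallel section with `σ = 1` at the point has zero curvature, so this skew
part vanishes, and with it the top component of the curvature on every section. The connection is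
metric, so curvature values are also orthogonal to all parallel sections, hence to the whole fibre
of `T^W`. They are therefore multiples of `J~`; since the top component of `J~` is `v ≠ 0`, they
vanish (`SCMS.flat_of_evalAt_surjective`).

Conversely, let `∇^W` be flat. The middle component of the curvature expresses the Riemann tensor
through `P` and `g` (`riemann_of_flat`), so that `Ric = (n - 2) P + (tr P) g`. Comparison with the
definition of `P^W` gives `m (∇²v + v P) = v (tr P - J^W) g`. For `m ≠ 0` this says that the top and
middle components of `∇^W J` vanish, and flatness forces the bottom one to vanish too
(`parallel_of_flat`), so `J` is parallel. Inserting the traces into the definition of `J^W` gives `μ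
= (m - 1) |J|²`, so `J~ = J`. Parallel sections exist through every vector when `M` is simply
connected; their pairing with `J` is constant, so those starting in `T^W` stay there
(`SCMS.evalAt_surjective_of_flat`).

The analytic input is local solvability of `dY = -Γ Y` for flat `Γ` (`exists_parallel_of_flat`).
Picard iteration along rays produces a limit whose radial derivative is right; flatness makes the
defect in the remaining directions shrink geometrically. Local frames are glued by a covering space
argument (`exists_global_section`). Much of the rest establishes smoothness and tensoriality of the
Levi-Civita connection and the curvature from the Koszul formula. -/

/-- A shortcut instance for connection forms. -/
instance connFormNormedAddCommGroup {E F G : Type*} [NormedAddCommGroup E] [NormedSpace ℝ E] [NormedAddCommGroup F]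
    [NormedSpace ℝ F] [NormedAddCommGroup G] [NormedSpace ℝ G] :
    NormedAddCommGroup (E →L[ℝ] F →L[ℝ] G) := ContinuousLinearMap.toNormedAddCommGroup

/-- A shortcut instance for connection forms. -/
instance connFormNormedSpace {E F G : Type*} [NormedAddCommGroup E] [NormedSpace ℝ E] [NormedAddCommGroup F]
    [NormedSpace ℝ F] [NormedAddCommGroup G] [NormedSpace ℝ G] :
    NormedSpace ℝ (E →L[ℝ] F →L[ℝ] G) := ContinuousLinearMap.toNormedSpace

/-- A shortcut instance for connection forms. -/
instance connFormSeminormedAddGroup {E F G : Type*} [NormedAddCommGroup E] [NormedSpace ℝ E] [NormedAddCommGroup F]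
    [NormedSpace ℝ F] [NormedAddCommGroup G] [NormedSpace ℝ G] :
    SeminormedAddGroup (E →L[ℝ] F →L[ℝ] G) := inferInstance

/-! ### Local solvability of the parallel transport equation for a flat connection form. -/

section ParallelODE

open Set Filter Topology MeasureTheory Metric

variable {E F : Type*} [NormedAddCommGroup E] [NormedSpace ℝ E] [FiniteDimensional ℝ E]
  [NormedAddCommGroup F] [NormedSpace ℝ F] [CompleteSpace F]

/-- The radial primitive of a one-form. -/
def radialPrimitive (θ : E → E →L[ℝ] F) (x : E) : F := ∫ t in (0 : ℝ)..1, θ (t • x) x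

/-- The derivative of the integrand of the radial primitive. -/
def radialDeriv (θ : E → E →L[ℝ] F) (x : E) (t : ℝ) : E →L[ℝ] F :=
  θ (t • x) + t • (fderiv ℝ θ (t • x)).flip x

omit [FiniteDimensional ℝ E] [CompleteSpace F] in
theorem continuous_radialDeriv {θ : E → E →L[ℝ] F} (hθ : ContDiff ℝ 1 θ) :
    Continuous (Function.uncurry (radialDeriv θ)) := by
  have h1 : Continuous θ := hθ.continuous
  have h2 : Continuous (fderiv ℝ θ) := hθ.continuous_fderiv one_ne_zero
  have h3 : Continuous fun p : E × ℝ => (fderiv ℝ θ (p.2 • p.1)).flip :=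
    (ContinuousLinearMap.flipₗᵢ ℝ E E F).continuous.comp (h2.comp (by fun_prop))
  unfold radialDeriv Function.uncurry
  exact (h1.comp (by fun_prop)).add (continuous_snd.smul (h3.clm_apply continuous_fst))

omit [CompleteSpace F] in
-- Differentiation under the integral sign. In finite dimension the closed unit ball around `x`
-- times `[0, 1]` is compact, which supplies a constant dominating function.
theorem hasFDerivAt_radialPrimitive {θ : E → E →L[ℝ] F} (hθ : ContDiff ℝ 1 θ) (x : E) :
    HasFDerivAt (radialPrimitive θ) (∫ t in (0 : ℝ)..1, radialDeriv θ x t) x := by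
  have hc := continuous_radialDeriv hθ
  have hF : Continuous fun p : E × ℝ => θ (p.2 • p.1) p.1 :=
    (hθ.continuous.comp (by fun_prop)).clm_apply continuous_fst
  obtain ⟨C, hC⟩ := ((isCompact_closedBall x 1).prod (isCompact_Icc (a := (0 : ℝ)) (b := 1))).exists_bound_of_continuousOn
    hc.continuousOn
  refine intervalIntegral.hasFDerivAt_integral_of_dominated_of_fderiv_le
    (F := fun y t => θ (t • y) y) (F' := radialDeriv θ) (bound := fun _ => C)
    (ball_mem_nhds x one_pos) ?_ ?_ ?_ ?_ ?_ ?_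
  · exact Eventually.of_forall fun y =>
      (hF.comp (by fun_prop : Continuous fun t : ℝ => (y, t))).aestronglyMeasurable
  · exact (hF.comp (by fun_prop : Continuous fun t : ℝ => (x, t))).intervalIntegrable _ _
  · exact (hc.comp (by fun_prop : Continuous fun t : ℝ => (x, t))).aestronglyMeasurable
  · refine Eventually.of_forall fun t ht y hy => ?_
    rw [uIoc_of_le zero_le_one] at ht
    exact hC (y, t) ⟨ball_subset_closedBall hy, ht.1.le, ht.2⟩
  · simp
  · refine Eventually.of_forall fun t _ y _ => ?_
    have h1 : HasFDerivAt (fun y : E => t • y) (t • ContinuousLinearMap.id ℝ E) y :=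
      (hasFDerivAt_id y).const_smul t
    have h2 := ((hθ.differentiable one_ne_zero).differentiableAt (x := t • y)).hasFDerivAt.comp y h1
    have h3 := h2.clm_apply (hasFDerivAt_id y)
    refine h3.congr_fderiv ?_
    ext v
    simp [radialDeriv]

omit [CompleteSpace F] in
theorem contDiff_radialPrimitive {θ : E → E →L[ℝ] F} (hθ : ContDiff ℝ 1 θ) :
    ContDiff ℝ 1 (radialPrimitive θ) := by
  rw [contDiff_one_iff_fderiv]
  refine ⟨fun x => (hasFDerivAt_radialPrimitive hθ x).differentiableAt, ?_⟩
  have : fderiv ℝ (radialPrimitive θ) = fun x => ∫ t in (0 : ℝ)..1, radialDeriv θ x t :=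
    funext fun x => (hasFDerivAt_radialPrimitive hθ x).fderiv
  rw [this]
  exact intervalIntegral.continuous_parametric_intervalIntegral_of_continuous' (continuous_radialDeriv hθ) 0 1

/-- The derivative of the radial primitive of `θ` differs from `θ` by an average of `dθ`. -/
theorem norm_fderiv_radialPrimitive_sub_le {θ : E → E →L[ℝ] F} (hθ : ContDiff ℝ 1 θ) {r K : ℝ}
    (hK : ∀ y ∈ ball (0 : E) r, ∀ v w, ‖fderiv ℝ θ y v w - fderiv ℝ θ y w v‖ ≤ K * ‖v‖ * ‖w‖)
    (hK0 : 0 ≤ K) {x : E} (hx : x ∈ ball (0 : E) r) :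
    ‖fderiv ℝ (radialPrimitive θ) x - θ x‖ ≤ K * r := by
  have hr : 0 ≤ r := (norm_nonneg x).trans (mem_ball_zero_iff.1 hx).le
  refine ContinuousLinearMap.opNorm_le_bound _ (by positivity) fun v => ?_
  have hc : Continuous fun t : ℝ => radialDeriv θ x t :=
    (continuous_radialDeriv hθ).comp (by fun_prop : Continuous fun t : ℝ => (x, t))
  have h1 : Continuous θ := hθ.continuous
  have h2 : Continuous (fderiv ℝ θ) := hθ.continuous_fderiv one_ne_zero
  have h2' : Continuous fun t : ℝ => fderiv ℝ θ (t • x) x v :=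
    ((h2.comp (by fun_prop)).clm_apply continuous_const).clm_apply continuous_const
  have h3' : Continuous fun t : ℝ => θ (t • x) v := (h1.comp (by fun_prop)).clm_apply continuous_const
  -- This integrates the `t`-derivative of `t • θ (t • x) v`. Subtracting it from the derivative of
  -- the primitive leaves only the antisymmetrized derivative of `θ`, as in the Poincaré lemma.
  have hftc : ∫ t in (0 : ℝ)..1, (θ (t • x) v + t • fderiv ℝ θ (t • x) x v) = θ x v := by
    have := intervalIntegral.integral_eq_sub_of_hasDerivAt (a := 0) (b := 1)
      (f := fun t : ℝ => t • θ (t • x) v)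
      (f' := fun t => θ (t • x) v + t • fderiv ℝ θ (t • x) x v) (fun t _ => ?_)
      (Continuous.intervalIntegrable (by fun_prop) _ _)
    · simpa using this
    · have e1 : HasDerivAt (fun t : ℝ => t • x) x t := by
        simpa using (hasDerivAt_id t).smul_const x
      have e2 := ((hθ.differentiable one_ne_zero).differentiableAt (x := t • x)).hasFDerivAt.comp_hasDerivAt t e1
      have e3 := (hasDerivAt_id t).smul (e2.clm_apply (hasDerivAt_const t v))
      refine e3.congr_deriv ?_
      simp [add_comm]
  have e : (fderiv ℝ (radialPrimitive θ) x - θ x) v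
      = ∫ t in (0 : ℝ)..1, t • (fderiv ℝ θ (t • x) v x - fderiv ℝ θ (t • x) x v) := by
    rw [(hasFDerivAt_radialPrimitive hθ x).fderiv, _root_.sub_apply,
      ContinuousLinearMap.intervalIntegral_apply (hc.intervalIntegrable _ _), ← hftc,
      ← intervalIntegral.integral_sub]
    · refine intervalIntegral.integral_congr fun t _ => ?_
      simp only [radialDeriv, _root_.add_apply, _root_.smul_apply,
        ContinuousLinearMap.flip_apply, smul_sub]
      abel
    · exact (hc.clm_apply continuous_const).intervalIntegrable _ _
    · exact Continuous.intervalIntegrable (by fun_prop) _ _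
  rw [e]
  refine (intervalIntegral.norm_integral_le_of_norm_le_const (C := K * r * ‖v‖) fun t ht => ?_).trans
    (by simp)
  rw [uIoc_of_le zero_le_one] at ht
  rw [norm_smul, Real.norm_of_nonneg ht.1.le]
  have hxr := mem_ball_zero_iff.1 hx
  have hb : t • x ∈ ball (0 : E) r := by
    rw [mem_ball_zero_iff, norm_smul, Real.norm_of_nonneg ht.1.le]
    exact (mul_le_of_le_one_left (norm_nonneg _) ht.2).trans_lt hxr
  calc t * _ ≤ 1 * (K * ‖v‖ * ‖x‖) := by
        gcongr
        · exact ht.2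
        · exact hK _ hb v x
    _ ≤ K * r * ‖v‖ := by
        rw [one_mul, mul_assoc, mul_assoc, mul_comm r]
        gcongr

variable (Γ : E → E →L[ℝ] F →L[ℝ] F) (y₀ : F)

variable (E F) in
/-- `ContinuousLinearMap.flip` as a continuous linear map. -/
def flipCLM : (E →L[ℝ] F →L[ℝ] F) →L[ℝ] (F →L[ℝ] E →L[ℝ] F) :=
  (ContinuousLinearMap.flipₗᵢ ℝ E F F).toContinuousLinearEquiv.toContinuousLinearMap

/-- The one-form `-Γ Y`. -/
def connForm (Y : E → F) (x : E) : E →L[ℝ] F := -(Γ x).flip (Y x)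

/-- Picard iterates for `dY = -Γ Y`, `Y 0 = y₀`. -/
def parallelIterate : ℕ → E → F
  | 0 => fun _ => y₀
  | k + 1 => fun x => y₀ + radialPrimitive (connForm Γ (parallelIterate k)) x

variable {Γ}

omit [FiniteDimensional ℝ E] [CompleteSpace F] in
theorem contDiff_connForm (hΓ : ContDiff ℝ 1 Γ) {Y : E → F} (hY : ContDiff ℝ 1 Y) :
    ContDiff ℝ 1 (connForm Γ Y) := by
  have : ContDiff ℝ 1 fun x => flipCLM E F (Γ x) :=
    ContDiff.comp (g := flipCLM E F) (by fun_prop) hΓ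
  exact (this.clm_apply hY).neg

omit [CompleteSpace F] in
theorem contDiff_parallelIterate (hΓ : ContDiff ℝ 1 Γ) (k : ℕ) :
    ContDiff ℝ 1 (parallelIterate Γ y₀ k) := by
  induction k with
  | zero => exact contDiff_const
  | succ k ih => exact contDiff_const.add (contDiff_radialPrimitive (contDiff_connForm hΓ ih))

omit [FiniteDimensional ℝ E] [CompleteSpace F] in
theorem fderiv_connForm (hΓ : ContDiff ℝ 1 Γ) {Y : E → F} (hY : ContDiff ℝ 1 Y) (x v w : E) :
    fderiv ℝ (connForm Γ Y) x v w = -(fderiv ℝ Γ x v w (Y x) + Γ x w (fderiv ℝ Y x v)) := by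
  have h1 := ((hΓ.differentiable one_ne_zero).differentiableAt (x := x)).hasFDerivAt
  have h2 := ((hY.differentiable one_ne_zero).differentiableAt (x := x)).hasFDerivAt
  have h3 := (HasFDerivAt.comp (g := flipCLM E F) x ((flipCLM E F).hasFDerivAt (x := Γ x))
    h1).clm_apply h2
  have h4 : HasFDerivAt (connForm Γ Y) _ x := h3.neg
  rw [h4.fderiv]
  simp [add_comm, flipCLM]

/-- Local solvability of `dY = -Γ Y` for a flat connection form `Γ`. -/
theorem exists_parallel_of_flat (hΓ : ContDiff ℝ 1 Γ)
    (hflat : ∀ᶠ x in 𝓝 (0 : E), ∀ v w, fderiv ℝ Γ x v w - fderiv ℝ Γ x w v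
      + (Γ x v ∘L Γ x w - Γ x w ∘L Γ x v) = 0) :
    ∃ r > 0, ∀ y₀ : F, ∃ Y : E → F, Y 0 = y₀ ∧
      ∀ x ∈ ball (0 : E) r, HasFDerivAt Y (connForm Γ Y x) x := by
  obtain ⟨ρ, hρ, hflat⟩ := Metric.eventually_nhds_iff_ball.1 hflat
  obtain ⟨C₀, hC₀⟩ := IsCompact.exists_bound_of_continuousOn
    (E := E →L[ℝ] F →L[ℝ] F) (isCompact_closedBall (0 : E) 1) hΓ.continuous.continuousOn
  set C := max C₀ 1
  have hC1 : 1 ≤ C := le_max_right _ _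
  have hC : ∀ x ∈ closedBall (0 : E) 1, ‖Γ x‖ ≤ C := fun x hx => (hC₀ x hx).trans (le_max_left _ _)
  -- The factor `8` makes both contraction factors, `C * r` in `hstep` and `2 * C * r` in `hdev`, at
  -- most `1 / 4`. Since `C ≥ 1`, also `r ≤ 1`, so the bound on `Γ` over the unit ball applies.
  set r := min ρ (1 / (8 * C)) with hr
  have hr0 : 0 < r := lt_min hρ (by positivity)
  have hrC : 8 * C * r ≤ 1 := by
    have : r ≤ 1 / (8 * C) := min_le_right _ _
    rw [le_div_iff₀ (by positivity)] at this
    linarith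
  have hr1 : r ≤ 1 := by nlinarith
  refine ⟨r, hr0, fun y₀ => ?_⟩
  have hΓr : ∀ x ∈ ball (0 : E) r, ‖Γ x‖ ≤ C := fun x hx =>
    hC x (ball_subset_closedBall (ball_subset_ball hr1 hx))
  set Y := parallelIterate Γ y₀ with hY
  have hYs : ∀ k, ContDiff ℝ 1 (Y k) := contDiff_parallelIterate y₀ hΓ
  have hY0 : ∀ k, Y k 0 = y₀ := by
    intro k
    cases k with
    | zero => rfl
    | succ k => simp [hY, parallelIterate, radialPrimitive]
  have hstep : ∀ k, ∀ x ∈ ball (0 : E) r, ‖Y (k + 1) x - Y k x‖ ≤ ‖y₀‖ * (1 / 4) ^ k := by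
    intro k
    induction k with
    | zero =>
      intro x hx
      have hxr := mem_ball_zero_iff.1 hx
      have : Y 1 x - Y 0 x = ∫ t in (0 : ℝ)..1, connForm Γ (Y 0) (t • x) x := by
        simp [hY, parallelIterate, radialPrimitive]
      rw [this]
      refine (intervalIntegral.norm_integral_le_of_norm_le_const (C := ‖y₀‖) fun t ht => ?_).trans
        (by simp)
      rw [uIoc_of_le zero_le_one] at ht
      have hb : t • x ∈ ball (0 : E) r := by
        rw [mem_ball_zero_iff, norm_smul, Real.norm_of_nonneg ht.1.le]
        exact (mul_le_of_le_one_left (norm_nonneg _) ht.2).trans_lt hxr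
      calc ‖connForm Γ (Y 0) (t • x) x‖ = ‖Γ (t • x) x y₀‖ := by
            simp [connForm, hY, parallelIterate]
        _ ≤ ‖Γ (t • x)‖ * ‖x‖ * ‖y₀‖ := ContinuousLinearMap.le_opNorm₂ _ _ _
        _ ≤ C * r * ‖y₀‖ := by gcongr; exact hΓr _ hb
        _ ≤ 1 * ‖y₀‖ := by gcongr; nlinarith
        _ = ‖y₀‖ := one_mul _
    | succ k ih =>
      intro x hx
      have hxr := mem_ball_zero_iff.1 hx
      have hi : ∀ j, IntervalIntegrable (fun t : ℝ => connForm Γ (Y j) (t • x) x) volume 0 1 :=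
        fun j => Continuous.intervalIntegrable
          (((contDiff_connForm hΓ (hYs j)).continuous.comp (by fun_prop)).clm_apply
            continuous_const) _ _
      have : Y (k + 1 + 1) x - Y (k + 1) x = ∫ t in (0 : ℝ)..1,
          (connForm Γ (Y (k + 1)) (t • x) x - connForm Γ (Y k) (t • x) x) := by
        rw [intervalIntegral.integral_sub (hi _) (hi _)]
        simp [hY, parallelIterate, radialPrimitive]
      rw [this]
      refine (intervalIntegral.norm_integral_le_of_norm_le_const (C := ‖y₀‖ * (1 / 4) ^ (k + 1))
        fun t ht => ?_).trans (by simp)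
      rw [uIoc_of_le zero_le_one] at ht
      have hb : t • x ∈ ball (0 : E) r := by
        rw [mem_ball_zero_iff, norm_smul, Real.norm_of_nonneg ht.1.le]
        exact (mul_le_of_le_one_left (norm_nonneg _) ht.2).trans_lt hxr
      calc _ = ‖Γ (t • x) x (Y (k + 1) (t • x) - Y k (t • x))‖ := by
            rw [← norm_neg]; simp [connForm]; congr 1; abel
        _ ≤ ‖Γ (t • x)‖ * ‖x‖ * ‖Y (k + 1) (t • x) - Y k (t • x)‖ :=
            ContinuousLinearMap.le_opNorm₂ _ _ _
        _ ≤ C * r * (‖y₀‖ * (1 / 4) ^ k) := by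
            gcongr
            · exact hΓr _ hb
            · exact ih _ hb
        _ ≤ (1 / 4) * (‖y₀‖ * (1 / 4) ^ k) := by gcongr; nlinarith
        _ = ‖y₀‖ * (1 / 4) ^ (k + 1) := by ring
  -- Chosen so that `C * ‖y₀‖ = A / 4`: the two error terms of the induction in `hdev` then add up
  -- to at most half of the previous bound.
  set A := 4 * C * ‖y₀‖ with hA
  have hA0 : 0 ≤ A := by positivity
  have hdev : ∀ k, ∀ x ∈ ball (0 : E) r,
      ‖fderiv ℝ (Y k) x - connForm Γ (Y k) x‖ ≤ A * (1 / 2) ^ k := by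
    intro k
    induction k with
    | zero =>
      intro x hx
      have : fderiv ℝ (Y 0) x = 0 := by simp [hY, parallelIterate]
      rw [this, zero_sub, norm_neg, connForm, norm_neg]
      calc ‖(Γ x).flip (Y 0 x)‖ ≤ ‖(Γ x).flip‖ * ‖y₀‖ := ContinuousLinearMap.le_opNorm _ _
        _ ≤ C * ‖y₀‖ := by rw [ContinuousLinearMap.opNorm_flip]; gcongr; exact hΓr x hx
        _ ≤ A * (1 / 2) ^ 0 := by rw [hA]; nlinarith [norm_nonneg y₀, mul_nonneg (by positivity : 0 ≤ C) (norm_nonneg y₀)]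
    | succ k ih =>
      intro x hx
      have hYk := hYs k
      have h1 : fderiv ℝ (Y (k + 1)) x = fderiv ℝ (radialPrimitive (connForm Γ (Y k))) x := by
        simp only [hY, parallelIterate]
        rw [fderiv_const_add]
      have h2 : ‖fderiv ℝ (radialPrimitive (connForm Γ (Y k))) x - connForm Γ (Y k) x‖
          ≤ (2 * C * (A * (1 / 2) ^ k)) * r := by
        refine norm_fderiv_radialPrimitive_sub_le (contDiff_connForm hΓ hYk) ?_ (by positivity) hx
        intro y hy v w
        have hfl := congrArg (fun T => T (Y k y)) (hflat y (ball_subset_ball (min_le_left _ _) hy) v w)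
        simp only [_root_.add_apply, _root_.sub_apply,
          ContinuousLinearMap.comp_apply, _root_.zero_apply] at hfl
        -- Here flatness enters. The curvature terms cancel, and the exterior derivative of `-Γ Y`
        -- is `Γ` applied to the defect of the current iterate, which the induction hypothesis
        -- controls.
        have e : fderiv ℝ (connForm Γ (Y k)) y v w - fderiv ℝ (connForm Γ (Y k)) y w v
            = Γ y v ((fderiv ℝ (Y k) y - connForm Γ (Y k) y) w)
              - Γ y w ((fderiv ℝ (Y k) y - connForm Γ (Y k) y) v) := by
          rw [fderiv_connForm hΓ hYk, fderiv_connForm hΓ hYk]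
          have ed : ∀ z, (fderiv ℝ (Y k) y - connForm Γ (Y k) y) z
              = fderiv ℝ (Y k) y z + Γ y z (Y k y) := fun z => by simp [connForm]
          rw [ed, ed, map_add, map_add, ← sub_eq_zero, ← neg_eq_zero, ← hfl]
          abel
        have hb : ∀ a b, ‖Γ y a ((fderiv ℝ (Y k) y - connForm Γ (Y k) y) b)‖
            ≤ C * ‖a‖ * (A * (1 / 2) ^ k * ‖b‖) := fun a b =>
          (ContinuousLinearMap.le_opNorm₂ _ _ _).trans (by
            gcongr
            · exact hΓr _ hy
            · exact (ContinuousLinearMap.le_opNorm _ _).trans (by gcongr; exact ih y hy))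
        rw [e]
        calc _ ≤ C * ‖v‖ * (A * (1 / 2) ^ k * ‖w‖) + C * ‖w‖ * (A * (1 / 2) ^ k * ‖v‖) :=
              (norm_sub_le _ _).trans (add_le_add (hb v w) (hb w v))
          _ = _ := by ring
      have h3 : ‖connForm Γ (Y k) x - connForm Γ (Y (k + 1)) x‖ ≤ C * (‖y₀‖ * (1 / 4) ^ k) := by
        have : connForm Γ (Y k) x - connForm Γ (Y (k + 1)) x
            = (Γ x).flip (Y (k + 1) x - Y k x) := by
          simp only [connForm, map_sub]; abel
        rw [this]
        refine (ContinuousLinearMap.le_opNorm _ _).trans ?_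
        rw [ContinuousLinearMap.opNorm_flip]
        gcongr
        · exact hΓr x hx
        · exact hstep k x hx
      rw [h1]
      calc _ = ‖(fderiv ℝ (radialPrimitive (connForm Γ (Y k))) x - connForm Γ (Y k) x)
              + (connForm Γ (Y k) x - connForm Γ (Y (k + 1)) x)‖ := by congr 1; abel
        _ ≤ 2 * C * (A * (1 / 2) ^ k) * r + C * (‖y₀‖ * (1 / 4) ^ k) :=
            (norm_add_le _ _).trans (add_le_add h2 h3)
        _ ≤ (1 / 4) * (A * (1 / 2) ^ k) + C * (‖y₀‖ * (1 / 2) ^ k) := by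
            gcongr ?_ + _ * (_ * ?_)
            · calc 2 * C * (A * (1 / 2) ^ k) * r = (2 * C * r) * (A * (1 / 2) ^ k) := by ring
                _ ≤ _ := by gcongr; nlinarith
            · gcongr; norm_num
        _ = A * (1 / 2) ^ (k + 1) := by rw [hA]; ring
  have hcau : ∀ x ∈ ball (0 : E) r, ∃ y, Tendsto (fun k => Y k x) atTop (𝓝 y) := fun x hx =>
    cauchySeq_tendsto_of_complete (cauchySeq_of_le_geometric (1 / 4) ‖y₀‖ (by norm_num) fun k => by
      rw [dist_comm, dist_eq_norm]; exact hstep k x hx)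
  choose! Yl hYl using hcau
  refine ⟨Yl, ?_, fun x hx => ?_⟩
  · refine tendsto_nhds_unique (hYl 0 (mem_ball_self hr0)) ?_
    simp [hY0]
  -- The derivatives of the iterates converge uniformly to `-Γ Yl`: their distance to it is the
  -- defect bound plus `C` times the geometric tail of the iterates.
  refine hasFDerivAt_of_tendstoUniformlyOn (f' := fun k => fderiv ℝ (Y k)) (g' := connForm Γ Yl)
    (l := atTop) isOpen_ball ?_
    (fun k z _ => (((hYs k).differentiable one_ne_zero) z).hasFDerivAt) hYl hx
  have hlim : Tendsto (fun k : ℕ => A * (1 / 2 : ℝ) ^ k + C * (‖y₀‖ * (1 / 4) ^ k / (1 - 1 / 4)))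
      atTop (𝓝 0) := by
    have e1 := tendsto_pow_atTop_nhds_zero_of_lt_one (r := (1 / 2 : ℝ)) (by norm_num) (by norm_num)
    have e2 := tendsto_pow_atTop_nhds_zero_of_lt_one (r := (1 / 4 : ℝ)) (by norm_num) (by norm_num)
    simpa using (e1.const_mul A).add ((((e2.const_mul ‖y₀‖).div_const (1 - 1 / 4)).const_mul C))
  rw [Metric.tendstoUniformlyOn_iff]
  intro ε hε
  filter_upwards [hlim.eventually_lt_const hε] with k hk z hz
  refine lt_of_le_of_lt ?_ hk
  have hd : ‖Y k z - Yl z‖ ≤ ‖y₀‖ * (1 / 4) ^ k / (1 - 1 / 4) := by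
    rw [← dist_eq_norm]
    exact dist_le_of_le_geometric_of_tendsto (1 / 4) ‖y₀‖ (by norm_num) (fun k => by
      rw [dist_comm, dist_eq_norm]; exact hstep k z hz) (hYl z hz) k
  have : fderiv ℝ (Y k) z - connForm Γ Yl z
      = (fderiv ℝ (Y k) z - connForm Γ (Y k) z) - (Γ z).flip (Y k z - Yl z) := by
    simp only [connForm, map_sub]; abel
  rw [dist_comm, dist_eq_norm, this]
  refine (norm_sub_le _ _).trans (add_le_add (hdev k z hz) ((ContinuousLinearMap.le_opNorm _ _).trans ?_))
  rw [ContinuousLinearMap.opNorm_flip]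
  gcongr
  exact hΓr z hz

end ParallelODE

end Tractor
end

noncomputable section
namespace Tractor

/-! ### Uniqueness and regularity of solutions of the parallel equation. -/

section ParallelUnique

open Set Filter Topology Metric

variable {E F : Type*} [NormedAddCommGroup E] [NormedSpace ℝ E]
  [NormedAddCommGroup F] [NormedSpace ℝ F] {Γ : E → E →L[ℝ] F →L[ℝ] F}

/-- A solution of `dY = -Γ Y` on a ball which vanishes at the centre is zero. -/
theorem eq_zero_of_parallel (hΓ : Continuous Γ) {c : E} {r : ℝ} {Y : E → F}
    (hY : ∀ x ∈ ball c r, HasFDerivAt Y (connForm Γ Y x) x) (h0 : Y c = 0) {x : E}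
    (hx : x ∈ ball c r) : Y x = 0 := by
  have hseg : ∀ t ∈ Icc (0 : ℝ) 1, c + t • (x - c) ∈ ball c r := by
    intro t ht
    rw [mem_ball_iff_norm, add_sub_cancel_left, norm_smul, Real.norm_of_nonneg ht.1]
    exact (mul_le_of_le_one_left (norm_nonneg _) ht.2).trans_lt (mem_ball_iff_norm.1 hx)
  have hl : ∀ t : ℝ, HasDerivAt (fun t : ℝ => c + t • (x - c)) (x - c) t := fun t => by
    simpa using ((hasDerivAt_id t).smul_const (x - c)).const_add c
  have hc : Continuous fun t : ℝ => Γ (c + t • (x - c)) := hΓ.comp (by fun_prop)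
  obtain ⟨C, hC⟩ := IsCompact.exists_bound_of_continuousOn (E := E →L[ℝ] F →L[ℝ] F)
    (isCompact_Icc (a := (0 : ℝ)) (b := 1)) hc.continuousOn
  have hd : ∀ t ∈ Icc (0 : ℝ) 1, HasDerivAt (fun t : ℝ => Y (c + t • (x - c)))
      (connForm Γ Y (c + t • (x - c)) (x - c)) t := fun t ht =>
    (hY _ (hseg t ht)).comp_hasDerivAt t (hl t)
  -- Along the segment from `c` to `x` the equation is a linear ODE with bounded coefficient, so
  -- Grönwall's inequality applies.
  have := eq_zero_of_abs_deriv_le_mul_abs_self_of_eq_zero_right (a := 0) (b := 1)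
    (K := C * ‖x - c‖) (f := fun t : ℝ => Y (c + t • (x - c)))
    (fun t ht => (hd t ht).continuousAt.continuousWithinAt)
    (fun t ht => (hd t (Ico_subset_Icc_self ht)).hasDerivWithinAt) (by simpa using h0) (by
      intro t ht
      have h1 : ‖connForm Γ Y (c + t • (x - c)) (x - c)‖
          = ‖Γ (c + t • (x - c)) (x - c) (Y (c + t • (x - c)))‖ := by
        rw [connForm, _root_.neg_apply, norm_neg, ContinuousLinearMap.flip_apply]
      rw [h1]
      refine (ContinuousLinearMap.le_opNorm₂ _ _ _).trans ?_
      gcongr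
      exact hC t (Ico_subset_Icc_self ht)) 1 (by simp)
  simpa using this

/-- Bootstrapping: the derivative `-Γ Y` has as many continuous derivatives as `Y`, so `Y` has one
more. -/
theorem contDiffOn_of_parallel (hΓ : ContDiff ℝ ∞ Γ) {s : Set E} (hs : IsOpen s) {Y : E → F}
    (hY : ∀ x ∈ s, HasFDerivAt Y (connForm Γ Y x) x) : ContDiffOn ℝ ∞ Y s := by
  rw [contDiffOn_infty]
  intro k
  induction k with
  | zero =>
    simp only [Nat.cast_zero, contDiffOn_zero]
    exact fun x hx => (hY x hx).continuousAt.continuousWithinAt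
  | succ k ih =>
    rw [Nat.cast_add, Nat.cast_one, contDiffOn_succ_iff_fderiv_of_isOpen hs]
    refine ⟨fun x hx => (hY x hx).differentiableAt.differentiableWithinAt, by simp, ?_⟩
    have h1 : ContDiff ℝ k fun x => flipCLM E F (Γ x) :=
      ContDiff.comp (g := flipCLM E F) (by fun_prop) (hΓ.of_le (mod_cast le_top))
    exact (h1.contDiffOn.clm_apply ih).neg.congr fun x hx => (hY x hx).fderiv

/-- A function smooth near a point agrees near that point with a globally smooth one. -/
theorem exists_contDiff_eventuallyEq [FiniteDimensional ℝ E] {f : E → F} {c : E} {s : Set E}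
    (hs : s ∈ 𝓝 c) (hf : ContDiffOn ℝ ∞ f s) : ∃ g : E → F, ContDiff ℝ ∞ g ∧ g =ᶠ[𝓝 c] f := by
  obtain ⟨ρ, hρ, hρs⟩ := Metric.mem_nhds_iff.1 hs
  let χ : ContDiffBump c := ⟨ρ / 4, ρ / 2, by positivity, by linarith⟩
  refine ⟨fun x => χ x • f x, contDiff_iff_contDiffAt.2 fun x => ?_, ?_⟩
  · by_cases hx : x ∈ ball c ρ
    · exact χ.contDiff.contDiffAt.smul
        ((hf.mono hρs).contDiffAt (isOpen_ball.mem_nhds hx))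
    · refine (contDiffAt_const (c := (0 : F))).congr_of_eventuallyEq ?_
      have : {x | ρ / 2 < dist x c} ∈ 𝓝 x :=
        (isOpen_lt continuous_const (by fun_prop)).mem_nhds (by
          simp only [mem_ball, not_lt] at hx
          simp only [mem_ofPred_eq]; linarith)
      filter_upwards [this] with y hy
      rw [χ.zero_of_le_dist (le_of_lt hy), zero_smul]
  · filter_upwards [χ.eventuallyEq_one] with y hy
    simp [hy]

end ParallelUnique

/-! ### Global sections by the monodromy principle. -/

open Set Filter Topology in
/-- On a simply connected space a family of local parallel frames with locally constant transition
functions admits a global parallel section with a prescribed value at a point. -/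
theorem exists_global_section {X : Type*} [TopologicalSpace X] [SimplyConnectedSpace X]
    [LocallyPathConnectedSpace X] {E : X → Type*} {F : Type*} (U : X → Set X)
    (hU : ∀ p, IsOpen (U p)) (hmem : ∀ p, p ∈ U p) (Φ : ∀ _ x : X, F → E x)
    (hΦ : ∀ p, ∀ x ∈ U p, Function.Bijective (Φ p x))
    (hloc : ∀ p q, ∀ x ∈ U p ∩ U q, ∀ f f', Φ p x f = Φ q x f' → ∀ᶠ y in 𝓝 x, Φ p y f = Φ q y f')
    (x₀ : X) (e : E x₀) :
    ∃ s : ∀ x, E x, s x₀ = e ∧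
      ∀ p, ∀ x ∈ U p, ∃ f, ∀ᶠ y in 𝓝 x, s y = Φ p y f := by
  classical
  obtain ⟨f₀, hf₀⟩ := (hΦ x₀ x₀ (hmem x₀)).2 e
  have : Nonempty F := ⟨f₀⟩
  -- With the discrete topology on the space of frame coordinates, local constancy of the transition
  -- functions is continuity. The resulting fibre bundle is a covering of `X`, and parallel sections
  -- are its continuous sections.
  let _ : TopologicalSpace F := ⊥
  have : DiscreteTopology F := ⟨rfl⟩
  have hinv : ∀ p, ∀ x ∈ U p, ∀ v, Φ p x (Function.invFun (Φ p x) v) = v := fun p x hx v =>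
    Function.invFun_eq ((hΦ p x hx).2 v)
  let Z : FiberBundleCore X X F :=
    { baseSet := U
      isOpen_baseSet := hU
      indexAt := id
      mem_baseSet_at := hmem
      coordChange := fun i j x v => Function.invFun (Φ j x) (Φ i x v)
      coordChange_self := fun i x hx v => Function.leftInverse_invFun (hΦ i x hx).1 v
      continuousOn_coordChange := by
        rintro i j ⟨x, v⟩ ⟨hx, -⟩
        refine ContinuousAt.continuousWithinAt ?_
        rw [ContinuousAt, nhds_discrete F]
        refine tendsto_pure.2 ?_
        rw [nhds_prod_eq, nhds_discrete F, prod_pure, eventually_map]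
        filter_upwards [hloc i j x hx v _ (hinv j x hx.2 _).symm, (hU j).mem_nhds hx.2] with y hy hyj
        rw [hy, Function.leftInverse_invFun (hΦ j y hyj).1]
      coordChange_comp := by
        intro i j k x hx v
        rw [hinv j x hx.1.2] }
  have hcov : IsCoveringMap (Bundle.TotalSpace.proj : Bundle.TotalSpace F Z.Fiber → X) :=
    FiberBundle.isCoveringMap
  -- Lifting the identity map is where simple connectedness and local path connectedness are used.
  obtain ⟨σ, ⟨hσ0, hσ⟩, -⟩ := hcov.existsUnique_continuousMap_lifts (ContinuousMap.id X) x₀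
    (⟨x₀, f₀⟩ : Bundle.TotalSpace F Z.Fiber) rfl
  have hproj : ∀ y, (σ y).1 = y := fun y => congrFun hσ y
  -- The coordinates of the section at `y` in the frame indexed by `p`. On `U p` they are locally
  -- constant in `y`, while the section itself is read off in the frame indexed by `y`.
  let v : X → X → F := fun p y => (Z.localTriv p (σ y)).2
  have hv : ∀ p y, v p y = Function.invFun (Φ p y) (Φ y y (v y y)) := by
    intro p y
    have h1 : ∀ z : Bundle.TotalSpace F Z.Fiber, ∀ q,
        (Z.localTriv q z).2 = Function.invFun (Φ q z.1) (Φ z.1 z.1 z.2) := fun z q => rfl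
    have key : ∀ z : Bundle.TotalSpace F Z.Fiber, (Z.localTriv p z).2
        = Function.invFun (Φ p z.1) (Φ z.1 z.1 (Z.localTriv z.1 z).2) := by
      intro z
      rw [h1, h1, hinv z.1 z.1 (hmem z.1)]
    have := key (σ y)
    rwa [hproj y] at this
  refine ⟨fun y => Φ y y (v y y), ?_, fun p x hx => ⟨v p x, ?_⟩⟩
  · have : v x₀ x₀ = f₀ := by
      change (Z.localTriv x₀ (σ x₀)).2 = f₀
      rw [hσ0]
      exact Function.leftInverse_invFun (hΦ x₀ x₀ (hmem x₀)).1 f₀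
    change Φ x₀ x₀ (v x₀ x₀) = e
    rw [this, hf₀]
  · have hcont : ContinuousAt (v p) x := by
      refine continuous_snd.continuousAt.comp (ContinuousAt.comp ?_ σ.continuous.continuousAt)
      refine (Z.localTriv p).continuousAt ?_
      rw [Z.mem_localTriv_source, hproj]
      exact hx
    rw [ContinuousAt, nhds_discrete F] at hcont
    filter_upwards [tendsto_pure.1 hcont, (hU p).mem_nhds hx] with y hy hyp
    rw [← hy, hv p y, hinv p y hyp]

end Tractor
end

noncomputable section
namespace Tractor

/-! ### Parallel frames on a vector space. -/

section ParallelFrame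

open Set Filter Topology

variable {E F : Type*} [NormedAddCommGroup E] [NormedSpace ℝ E] [FiniteDimensional ℝ E]
  [NormedAddCommGroup F] [NormedSpace ℝ F] [FiniteDimensional ℝ F]

/-- A flat connection on a trivial bundle over a vector space has a parallel frame near a point. -/
theorem exists_parallel_matrix {Γ : E → E →L[ℝ] F →L[ℝ] F} (hΓ : ContDiff ℝ ∞ Γ) (c : E)
    (hflat : ∀ a v w, ∀ᶠ x in 𝓝 c, fderiv ℝ Γ x v w a - fderiv ℝ Γ x w v a
      + (Γ x v (Γ x w a) - Γ x w (Γ x v a)) = 0) :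
    ∃ A : E → F →L[ℝ] F, ContDiff ℝ ∞ A ∧ (∀ᶠ x in 𝓝 c, IsUnit (A x)) ∧
      ∀ᶠ x in 𝓝 c, ∀ f u, Γ x u (A x f) + fderiv ℝ (fun x => A x f) x u = 0 := by
  have : CompleteSpace F := FiniteDimensional.complete ℝ F
  let e := Module.finBasis ℝ E
  let b := Module.finBasis ℝ F
  have hshift : ∀ x, fderiv ℝ (fun x => Γ (x + c)) x = fderiv ℝ Γ (x + c) := fun x =>
    fderiv_comp_add_right (𝕜 := ℝ) (f := Γ) c
  have hfl : ∀ᶠ x in 𝓝 (0 : E), ∀ v w,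
      fderiv ℝ (fun x => Γ (x + c)) x v w - fderiv ℝ (fun x => Γ (x + c)) x w v
      + (Γ (x + c) v ∘L Γ (x + c) w - Γ (x + c) w ∘L Γ (x + c) v) = 0 := by
    -- The neighbourhood in `hflat` depends on the vectors. Restriction to finitely many basis
    -- vectors gives a common neighbourhood, and multilinearity extends the identity to all vectors.
    have h1 : ∀ᶠ x in 𝓝 c, ∀ i j k, fderiv ℝ Γ x (e i) (e j) (b k) - fderiv ℝ Γ x (e j) (e i) (b k)
      + (Γ x (e i) (Γ x (e j) (b k)) - Γ x (e j) (Γ x (e i) (b k))) = 0 :=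
      eventually_all.2 fun i => eventually_all.2 fun j => eventually_all.2 fun k =>
        hflat (b k) (e i) (e j)
    have h2 : Tendsto (fun x => x + c) (𝓝 0) (𝓝 c) := by
      have : Continuous fun x : E => x + c := by fun_prop
      simpa using this.tendsto 0
    filter_upwards [h2.eventually h1] with x hx v w
    rw [hshift]
    generalize x + c = y at *
    let L : E →ₗ[ℝ] E →ₗ[ℝ] (F →L[ℝ] F) :=
      LinearMap.mk₂ ℝ (fun v w => fderiv ℝ Γ y v w - fderiv ℝ Γ y w v
          + (Γ y v ∘L Γ y w - Γ y w ∘L Γ y v))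
        (fun v v' w => by
          ext1 f
          simp only [map_add, _root_.add_apply, _root_.sub_apply, ContinuousLinearMap.comp_apply]
          abel)
        (fun c v w => by
          ext1 f
          simp only [map_smul, _root_.smul_apply, _root_.add_apply, _root_.sub_apply,
            ContinuousLinearMap.comp_apply]
          module)
        (fun v w w' => by
          ext1 f
          simp only [map_add, _root_.add_apply, _root_.sub_apply, ContinuousLinearMap.comp_apply]
          abel)
        (fun c v w => by
          ext1 f
          simp only [map_smul, _root_.smul_apply, _root_.add_apply, _root_.sub_apply,
            ContinuousLinearMap.comp_apply]
          module)
    have hL : L = 0 := e.ext fun i => e.ext fun j => ContinuousLinearMap.coe_injective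
      (b.ext fun k => hx i j k)
    exact congrArg (fun A => A v w) hL
  have hΓ1 : ContDiff ℝ 1 fun x => Γ (x + c) :=
    (hΓ.comp (contDiff_id.add contDiff_const)).of_le (by simp)
  obtain ⟨r, hr, hY⟩ := exists_parallel_of_flat hΓ1 hfl
  choose Y hY0 hYd using fun k => hY (b k)
  have hYd' : ∀ k, ∀ x ∈ Metric.ball c r,
      HasFDerivAt (fun x => Y k (x - c)) (connForm Γ (fun x => Y k (x - c)) x) x := by
    intro k x hx
    have hx' : x - c ∈ Metric.ball (0 : E) r := by
      simpa [dist_eq_norm] using hx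
    have := (hYd k _ hx').comp x ((hasFDerivAt_id x).sub_const c)
    rw [ContinuousLinearMap.comp_id] at this
    simp only [connForm, sub_add_cancel] at this
    exact this
  -- The solutions are smooth only on a ball; they are replaced by globally smooth functions with
  -- the same germ at `c`.
  have hext := fun k => exists_contDiff_eventuallyEq (Metric.ball_mem_nhds c hr)
    (contDiffOn_of_parallel hΓ Metric.isOpen_ball (hYd' k))
  choose Z hZ hZe using hext
  have hZd : ∀ᶠ x in 𝓝 c, ∀ k, HasFDerivAt (Z k) (connForm Γ (Z k) x) x := by
    filter_upwards [eventually_all.2 fun k => (hZe k).eventuallyEq_nhds,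
      Metric.ball_mem_nhds c hr] with x h1 h2 k
    have h3 := (hYd' k x h2).congr_of_eventuallyEq (h1 k)
    have h4 : Z k x = Y k (x - c) := (h1 k).self_of_nhds
    rwa [connForm, ← h4] at h3
  have hZc : ∀ k, Z k c = b k := fun k => by
    have h4 : Z k c = Y k (c - c) := (hZe k).self_of_nhds
    rw [h4, sub_self, hY0]
  let A : E → F →L[ℝ] F := fun x => ∑ k, (b.coord k).toContinuousLinearMap.smulRight (Z k x)
  have hA : ∀ x f, A x f = ∑ k, b.repr f k • Z k x := by
    intro x f
    simp [A]
  have hAs : ContDiff ℝ ∞ A := ContDiff.sum fun k _ => contDiff_const.smulRight (hZ k)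
  have hAc : A c = 1 := by
    ext1 f
    rw [hA]
    simp only [hZc]
    exact b.sum_repr f
  refine ⟨A, hAs, ?_, ?_⟩
  · have : {B : F →L[ℝ] F | IsUnit B} ∈ 𝓝 (A c) :=
      Units.isOpen.mem_nhds (by rw [hAc]; exact isUnit_one)
    exact hAs.continuous.continuousAt.eventually this
  · filter_upwards [hZd] with x hx f u
    have : HasFDerivAt (fun x => A x f) (∑ k, b.repr f k • connForm Γ (Z k) x) x := by
      simp only [hA]
      exact HasFDerivAt.fun_sum fun k _ => (hx k).fun_const_smul _
    rw [this.fderiv, hA]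
    simp [connForm, map_sum]

end ParallelFrame
end Tractor
end

noncomputable section
namespace Tractor
variable {n : ℕ} {M : Type*} [TopologicalSpace M] [ChartedSpace (EuclideanSpace ℝ (Fin n)) M]
  [IsManifold (𝓡 n) ∞ M]

/-! ### Globally smooth functions and vector fields. -/

section SmoothFields

open Set Filter Topology

theorem natCast_le_infty (k : ℕ) : (k : WithTop ℕ∞) ≤ ∞ := mod_cast le_top

/-- The results on Lie brackets are stated for this regularity, which over `ℝ` is just `2`. -/
instance isManifold_minSmoothness_two : IsManifold (𝓡 n) (minSmoothness ℝ 2) M := by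
  rw [minSmoothness_of_isRCLikeNormedField]
  exact IsManifold.of_le (n := ∞) (natCast_le_infty 2)

instance isManifold_minSmoothness_three : IsManifold (𝓡 n) (minSmoothness ℝ 3) M := by
  rw [minSmoothness_of_isRCLikeNormedField]
  exact IsManifold.of_le (n := ∞) (natCast_le_infty 3)

/-- Smooth vector fields. -/
abbrev SmoothVF (X : ∀ p : M, TangentSpace (𝓡 n) p) : Prop :=
  ContMDiff (𝓡 n) (𝓡 n).tangent ∞ (fun p => (⟨p, X p⟩ : TangentBundle (𝓡 n) M))

variable (n) in
/-- Smooth functions. -/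
abbrev SmoothFn (f : M → ℝ) : Prop := ContMDiff (𝓡 n) 𝓘(ℝ) ∞ f

theorem SmoothVF.diffAt {X : ∀ p : M, TangentSpace (𝓡 n) p} (h : SmoothVF X) (p : M) : DiffAt X p :=
  ContMDiff.mdifferentiableAt h (by simp)

omit [IsManifold (𝓡 n) ∞ M] in
theorem SmoothFn.diffAt {f : M → ℝ} (h : SmoothFn n f) (p : M) :
    MDifferentiableAt (𝓡 n) 𝓘(ℝ) f p :=
  ContMDiff.mdifferentiableAt h (by simp)

theorem SmoothVF.add {X Y : ∀ p : M, TangentSpace (𝓡 n) p} (hX : SmoothVF X) (hY : SmoothVF Y) :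
    SmoothVF (X + Y) := ContMDiff.add_section hX hY

theorem SmoothVF.sub {X Y : ∀ p : M, TangentSpace (𝓡 n) p} (hX : SmoothVF X) (hY : SmoothVF Y) :
    SmoothVF (X - Y) := ContMDiff.sub_section hX hY

theorem SmoothVF.smul {f : M → ℝ} {X : ∀ p : M, TangentSpace (𝓡 n) p} (hf : SmoothFn n f)
    (hX : SmoothVF X) : SmoothVF (f • X) := ContMDiff.smul_section hf hX

theorem SmoothVF.zero : SmoothVF (0 : ∀ p : M, TangentSpace (𝓡 n) p) := contMDiff_zeroSection _ _

theorem SmoothVF.bracket {X Y : ∀ p : M, TangentSpace (𝓡 n) p} (hX : SmoothVF X)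
    (hY : SmoothVF Y) : SmoothVF (VectorField.mlieBracket (𝓡 n) X Y) := by
  have : IsManifold (𝓡 n) ((⊤ : ℕ∞) + 1) M := by
    rw [show (((⊤ : ℕ∞) : WithTop ℕ∞) + 1) = ∞ from rfl]; infer_instance
  exact ContDiff.mlieBracket_vectorField (m := ⊤) (n := ⊤) hX hY (by simp)

theorem SmoothVF.inner (g : RMetric n M) {X Y : ∀ p : M, TangentSpace (𝓡 n) p} (hX : SmoothVF X)
    (hY : SmoothVF Y) : SmoothFn n (fun p => g.inner p (X p) (Y p)) := by
  let _ : RiemannianBundle (fun p : M => TangentSpace (𝓡 n) p) := ⟨g.toRiemannianMetric⟩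
  exact ContMDiff.inner_bundle (E := fun p : M => TangentSpace (𝓡 n) p) hX hY

theorem SmoothVF.deriv {f : M → ℝ} {X : ∀ p : M, TangentSpace (𝓡 n) p} (hf : SmoothFn n f)
    (hX : SmoothVF X) : SmoothFn n (fun p => mvfderiv (𝓡 n) f p (X p)) := by
  have h1 : ContMDiff (𝓡 n).tangent 𝓘(ℝ).tangent ∞ (tangentMap (𝓡 n) 𝓘(ℝ) f) :=
    ContMDiff.contMDiff_tangentMap hf (by simp)
  have h2 := h1.comp hX
  intro p
  have h3 := ((contMDiffAt_totalSpace).1 (h2 p)).2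
  simp only [mfld_simps, tangentMap] at h3
  exact h3

variable [T2Space M]

theorem exists_cutoff {p : M} {s : Set M} (hs : s ∈ 𝓝 p) :
    ∃ χ : M → ℝ, SmoothFn n χ ∧ χ =ᶠ[𝓝 p] 1 ∧ tsupport χ ⊆ s := by
  obtain ⟨f, hf, -⟩ := (SmoothBumpFunction.nhds_basis_support (I := 𝓡 n) hs).mem_iff.1
    (univ_mem : (univ : Set M) ∈ 𝓝 p)
  exact ⟨f, f.contMDiff, f.eventuallyEq_one, hf⟩

/-- Multiplication by a cutoff function. Pointwise identities can thereby be tested on globally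
smooth fields alone. -/
theorem exists_smoothVF_eventuallyEq {p : M} {s : Set M} (hs : IsOpen s) (hp : p ∈ s)
    {X : ∀ p : M, TangentSpace (𝓡 n) p}
    (hX : ContMDiffOn (𝓡 n) (𝓡 n).tangent ∞ (fun p => (⟨p, X p⟩ : TangentBundle (𝓡 n) M)) s) :
    ∃ Y : ∀ p : M, TangentSpace (𝓡 n) p, SmoothVF Y ∧ Y =ᶠ[𝓝 p] X := by
  obtain ⟨χ, hχ, h1, h2⟩ := exists_cutoff (n := n) (hs.mem_nhds hp)
  refine ⟨χ • X, ContMDiffOn.smul_section_of_tsupport hχ.contMDiffOn hs h2 hX, ?_⟩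
  filter_upwards [h1] with q hq
  change χ q • X q = X q
  rw [hq]
  exact one_smul _ _

/-- The extension is constant in the trivialization at `p`, hence smooth over its base set. The germ
matters, not only the value, because `riemann` differentiates these extensions twice. -/
theorem exists_smoothVF_extendVec (p : M) (u : TangentSpace (𝓡 n) p) :
    ∃ Y : ∀ p : M, TangentSpace (𝓡 n) p, SmoothVF Y ∧ Y =ᶠ[𝓝 p] extendVec p u := by
  set t := trivializationAt (EuclideanSpace ℝ (Fin n)) (fun p : M => TangentSpace (𝓡 n) p) p
  refine exists_smoothVF_eventuallyEq t.open_baseSet (FiberBundle.mem_baseSet_trivializationAt' p) ?_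
  rw [t.contMDiffOn_section_baseSet_iff]
  refine (contMDiffOn_const (c := (t ⟨p, u⟩).2)).congr fun y hy => ?_
  have := congrArg Prod.snd (t.apply_mk_symm hy (t ⟨p, u⟩).2)
  exact this

theorem exists_smoothVF (p : M) (u : TangentSpace (𝓡 n) p) :
    ∃ Y : ∀ p : M, TangentSpace (𝓡 n) p, SmoothVF Y ∧ Y p = u := by
  obtain ⟨Y, hY, h⟩ := exists_smoothVF_extendVec p u
  exact ⟨Y, hY, h.self_of_nhds.trans (FiberBundle.extend_apply_self _ u)⟩

/-- An operation on smooth vector fields which is linear over smooth functions depends only on the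
value of the field at the point. -/
theorem eq_of_tensorial {V : Type*} [AddCommGroup V] [Module ℝ V] {p : M}
    (A : (∀ p : M, TangentSpace (𝓡 n) p) → V)
    (hadd : ∀ X Y, SmoothVF X → SmoothVF Y → A (X + Y) = A X + A Y)
    (hsmul : ∀ (f : M → ℝ) X, SmoothFn n f → SmoothVF X → A (f • X) = f p • A X)
    {X Y : ∀ p : M, TangentSpace (𝓡 n) p} (hX : SmoothVF X) (hY : SmoothVF Y) (h : X p = Y p) :
    A X = A Y := by
  suffices H : ∀ Z, SmoothVF Z → Z p = 0 → A Z = 0 by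
    have hd := H (X - Y) (hX.sub hY) (by simp [h])
    have := hadd (X - Y) Y (hX.sub hY) hY
    rw [sub_add_cancel, hd, zero_add] at this
    exact this
  intro Z hZ hZp
  set t := trivializationAt (EuclideanSpace ℝ (Fin n)) (fun p : M => TangentSpace (𝓡 n) p) p
  have hpt : p ∈ t.baseSet := FiberBundle.mem_baseSet_trivializationAt' p
  let b := (EuclideanSpace.basisFun (Fin n) ℝ).toBasis
  obtain ⟨χ, hχ, h1, h2⟩ := exists_cutoff (n := n) (t.open_baseSet.mem_nhds hpt)
  let c : Fin n → M → ℝ := fun i q => t.localFrameCoeff (𝓡 n) b i q (Z q)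
  have hc : ∀ i, SmoothFn n (fun q => χ q * c i q) := fun i => by
    refine contMDiff_of_tsupport fun q hq => ?_
    have hq' : q ∈ t.baseSet := h2 (tsupport_mul_subset_left hq)
    exact (hχ q).mul (contMDiffAt_localFrameCoeff b hq' (hZ q) i)
  have hW : ∀ i, SmoothVF (χ • t.localFrame b i) := fun i =>
    ContMDiffOn.smul_section_of_tsupport hχ.contMDiffOn t.open_baseSet h2
      (t.contMDiffOn_localFrame_baseSet (I := 𝓡 n) ∞ b i)
  have hA0 : A 0 = 0 := by
    have := hadd 0 0 SmoothVF.zero SmoothVF.zero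
    simpa using this
  have hsum : ∀ s : Finset (Fin n), SmoothVF (∑ i ∈ s, (fun q => χ q * c i q) • (χ • t.localFrame b i)) ∧
      A (∑ i ∈ s, (fun q => χ q * c i q) • (χ • t.localFrame b i))
        = ∑ i ∈ s, (χ p * c i p) • A (χ • t.localFrame b i) := by
    intro s
    induction s using Finset.induction_on with
    | empty => exact ⟨by simpa using SmoothVF.zero, by simpa using hA0⟩
    | insert i s hi ih =>
      have hs := SmoothVF.smul (hc i) (hW i)
      rw [Finset.sum_insert hi, Finset.sum_insert hi]
      refine ⟨hs.add ih.1, ?_⟩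
      rw [hadd _ _ hs ih.1, ih.2, hsmul _ _ (hc i) (hW i)]
  have hχ2 : SmoothFn n (fun q => 1 - χ q * χ q) := contMDiff_const.sub (hχ.mul hχ)
  -- Coefficients and frame are cut off separately so that each is globally smooth, whence `χ²`.
  -- Both the coefficients `c i` and the factor `1 - χ²` of the remainder vanish at `p`.
  have hdec : Z = (∑ i, (fun q => χ q * c i q) • (χ • t.localFrame b i))
      + (fun q => 1 - χ q * χ q) • Z := by
    funext q
    simp only [Pi.add_apply, Finset.sum_apply, Pi.smul_apply']
    by_cases hq : q ∈ t.baseSet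
    · have := t.eq_sum_localFrameCoeff_smul (I := 𝓡 n) (b := b) (s := Z) hq
      have e : ∑ i, (χ q * c i q) • χ q • t.localFrame b i q = (χ q * χ q) • Z q := by
        conv_rhs => rw [this, Finset.smul_sum]
        refine Finset.sum_congr rfl fun i _ => ?_
        simp only [smul_smul, c]
        congr 1; ring
      rw [e, sub_smul, one_smul, add_sub_cancel]
    · have : χ q = 0 := image_eq_zero_of_notMem_tsupport fun hq' => hq (h2 hq')
      simp [this]
  rw [hdec, hadd _ _ (hsum _).1 (SmoothVF.smul hχ2 hZ), (hsum _).2, hsmul _ _ hχ2 hZ]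
  have hχp : χ p = 1 := h1.self_of_nhds
  have : ∀ i, c i p = 0 := fun i => by simp [c, hZp]
  simp [hχp, this]

variable (X Z : ∀ p : M, TangentSpace (𝓡 n) p)

/-- The Lie bracket acts on functions as the commutator. -/
theorem mvfderiv_mlieBracket {X Z : ∀ p : M, TangentSpace (𝓡 n) p} (hX : SmoothVF X)
    (hZ : SmoothVF Z) {f : M → ℝ} (hf : SmoothFn n f) (p : M) :
    mvfderiv (𝓡 n) f p (VectorField.mlieBracket (𝓡 n) X Z p)
      = mvfderiv (𝓡 n) (fun q => mvfderiv (𝓡 n) f q (Z q)) p (X p)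
        - mvfderiv (𝓡 n) (fun q => mvfderiv (𝓡 n) f q (X q)) p (Z p) := by
  -- The argument below needs a nonzero tangent vector, so dimension zero is separate.
  rcases Nat.eq_zero_or_pos n with h0 | hn
  · subst h0
    have hs : ∀ u : TangentSpace (𝓡 0) p, u = 0 := fun u =>
      (inferInstance : Subsingleton (EuclideanSpace ℝ (Fin 0))).elim u 0
    rw [hs (VectorField.mlieBracket _ X Z p), hs (X p), hs (Z p)]
    simp
  let u : TangentSpace (𝓡 n) p := tangentBasis p ⟨0, hn⟩
  have hu : u ≠ 0 := (tangentBasis p).ne_zero _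
  obtain ⟨W, hW, hWp⟩ := exists_smoothVF p u
  have key : ∀ (Y : ∀ p : M, TangentSpace (𝓡 n) p) (k : M → ℝ), SmoothFn n k →
      ∀ (W : ∀ p : M, TangentSpace (𝓡 n) p), SmoothVF W →
      VectorField.mlieBracket (𝓡 n) Y (k • W)
        = k • VectorField.mlieBracket (𝓡 n) Y W + (fun q => mvfderiv (𝓡 n) k q (Y q)) • W := by
    intro Y k hk W hW
    funext q
    rw [VectorField.mlieBracket_smul_right (hk.diffAt q) (hW.diffAt q)]
    simp [Pi.smul_apply', add_comm]
  have h2 : ∀ {Y : ∀ p : M, TangentSpace (𝓡 n) p}, SmoothVF Y →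
      ContMDiff (𝓡 n) (𝓡 n).tangent (minSmoothness ℝ 2)
        (fun p => (⟨p, Y p⟩ : TangentBundle (𝓡 n) M)) := fun hY => by
    rw [minSmoothness_of_isRCLikeNormedField]
    exact ContMDiff.of_le hY (natCast_le_infty 2)
  -- Expanding the Jacobi identity for `X`, `Z`, `f W` by the Leibniz rule and removing `f` times
  -- the one for `X`, `Z`, `W` leaves the claimed identity as the coefficient of `W`, which is
  -- nonzero at `p`.
  have J1 := VectorField.leibniz_identity_mlieBracket (h2 hX) (h2 hZ) (h2 (SmoothVF.smul hf hW))
  have J0 := VectorField.leibniz_identity_mlieBracket (h2 hX) (h2 hZ) (h2 hW)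
  have hXW := hX.bracket hW
  have hZW := hZ.bracket hW
  have hfX := SmoothVF.deriv hf hX
  have hfZ := SmoothVF.deriv hf hZ
  have J1p := congrFun J1 p
  have add_r : ∀ {Y A B : ∀ p : M, TangentSpace (𝓡 n) p}, SmoothVF A → SmoothVF B →
      VectorField.mlieBracket (𝓡 n) Y (A + B)
        = VectorField.mlieBracket (𝓡 n) Y A + VectorField.mlieBracket (𝓡 n) Y B := by
    intro Y A B hA hB
    funext q
    exact VectorField.mlieBracket_add_right (hA.diffAt q) (hB.diffAt q)
  rw [key Z f hf W hW, key X f hf W hW, key _ f hf W hW,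
    add_r (SmoothVF.smul hf hZW) (SmoothVF.smul hfZ hW),
    add_r (SmoothVF.smul hf hXW) (SmoothVF.smul hfX hW),
    key X f hf _ hZW, key Z f hf _ hXW, key X _ hfZ W hW, key Z _ hfX W hW, J0] at J1p
  simp only [Pi.add_apply, Pi.smul_apply', smul_add] at J1p
  rw [hWp] at J1p
  have h3 : (mvfderiv (𝓡 n) f p (VectorField.mlieBracket (𝓡 n) X Z p)
      - (mvfderiv (𝓡 n) (fun q => mvfderiv (𝓡 n) f q (Z q)) p (X p)
        - mvfderiv (𝓡 n) (fun q => mvfderiv (𝓡 n) f q (X q)) p (Z p))) • u = 0 := by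
    rw [sub_smul, sub_smul, sub_eq_zero, ← sub_eq_zero]
    rw [← sub_eq_zero] at J1p
    rw [← neg_eq_zero, ← J1p]
    abel
  exact sub_eq_zero.1 ((smul_eq_zero.1 h3).resolve_right hu)

end SmoothFields
end Tractor
end

noncomputable section
namespace Tractor
variable {n : ℕ} {M : Type*} [TopologicalSpace M] [ChartedSpace (EuclideanSpace ℝ (Fin n)) M]
  [IsManifold (𝓡 n) ∞ M]

/-! ### Linear algebra of the metric at a point. -/

section MetricAlgebra

variable (g : RMetric n M) {p : M}

theorem inner_ext {a b : TangentSpace (𝓡 n) p} (h : ∀ w, g.inner p a w = g.inner p b w) :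
    a = b := by
  by_contra hab
  have := g.pos p (a - b) (sub_ne_zero.2 hab)
  rw [map_sub, g.symm p (a - b) a, g.symm p (a - b) b, h, sub_self] at this
  exact lt_irrefl _ this

/-- The Gram matrix of a basis of `T_p M`. -/
def basisGram (b : Module.Basis (Fin n) ℝ (TangentSpace (𝓡 n) p)) : Matrix (Fin n) (Fin n) ℝ :=
  Matrix.of fun i j => g.inner p (b i) (b j)

theorem isUnit_basisGram (b : Module.Basis (Fin n) ℝ (TangentSpace (𝓡 n) p)) :
    IsUnit (basisGram g b).det := by
  rw [isUnit_iff_ne_zero]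
  intro h
  obtain ⟨v, hv, hv0⟩ := Matrix.exists_mulVec_eq_zero_iff.2 h
  have hVne : (∑ i, v i • b i) ≠ 0 := fun h0 =>
    hv (funext fun i => Fintype.linearIndependent_iff.1 b.linearIndependent v h0 i)
  have h1 : g.inner p (∑ i, v i • b i) (∑ i, v i • b i) = ∑ i, v i * ((basisGram g b).mulVec v) i := by
    simp only [basisGram, Matrix.mulVec, dotProduct, map_sum, map_smul, Finset.mul_sum,
      FunLike.coe_sum, Finset.sum_apply, FunLike.coe_smul, Pi.smul_apply, smul_eq_mul,
      Matrix.of_apply]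
    rw [Finset.sum_comm]
    exact Finset.sum_congr rfl fun i _ => Finset.sum_congr rfl fun j _ => by ring
  have := g.pos p _ hVne
  rw [h1, hv0] at this
  simp at this

theorem sum_basisGram_inv (b : Module.Basis (Fin n) ℝ (TangentSpace (𝓡 n) p))
    (x : TangentSpace (𝓡 n) p) :
    ∑ i, ∑ j, ((basisGram g b)⁻¹ i j * g.inner p x (b i)) • b j = x := by
  have hx := b.sum_repr x
  set c := b.repr x
  have h1 : ∀ i, g.inner p x (b i) = ∑ k, c k * basisGram g b k i := by
    intro i
    conv_lhs => rw [← hx]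
    simp [basisGram, map_sum, map_smul]
  have h2 : ∀ k j, ∑ i, basisGram g b k i * (basisGram g b)⁻¹ i j = if k = j then 1 else 0 := by
    intro k j
    have := congrFun (congrFun (Matrix.mul_nonsing_inv _ (isUnit_basisGram g b)) k) j
    rwa [Matrix.mul_apply, Matrix.one_apply] at this
  conv_rhs => rw [← hx]
  rw [Finset.sum_comm]
  refine Finset.sum_congr rfl fun j _ => ?_
  rw [← Finset.sum_smul]
  congr 1
  simp only [h1, Finset.mul_sum]
  rw [Finset.sum_comm]
  calc ∑ k, ∑ i, (basisGram g b)⁻¹ i j * (c k * basisGram g b k i)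
      = ∑ k, c k * ∑ i, basisGram g b k i * (basisGram g b)⁻¹ i j := by
        refine Finset.sum_congr rfl fun k _ => ?_
        rw [Finset.mul_sum]
        exact Finset.sum_congr rfl fun i _ => by ring
    _ = c j := by simp [h2]

theorem inner_sharp (ℓ : TangentSpace (𝓡 n) p →ₗ[ℝ] ℝ) (w : TangentSpace (𝓡 n) p) :
    g.inner p (sharp g p ℓ) w = ℓ w := by
  have h2 : ∀ i k, ∑ j, (gram g p)⁻¹ i j * gram g p j k = if i = k then 1 else 0 := by
    intro i k
    have := congrFun (congrFun (Matrix.nonsing_inv_mul _ (isUnit_gram g p)) i) k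
    rwa [Matrix.mul_apply, Matrix.one_apply] at this
  have key : (g.inner p (sharp g p ℓ)).toLinearMap = ℓ := by
    refine (tangentBasis p).ext fun k => ?_
    change g.inner p (sharp g p ℓ) (tangentBasis p k) = _
    simp only [sharp, map_sum, map_smul, FunLike.coe_sum, Finset.sum_apply, FunLike.coe_smul,
      Pi.smul_apply, smul_eq_mul]
    calc _ = ∑ i, ℓ (tangentBasis p i) * ∑ j, (gram g p)⁻¹ i j * gram g p j k := by
          refine Finset.sum_congr rfl fun i _ => ?_
          rw [Finset.mul_sum]
          refine Finset.sum_congr rfl fun j _ => ?_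
          simp only [gram, Matrix.of_apply]
          ring
      _ = ℓ (tangentBasis p k) := by simp [h2]
  exact congrArg (fun f => f w) key

/-- Bilinearity of a form on `T_p M`. -/
structure Bilin (B : TangentSpace (𝓡 n) p → TangentSpace (𝓡 n) p → ℝ) : Prop where
  add_left : ∀ a b w, B (a + b) w = B a w + B b w
  smul_left : ∀ (c : ℝ) a w, B (c • a) w = c * B a w
  add_right : ∀ w a b, B w (a + b) = B w a + B w b
  smul_right : ∀ (c : ℝ) w a, B w (c • a) = c * B w a

omit [IsManifold (𝓡 n) ∞ M] in
theorem Bilin.sum_smul_left {B : TangentSpace (𝓡 n) p → TangentSpace (𝓡 n) p → ℝ} (h : Bilin B)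
    {ι : Type*} (s : Finset ι) (c : ι → ℝ) (a : ι → TangentSpace (𝓡 n) p) (w) :
    B (∑ i ∈ s, c i • a i) w = ∑ i ∈ s, c i * B (a i) w := by
  let L : TangentSpace (𝓡 n) p →ₗ[ℝ] ℝ :=
    { toFun := fun a => B a w, map_add' := fun a b => h.add_left a b w,
      map_smul' := fun c a => h.smul_left c a w }
  have := map_sum L (fun i => c i • a i) s
  simp only [map_smul] at this
  exact this

omit [IsManifold (𝓡 n) ∞ M] in
theorem Bilin.sum_smul_right {B : TangentSpace (𝓡 n) p → TangentSpace (𝓡 n) p → ℝ} (h : Bilin B)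
    {ι : Type*} (s : Finset ι) (c : ι → ℝ) (a : ι → TangentSpace (𝓡 n) p) (w) :
    B w (∑ i ∈ s, c i • a i) = ∑ i ∈ s, c i * B w (a i) := by
  let L : TangentSpace (𝓡 n) p →ₗ[ℝ] ℝ :=
    { toFun := fun a => B w a, map_add' := fun a b => h.add_right w a b,
      map_smul' := fun c a => h.smul_right c w a }
  have := map_sum L (fun i => c i • a i) s
  simp only [map_smul] at this
  exact this

omit [IsManifold (𝓡 n) ∞ M] in
theorem Bilin.sum_sum_left {B : TangentSpace (𝓡 n) p → TangentSpace (𝓡 n) p → ℝ} (h : Bilin B)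
    {ι : Type*} (s : Finset ι) (c : ι → ι → ℝ) (a : ι → ι → TangentSpace (𝓡 n) p) (w) :
    B (∑ i ∈ s, ∑ j ∈ s, c i j • a i j) w = ∑ i ∈ s, ∑ j ∈ s, c i j * B (a i j) w := by
  have := h.sum_smul_left s (fun _ => 1) (fun i => ∑ j ∈ s, c i j • a i j) w
  simp only [one_smul, one_mul] at this
  rw [this]
  exact Finset.sum_congr rfl fun i _ => h.sum_smul_left s _ _ w

omit [IsManifold (𝓡 n) ∞ M] in
theorem Bilin.sum_sum_right {B : TangentSpace (𝓡 n) p → TangentSpace (𝓡 n) p → ℝ} (h : Bilin B)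
    {ι : Type*} (s : Finset ι) (c : ι → ι → ℝ) (a : ι → ι → TangentSpace (𝓡 n) p) (w) :
    B w (∑ i ∈ s, ∑ j ∈ s, c i j • a i j) = ∑ i ∈ s, ∑ j ∈ s, c i j * B w (a i j) := by
  have := h.sum_smul_right s (fun _ => 1) (fun i => ∑ j ∈ s, c i j • a i j) w
  simp only [one_smul, one_mul] at this
  rw [this]
  exact Finset.sum_congr rfl fun i _ => h.sum_smul_right s _ _ w

theorem bilin_inner : Bilin fun a b => g.inner p a b where
  add_left a b w := by simp
  smul_left c a w := by simp
  add_right w a b := by simp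
  smul_right c w a := by simp

/-- Independence of the basis. The basis `tangentBasis` depends on the chart chosen at each point
and need not vary continuously, so smoothness of a trace must be read off in a smooth frame. -/
theorem metricTrace_eq_sum {B : TangentSpace (𝓡 n) p → TangentSpace (𝓡 n) p → ℝ} (hB : Bilin B)
    (b : Module.Basis (Fin n) ℝ (TangentSpace (𝓡 n) p)) :
    metricTrace g p B = ∑ i, ∑ j, (basisGram g b)⁻¹ i j * B (b i) (b j) := by
  have e1 : ∀ k, ∑ i, ∑ j, ((gram g p)⁻¹ i j * g.inner p (tangentBasis p j) (b k)) • tangentBasis p i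
      = b k := by
    intro k
    have hs : ∀ i j, (gram g p)⁻¹ i j = (gram g p)⁻¹ j i := by
      intro i j
      have : (gram g p).transpose = gram g p := by
        ext i j; simp [gram, g.symm p (tangentBasis p i)]
      rw [← Matrix.transpose_apply (gram g p)⁻¹ i j, Matrix.transpose_nonsing_inv, this]
    have := sum_basisGram_inv g (tangentBasis p) (b k)
    rw [Finset.sum_comm] at this
    refine Eq.trans ?_ this
    refine Finset.sum_congr rfl fun i _ => Finset.sum_congr rfl fun j _ => ?_
    rw [hs i j, g.symm p (tangentBasis p j)]
    rfl
  have e2 : ∀ i j, B (tangentBasis p i) (tangentBasis p j)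
      = ∑ k, ∑ l, ((basisGram g b)⁻¹ k l * g.inner p (tangentBasis p j) (b k))
          * B (tangentBasis p i) (b l) := by
    intro i j
    conv_lhs => rw [← sum_basisGram_inv g b (tangentBasis p j)]
    rw [hB.sum_sum_right]
  calc metricTrace g p B
      = ∑ i, ∑ j, ∑ k, ∑ l, (basisGram g b)⁻¹ k l *
          (((gram g p)⁻¹ i j * g.inner p (tangentBasis p j) (b k)) * B (tangentBasis p i) (b l)) := by
        unfold metricTrace
        refine Finset.sum_congr rfl fun i _ => Finset.sum_congr rfl fun j _ => ?_
        rw [e2 i j, Finset.mul_sum]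
        refine Finset.sum_congr rfl fun k _ => ?_
        rw [Finset.mul_sum]
        exact Finset.sum_congr rfl fun l _ => by ring
    _ = ∑ k, ∑ l, (basisGram g b)⁻¹ k l * ∑ i, ∑ j,
          (((gram g p)⁻¹ i j * g.inner p (tangentBasis p j) (b k)) * B (tangentBasis p i) (b l)) := by
        simp only [Finset.mul_sum]
        simp only [← Finset.sum_product']
        refine Finset.sum_bij' (fun x _ => (x.2.2.1, x.2.2.2, x.1, x.2.1))
          (fun x _ => (x.2.2.1, x.2.2.2, x.1, x.2.1)) ?_ ?_ ?_ ?_ ?_ <;> simp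
    _ = _ := by
        refine Finset.sum_congr rfl fun k _ => Finset.sum_congr rfl fun l _ => ?_
        congr 1
        conv_rhs => rw [← e1 k]
        rw [hB.sum_sum_left]

end MetricAlgebra

/-! ### The Levi-Civita connection: Koszul formula, metricity, vanishing torsion. -/

section LeviCivita

variable (g : RMetric n M) {X Y Z Z' : ∀ p : M, TangentSpace (𝓡 n) p} {p : M} {f : M → ℝ}

theorem koszul_smul_right (hf : MDifferentiableAt (𝓡 n) 𝓘(ℝ) f p) (hX : DiffAt X p)
    (hY : DiffAt Y p) (hZ : DiffAt Z p) :
    koszul g X Y (f • Z) p = f p * koszul g X Y Z p := by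
  simp only [koszul, fun q => g.symm q (Y q) ((f • Z) q), fun q => g.symm q (X q) ((f • Z) q),
    deriv_inner_smul g hf hZ hY, deriv_inner_smul g hf hZ hX,
    fun q => g.symm q (Y q) (Z q), fun q => g.symm q (X q) (Z q),
    VectorField.mlieBracket_smul_right hf hZ]
  simp [g.symm p (Z p)]
  ring

theorem koszul_add_right (hX : DiffAt X p) (hY : DiffAt Y p) (hZ : DiffAt Z p)
    (hZ' : DiffAt Z' p) : koszul g X Y (Z + Z') p = koszul g X Y Z p + koszul g X Y Z' p := by
  simp only [koszul, fun q => g.symm q (Y q) ((Z + Z') q), fun q => g.symm q (X q) ((Z + Z') q),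
    deriv_inner_add g hZ hZ' hY, deriv_inner_add g hZ hZ' hX,
    fun q => g.symm q (Y q) (Z q), fun q => g.symm q (X q) (Z q),
    fun q => g.symm q (Y q) (Z' q), fun q => g.symm q (X q) (Z' q),
    VectorField.mlieBracket_add_right hZ hZ']
  simp
  ring

theorem tensorialAt_koszul_right (hX : DiffAt X p) (hY : DiffAt Y p) :
    TensorialAt (𝓡 n) (EuclideanSpace ℝ (Fin n)) (fun Z => koszul g X Y Z p) p where
  smul hf hZ := koszul_smul_right g hf hX hY hZ
  add hZ hZ' := koszul_add_right g hX hY hZ hZ'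

/-- The connection was defined with particular extensions of vectors; tensoriality of the Koszul
expression in its first and third arguments allows arbitrary fields instead. -/
theorem inner_leviCivita (hX : DiffAt X p) (hY : DiffAt Y p) (hZ : DiffAt Z p) :
    g.inner p (leviCivita g Y p (X p)) (Z p) = koszul g X Y Z p := by
  have h1 : leviCivita g Y p = leviCivitaAt g p Y hY := by
    exact dif_pos hY
  have hU := diffAt_extendVec p (X p)
  let ℓ : TangentSpace (𝓡 n) p →ₗ[ℝ] ℝ :=
    { toFun := fun z => koszul g (extendVec p (X p)) Y (extendVec p z) p
      map_add' := fun z z' => by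
        rw [← koszul_add_right g hU hY (diffAt_extendVec p z) (diffAt_extendVec p z')]
        exact (tensorialAt_koszul_right g hU hY).pointwise (diffAt_extendVec p _)
          (diffAt_add (diffAt_extendVec p z) (diffAt_extendVec p z')) (by simp [extendVec])
      map_smul' := fun c z => by
        have hc : MDifferentiableAt (𝓡 n) 𝓘(ℝ) (fun _ : M => c) p := mdifferentiableAt_const
        rw [RingHom.id_apply, smul_eq_mul, ← koszul_smul_right g hc hU hY (diffAt_extendVec p z)]
        exact (tensorialAt_koszul_right g hU hY).pointwise (diffAt_extendVec p _)
          (diffAt_smul hc (diffAt_extendVec p z)) (by simp [extendVec]) }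
  rw [h1, leviCivitaAt_apply]
  refine (inner_sharp g ℓ (Z p)).trans ?_
  change koszul g (extendVec p (X p)) Y (extendVec p (Z p)) p = _
  rw [(tensorialAt_koszul g hY (diffAt_extendVec p (Z p))).pointwise hU hX (by simp [extendVec])]
  exact (tensorialAt_koszul_right g hX hY).pointwise (diffAt_extendVec p _) hZ (by simp [extendVec])

/-- The Levi-Civita connection is metric. -/
theorem mvfderiv_inner (hY : DiffAt Y p) (hZ : DiffAt Z p) (u : TangentSpace (𝓡 n) p) :
    mvfderiv (𝓡 n) (fun q => g.inner q (Y q) (Z q)) p u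
      = g.inner p (leviCivita g Y p u) (Z p) + g.inner p (Y p) (leviCivita g Z p u) := by
  have hu := diffAt_extendVec p u
  have e : extendVec p u p = u := FiberBundle.extend_apply_self _ u
  have h1 := inner_leviCivita g hu hY hZ
  have h2 := inner_leviCivita g hu hZ hY
  rw [e] at h1 h2
  rw [g.symm p (Y p), h1, h2]
  simp only [koszul, fun q => g.symm q (Z q) (Y q), e]
  rw [VectorField.mlieBracket_swap_apply (V := Z) (W := Y)]
  simp
  ring

/-- The Levi-Civita connection is torsion free. -/
theorem leviCivita_torsion (hX : DiffAt X p) (hZ : DiffAt Z p) :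
    leviCivita g Z p (X p) - leviCivita g X p (Z p) = VectorField.mlieBracket (𝓡 n) X Z p := by
  refine inner_ext g fun w => ?_
  have hw := diffAt_extendVec p w
  have e : extendVec p w p = w := FiberBundle.extend_apply_self _ w
  have h1 := inner_leviCivita g hX hZ hw
  have h2 := inner_leviCivita g hZ hX hw
  rw [e] at h1 h2
  have e3 : ∀ a b : TangentSpace (𝓡 n) p,
      g.inner p (a - b) w = g.inner p a w - g.inner p b w := fun a b => by simp
  rw [e3, h1, h2]
  simp only [koszul, e, fun q => g.symm q (Z q) (X q)]
  rw [VectorField.mlieBracket_swap_apply (V := Z) (W := X)]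
  simp
  ring

theorem leviCivita_congr (hY : DiffAt Y p) (hZ : DiffAt Z p) (h : ∀ᶠ q in nhds p, Y q = Z q) :
    leviCivita g Y p = leviCivita g Z p :=
  (leviCivita g).isCovariantDerivativeOnUniv.congr_of_eventuallyEq hY hZ Filter.univ_mem h

theorem leviCivita_add (hY : DiffAt Y p) (hZ : DiffAt Z p) :
    leviCivita g (Y + Z) p = leviCivita g Y p + leviCivita g Z p :=
  (leviCivita g).isCovariantDerivativeOnUniv.add hY hZ trivial

theorem leviCivita_smul (hf : MDifferentiableAt (𝓡 n) 𝓘(ℝ) f p) (hY : DiffAt Y p)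
    (u : TangentSpace (𝓡 n) p) :
    leviCivita g (f • Y) p u = f p • leviCivita g Y p u + mvfderiv (𝓡 n) f p u • Y p := by
  rw [(leviCivita g).isCovariantDerivativeOnUniv.leibniz hY hf trivial]
  simp

end LeviCivita
end Tractor
end

noncomputable section
namespace Tractor
variable {n : ℕ} {M : Type*} [TopologicalSpace M] [ChartedSpace (EuclideanSpace ℝ (Fin n)) M]
  [IsManifold (𝓡 n) ∞ M]

/-! ### Smoothness and tensoriality of derivatives, curvature and traces. -/

section SmoothTensors

open Set Filter Topology

variable [T2Space M] (g : RMetric n M)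

theorem contDiff_det : ContDiff ℝ ∞ fun A : Fin n → Fin n → ℝ => (Matrix.of A).det := by
  simp only [Matrix.det_apply']
  refine ContDiff.sum fun σ _ => contDiff_const.mul ?_
  refine contDiff_prod fun i _ => ?_
  simp only [Matrix.of_apply]
  fun_prop

/-- By Cramer's rule an entry of the inverse is a quotient of determinants, which are polynomial in
the entries. -/
theorem contDiffAt_matrix_inv (A : Fin n → Fin n → ℝ) (hA : IsUnit (Matrix.of A).det)
    (i j : Fin n) : ContDiffAt ℝ ∞ (fun A : Fin n → Fin n → ℝ => (Matrix.of A)⁻¹ i j) A := by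
  have : (fun A : Fin n → Fin n → ℝ => (Matrix.of A)⁻¹ i j)
      = fun A => (Matrix.of A).det⁻¹ * (Matrix.of fun k l => if k = j then (if l = i then (1 : ℝ) else 0) else A k l).det := by
    funext A
    rw [Matrix.inv_def, Matrix.smul_apply, smul_eq_mul, Matrix.adjugate_apply, Ring.inverse_eq_inv']
    congr 2
    ext k l
    simp [Matrix.updateRow_apply, Pi.single_apply]
  rw [this]
  refine ContDiffAt.mul (contDiff_det.contDiffAt.inv hA.ne_zero) ?_
  refine ContDiffAt.comp (g := fun A : Fin n → Fin n → ℝ => (Matrix.of A).det) A contDiff_det.contDiffAt ?_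
  refine ContDiff.contDiffAt ?_
  refine contDiff_pi.2 fun k => contDiff_pi.2 fun l => ?_
  split_ifs
  · exact contDiff_const
  · exact contDiff_const
  · fun_prop

/-- Near every point there is a frame of globally defined smooth vector fields. -/
theorem exists_smooth_frame (p : M) : ∃ W : Fin n → ∀ p : M, TangentSpace (𝓡 n) p,
    (∀ i, SmoothVF (W i)) ∧ ∀ᶠ q in 𝓝 p, ∃ b : Module.Basis (Fin n) ℝ (TangentSpace (𝓡 n) q),
      ∀ i, b i = W i q := by
  set t := trivializationAt (EuclideanSpace ℝ (Fin n)) (fun p : M => TangentSpace (𝓡 n) p) p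
  have hpt : p ∈ t.baseSet := FiberBundle.mem_baseSet_trivializationAt' p
  let b := (EuclideanSpace.basisFun (Fin n) ℝ).toBasis
  have hW := fun i => exists_smoothVF_eventuallyEq t.open_baseSet hpt
    (t.contMDiffOn_localFrame_baseSet (I := 𝓡 n) ∞ b i)
  choose W hW1 hW2 using hW
  refine ⟨W, hW1, ?_⟩
  filter_upwards [eventually_all.2 hW2, t.open_baseSet.mem_nhds hpt] with q hq hqt
  exact ⟨t.basisAt b hqt, fun i => by rw [hq i, t.localFrame_apply_of_mem_baseSet b hqt]⟩

omit [T2Space M] in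
/-- The inverse Gram matrix of a smooth frame is smooth. -/
theorem contMDiffAt_frameGram_inv {W : Fin n → ∀ p : M, TangentSpace (𝓡 n) p}
    (hW : ∀ i, SmoothVF (W i)) {p : M}
    (hb : ∃ b : Module.Basis (Fin n) ℝ (TangentSpace (𝓡 n) p), ∀ i, b i = W i p) (i j : Fin n) :
    ContMDiffAt (𝓡 n) 𝓘(ℝ) ∞
      (fun q => (Matrix.of fun i j => g.inner q (W i q) (W j q))⁻¹ i j) p := by
  obtain ⟨b, hb⟩ := hb
  have h1 : IsUnit (Matrix.of fun i j => g.inner p (W i p) (W j p)).det := by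
    have := isUnit_basisGram g b
    simpa only [basisGram, hb] using this
  have h2 : ContMDiffAt (𝓡 n) 𝓘(ℝ, Fin n → Fin n → ℝ) ∞
      (fun q => fun i j => g.inner q (W i q) (W j q)) p :=
    contMDiffAt_pi_space.2 fun i => contMDiffAt_pi_space.2 fun j =>
      (SmoothVF.inner g (hW i) (hW j)) p
  exact ContDiffAt.comp_contMDiffAt
    (g := fun A : Fin n → Fin n → ℝ => (Matrix.of A)⁻¹ i j) (contDiffAt_matrix_inv _ h1 i j) h2

/-- A vector field is smooth if its inner products with smooth fields are. -/
theorem smoothVF_of_inner {Z : ∀ p : M, TangentSpace (𝓡 n) p}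
    (h : ∀ W, SmoothVF W → SmoothFn n (fun q => g.inner q (Z q) (W q))) : SmoothVF Z := by
  intro p
  obtain ⟨W, hW, hb⟩ := exists_smooth_frame (n := n) p
  have h1 : ContMDiffAt (𝓡 n) (𝓡 n).tangent ∞
      (fun q => (⟨q, ∑ i, ∑ j, ((Matrix.of fun i j => g.inner q (W i q) (W j q))⁻¹ i j
        * g.inner q (Z q) (W i q)) • W j q⟩ : TangentBundle (𝓡 n) M)) p := by
    refine ContMDiffAt.sum_section fun i _ => ContMDiffAt.sum_section fun j _ => ?_
    exact ContMDiffAt.smul_section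
      ((contMDiffAt_frameGram_inv g hW hb.self_of_nhds i j).mul (h (W i) (hW i) p)) (hW j p)
  refine h1.congr_of_eventuallyEq ?_
  filter_upwards [hb] with q hq
  obtain ⟨b, hb⟩ := hq
  have := sum_basisGram_inv g b (Z q)
  simp only [basisGram, hb] at this
  rw [this]

theorem SmoothVF.leviCivita {X Y : ∀ p : M, TangentSpace (𝓡 n) p} (hX : SmoothVF X)
    (hY : SmoothVF Y) : SmoothVF fun p => leviCivita g Y p (X p) := by
  refine smoothVF_of_inner g fun W hW => ?_
  have : (fun q => g.inner q (Tractor.leviCivita g Y q (X q)) (W q)) = fun q => koszul g X Y W q :=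
    funext fun q => inner_leviCivita g (hX.diffAt q) (hY.diffAt q) (hW.diffAt q)
  rw [this]
  have hYW := SmoothVF.inner g hY hW
  have hXW := SmoothVF.inner g hX hW
  have hXY := SmoothVF.inner g hX hY
  unfold koszul
  exact ((((((SmoothVF.deriv hYW hX).add (SmoothVF.deriv hXW hY)).sub
    (SmoothVF.deriv hXY hW)).add (SmoothVF.inner g (hX.bracket hY) hW)).sub
    (SmoothVF.inner g (hX.bracket hW) hY)).sub (SmoothVF.inner g (hY.bracket hW) hX)).div_const 2

theorem SmoothVF.nabla {X Y : ∀ p : M, TangentSpace (𝓡 n) p} (hX : SmoothVF X)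
    (hY : SmoothVF Y) : SmoothVF (nabla g X Y) := hX.leviCivita g hY

/-- Smooth covariant two-tensors. -/
structure SmoothForm (B : ∀ p : M, TangentSpace (𝓡 n) p → TangentSpace (𝓡 n) p → ℝ) : Prop where
  bilin : ∀ p, Bilin (B p)
  smooth : ∀ X Y, SmoothVF X → SmoothVF Y → SmoothFn n (fun p => B p (X p) (Y p))

omit [T2Space M] in
theorem smoothForm_inner : SmoothForm fun (p : M) a b => g.inner p a b where
  bilin _ := bilin_inner g
  smooth _ _ hX hY := SmoothVF.inner g hX hY

omit [T2Space M] in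
theorem SmoothForm.sub {B C : ∀ p : M, TangentSpace (𝓡 n) p → TangentSpace (𝓡 n) p → ℝ}
    (hB : SmoothForm B) (hC : SmoothForm C) : SmoothForm fun p a b => B p a b - C p a b where
  bilin p :=
    { add_left := fun a b w => by rw [(hB.bilin p).add_left, (hC.bilin p).add_left]; ring
      smul_left := fun c a w => by rw [(hB.bilin p).smul_left, (hC.bilin p).smul_left]; ring
      add_right := fun a b w => by rw [(hB.bilin p).add_right, (hC.bilin p).add_right]; ring
      smul_right := fun c a w => by rw [(hB.bilin p).smul_right, (hC.bilin p).smul_right]; ring }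
  smooth X Y hX hY := (hB.smooth X Y hX hY).sub (hC.smooth X Y hX hY)

omit [T2Space M] in
theorem SmoothForm.smul {f : M → ℝ} (hf : SmoothFn n f)
    {B : ∀ p : M, TangentSpace (𝓡 n) p → TangentSpace (𝓡 n) p → ℝ}
    (hB : SmoothForm B) : SmoothForm fun p a b => f p * B p a b where
  bilin p :=
    { add_left := fun a b w => by rw [(hB.bilin p).add_left]; ring
      smul_left := fun c a w => by rw [(hB.bilin p).smul_left]; ring
      add_right := fun a b w => by rw [(hB.bilin p).add_right]; ring
      smul_right := fun c a w => by rw [(hB.bilin p).smul_right]; ring }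
  smooth X Y hX hY := hf.mul (hB.smooth X Y hX hY)

omit [T2Space M] in
theorem contMDiffAt_metricTrace {B : ∀ p : M, TangentSpace (𝓡 n) p → TangentSpace (𝓡 n) p → ℝ}
    (hbil : ∀ p, Bilin (B p)) {p : M} {W : Fin n → ∀ p : M, TangentSpace (𝓡 n) p}
    (hW : ∀ i, SmoothVF (W i))
    (hb : ∀ᶠ q in 𝓝 p, ∃ b : Module.Basis (Fin n) ℝ (TangentSpace (𝓡 n) q), ∀ i, b i = W i q)
    (hB : ∀ i j, SmoothFn n (fun p => B p (W i p) (W j p))) :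
    ContMDiffAt (𝓡 n) 𝓘(ℝ) ∞ (fun q => metricTrace g q (B q)) p := by
  have h1 : ContMDiffAt (𝓡 n) 𝓘(ℝ) ∞
      (fun q => ∑ i, ∑ j, (Matrix.of fun i j => g.inner q (W i q) (W j q))⁻¹ i j
        * B q (W i q) (W j q)) p :=
    ContMDiffAt.sum fun i _ => ContMDiffAt.sum fun j _ =>
      (contMDiffAt_frameGram_inv g hW hb.self_of_nhds i j).mul (hB i j p)
  refine h1.congr_of_eventuallyEq ?_
  filter_upwards [hb] with q hq
  obtain ⟨b, hb⟩ := hq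
  have := metricTrace_eq_sum g (hbil q) b
  simpa only [basisGram, hb] using this

theorem SmoothForm.metricTrace {B : ∀ p : M, TangentSpace (𝓡 n) p → TangentSpace (𝓡 n) p → ℝ}
    (hB : SmoothForm B) : SmoothFn n (fun p => metricTrace g p (B p)) := by
  intro p
  obtain ⟨W, hW, hb⟩ := exists_smooth_frame (n := n) p
  exact contMDiffAt_metricTrace g hB.bilin hW hb fun i j => hB.smooth _ _ (hW i) (hW j)

omit [T2Space M] in
theorem inner_grad (f : M → ℝ) (p : M) (w : TangentSpace (𝓡 n) p) :
    g.inner p (grad g f p) w = mvfderiv (𝓡 n) f p w :=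
  inner_sharp g (mvfderiv (𝓡 n) f p).toLinearMap w

theorem SmoothFn.grad {f : M → ℝ} (hf : SmoothFn n f) : SmoothVF (grad g f) := by
  refine smoothVF_of_inner g fun W hW => ?_
  simp only [inner_grad]
  exact SmoothVF.deriv hf hW

theorem SmoothFn.hess {f : M → ℝ} (hf : SmoothFn n f) : SmoothForm (hess g f) where
  bilin p :=
    { add_left := fun a b w => by simp [Tractor.hess]
      smul_left := fun c a w => by simp [Tractor.hess]
      add_right := fun a b w => by simp [Tractor.hess]
      smul_right := fun c a w => by simp [Tractor.hess] }
  smooth X Y hX hY := SmoothVF.inner g (hX.leviCivita g (SmoothFn.grad g hf)) hY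

theorem SmoothFn.laplacian {f : M → ℝ} (hf : SmoothFn n f) : SmoothFn n (laplacian g f) :=
  (SmoothFn.hess g hf).metricTrace g

/-- The curvature operator on vector fields. -/
def curvField (X Y Z : ∀ p : M, TangentSpace (𝓡 n) p) (p : M) : TangentSpace (𝓡 n) p :=
  nabla g X (nabla g Y Z) p - nabla g Y (nabla g X Z) p
    - nabla g (VectorField.mlieBracket (𝓡 n) X Y) Z p

variable {X X' Y Y' Z Z' : ∀ p : M, TangentSpace (𝓡 n) p}

theorem SmoothVF.curvField (hX : SmoothVF X) (hY : SmoothVF Y) (hZ : SmoothVF Z) :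
    SmoothVF (curvField g X Y Z) :=
  ((hX.nabla g (hY.nabla g hZ)).sub (hY.nabla g (hX.nabla g hZ))).sub ((hX.bracket hY).nabla g hZ)

omit [T2Space M] in
theorem nabla_smul_left (f : M → ℝ) (X Y : ∀ p : M, TangentSpace (𝓡 n) p) :
    nabla g (f • X) Y = f • nabla g X Y := by
  funext p
  simp [nabla, Pi.smul_apply']

omit [T2Space M] in
theorem nabla_add_left (X X' Y : ∀ p : M, TangentSpace (𝓡 n) p) :
    nabla g (X + X') Y = nabla g X Y + nabla g X' Y := by
  funext p
  simp [nabla]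

omit [T2Space M] in
theorem nabla_add_right (X : ∀ p : M, TangentSpace (𝓡 n) p) (hY : SmoothVF Y) (hY' : SmoothVF Y') :
    nabla g X (Y + Y') = nabla g X Y + nabla g X Y' := by
  funext p
  simp only [nabla, Pi.add_apply, leviCivita_add g (hY.diffAt p) (hY'.diffAt p)]
  rfl

omit [T2Space M] in
theorem nabla_smul_right (X : ∀ p : M, TangentSpace (𝓡 n) p) {f : M → ℝ} (hf : SmoothFn n f)
    (hY : SmoothVF Y) :
    nabla g X (f • Y) = f • nabla g X Y + (fun q => mvfderiv (𝓡 n) f q (X q)) • Y := by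
  funext p
  simp only [nabla, Pi.add_apply, leviCivita_smul g (hf.diffAt p) (hY.diffAt p), Pi.smul_apply']

omit [T2Space M] in
theorem curvField_swap (X Y Z : ∀ p : M, TangentSpace (𝓡 n) p) (p : M) :
    curvField g X Y Z p = - curvField g Y X Z p := by
  simp only [curvField, nabla, VectorField.mlieBracket_swap_apply (V := X) (W := Y)]
  simp
  abel

theorem curvField_add_left (hX : SmoothVF X) (hX' : SmoothVF X')
    (hZ : SmoothVF Z) (p : M) :
    curvField g (X + X') Y Z p = curvField g X Y Z p + curvField g X' Y Z p := by
  have h1 : VectorField.mlieBracket (𝓡 n) (X + X') Y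
      = VectorField.mlieBracket (𝓡 n) X Y + VectorField.mlieBracket (𝓡 n) X' Y :=
    funext fun q => VectorField.mlieBracket_add_left (hX.diffAt q) (hX'.diffAt q)
  simp only [curvField, nabla_add_left, h1, nabla_add_right g Y (hX.nabla g hZ) (hX'.nabla g hZ),
    Pi.add_apply]
  abel

theorem curvField_smul_left {f : M → ℝ} (hf : SmoothFn n f) (hX : SmoothVF X)
    (hZ : SmoothVF Z) (p : M) :
    curvField g (f • X) Y Z p = f p • curvField g X Y Z p := by
  have h1 : VectorField.mlieBracket (𝓡 n) (f • X) Y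
      = f • VectorField.mlieBracket (𝓡 n) X Y - (fun q => mvfderiv (𝓡 n) f q (Y q)) • X := by
    funext q
    rw [VectorField.mlieBracket_smul_left (hf.diffAt q) (hX.diffAt q)]
    simp [Pi.smul_apply']
    abel
  have h2 : ∀ A B C : ∀ p : M, TangentSpace (𝓡 n) p, nabla g (A - B) C = nabla g A C - nabla g B C := by
    intro A B C; funext q; simp [nabla]
  simp only [curvField, nabla_smul_left, h1, h2, nabla_smul_right g Y hf (hX.nabla g hZ),
    Pi.add_apply, Pi.sub_apply, Pi.smul_apply', smul_sub]
  abel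

theorem curvField_add_right (hX : SmoothVF X) (hY : SmoothVF Y) (hZ : SmoothVF Z)
    (hZ' : SmoothVF Z') (p : M) :
    curvField g X Y (Z + Z') p = curvField g X Y Z p + curvField g X Y Z' p := by
  simp only [curvField, nabla_add_right g _ hZ hZ',
    nabla_add_right g X (hY.nabla g hZ) (hY.nabla g hZ'),
    nabla_add_right g Y (hX.nabla g hZ) (hX.nabla g hZ'), Pi.add_apply]
  abel

/-- The first derivatives of `f` cancel in the commutator, and the second derivatives cancel against
the derivative of `f` along the bracket. -/
theorem curvField_smul_right {f : M → ℝ} (hf : SmoothFn n f) (hX : SmoothVF X) (hY : SmoothVF Y)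
    (hZ : SmoothVF Z) (p : M) :
    curvField g X Y (f • Z) p = f p • curvField g X Y Z p := by
  have hYf := SmoothVF.deriv hf hY
  have hXf := SmoothVF.deriv hf hX
  have h1 : nabla g X (nabla g Y (f • Z)) p = f p • nabla g X (nabla g Y Z) p
      + mvfderiv (𝓡 n) f p (X p) • nabla g Y Z p + mvfderiv (𝓡 n) f p (Y p) • nabla g X Z p
      + mvfderiv (𝓡 n) (fun q => mvfderiv (𝓡 n) f q (Y q)) p (X p) • Z p := by
    rw [nabla_smul_right g Y hf hZ, nabla_add_right g X (SmoothVF.smul hf (hY.nabla g hZ))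
      (SmoothVF.smul hYf hZ), nabla_smul_right g X hf (hY.nabla g hZ), nabla_smul_right g X hYf hZ]
    simp only [Pi.add_apply, Pi.smul_apply']
    abel
  have h2 : nabla g Y (nabla g X (f • Z)) p = f p • nabla g Y (nabla g X Z) p
      + mvfderiv (𝓡 n) f p (Y p) • nabla g X Z p + mvfderiv (𝓡 n) f p (X p) • nabla g Y Z p
      + mvfderiv (𝓡 n) (fun q => mvfderiv (𝓡 n) f q (X q)) p (Y p) • Z p := by
    rw [nabla_smul_right g X hf hZ, nabla_add_right g Y (SmoothVF.smul hf (hX.nabla g hZ))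
      (SmoothVF.smul hXf hZ), nabla_smul_right g Y hf (hX.nabla g hZ), nabla_smul_right g Y hXf hZ]
    simp only [Pi.add_apply, Pi.smul_apply']
    abel
  have h3 := congrFun (nabla_smul_right g (VectorField.mlieBracket (𝓡 n) X Y) hf hZ) p
  simp only [Pi.add_apply, Pi.smul_apply', mvfderiv_mlieBracket hX hY hf] at h3
  rw [curvField, h1, h2, h3, curvField]
  module

theorem curvField_congr (hX : SmoothVF X) (hX' : SmoothVF X') (hY : SmoothVF Y) (hY' : SmoothVF Y')
    (hZ : SmoothVF Z) (hZ' : SmoothVF Z') {p : M} (eX : X p = X' p) (eY : Y p = Y' p)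
    (eZ : Z p = Z' p) : curvField g X Y Z p = curvField g X' Y' Z' p := by
  have h1 : curvField g X Y Z p = curvField g X' Y Z p :=
    eq_of_tensorial (fun X => curvField g X Y Z p)
      (fun A B hA hB => curvField_add_left g hA hB hZ p)
      (fun f A hf hA => curvField_smul_left g hf hA hZ p) hX hX' eX
  have h2 : curvField g X' Y Z p = curvField g X' Y' Z p := by
    rw [curvField_swap g X' Y, curvField_swap g X' Y']
    congr 1
    exact eq_of_tensorial (fun Y => curvField g Y X' Z p)
      (fun A B hA hB => curvField_add_left g hA hB hZ p)
      (fun f A hf hA => curvField_smul_left g hf hA hZ p) hY hY' eY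
  have h3 : curvField g X' Y' Z p = curvField g X' Y' Z' p :=
    eq_of_tensorial (fun Z => curvField g X' Y' Z p)
      (fun A B hA hB => curvField_add_right g hX' hY' hA hB p)
      (fun f A hf hA => curvField_smul_right g hf hX' hY' hA p) hZ hZ' eZ
  rw [h1, h2, h3]

omit [T2Space M] in
theorem nabla_congr_nhds {p : M} (hX : X =ᶠ[𝓝 p] X')
    (hY : ∀ᶠ q in 𝓝 p, DiffAt Y q) (hY' : ∀ᶠ q in 𝓝 p, DiffAt Y' q)
    (h : Y =ᶠ[𝓝 p] Y') : nabla g X Y =ᶠ[𝓝 p] nabla g X' Y' := by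
  filter_upwards [hX, hY, hY', h.eventuallyEq_nhds] with q h1 h2 h3 h4
  rw [nabla, nabla, h1, leviCivita_congr g h2 h3 h4]

omit [T2Space M] in
theorem eventually_diffAt_of_eventuallyEq {p : M} (hY : SmoothVF Y) (h : Y =ᶠ[𝓝 p] Y') :
    ∀ᶠ q in 𝓝 p, DiffAt Y' q := by
  filter_upwards [h.eventuallyEq_nhds] with q hq
  refine (hY.diffAt q).congr_of_eventuallyEq ?_
  filter_upwards [hq] with r hr
  rw [hr]

/-- The extensions used in `riemann` are smooth only near `p`. They are exchanged for global fields
with the same germs, and those for the given fields by tensoriality. -/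
theorem riemann_eq (hX : SmoothVF X) (hY : SmoothVF Y) (hZ : SmoothVF Z) (p : M) :
    riemann g p (X p) (Y p) (Z p) = curvField g X Y Z p := by
  obtain ⟨A, hA, eA⟩ := exists_smoothVF_extendVec p (X p)
  obtain ⟨B, hB, eB⟩ := exists_smoothVF_extendVec p (Y p)
  obtain ⟨C, hC, eC⟩ := exists_smoothVF_extendVec p (Z p)
  have ev : ∀ {D : ∀ p : M, TangentSpace (𝓡 n) p} {u : TangentSpace (𝓡 n) p},
      D =ᶠ[𝓝 p] extendVec p u → D p = u := fun h =>
    h.self_of_nhds.trans (FiberBundle.extend_apply_self _ _)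
  rw [curvField_congr g hX hA hY hB hZ hC (ev eA).symm (ev eB).symm (ev eC).symm]
  have dC := eventually_diffAt_of_eventuallyEq hC eC
  have sC := Eventually.of_forall (f := 𝓝 p) hC.diffAt
  have hBC := nabla_congr_nhds g eB sC dC eC
  have hAC := nabla_congr_nhds g eA sC dC eC
  have d1 := eventually_diffAt_of_eventuallyEq (hB.nabla g hC) hBC
  have d2 := eventually_diffAt_of_eventuallyEq (hA.nabla g hC) hAC
  have e1 := nabla_congr_nhds g eA (Eventually.of_forall (hB.nabla g hC).diffAt) d1 hBC
  have e2 := nabla_congr_nhds g eB (Eventually.of_forall (hA.nabla g hC).diffAt) d2 hAC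
  have e3 := nabla_congr_nhds g (eA.mlieBracket_vectorField eB) sC dC eC
  rw [curvField, e1.self_of_nhds, e2.self_of_nhds, e3.self_of_nhds, riemann]

theorem riemann_add_left (p : M) (a b u w : TangentSpace (𝓡 n) p) :
    riemann g p (a + b) u w = riemann g p a u w + riemann g p b u w := by
  obtain ⟨A, hA, rfl⟩ := exists_smoothVF p a
  obtain ⟨B, hB, rfl⟩ := exists_smoothVF p b
  obtain ⟨U, hU, rfl⟩ := exists_smoothVF p u
  obtain ⟨W, hW, rfl⟩ := exists_smoothVF p w
  rw [← Pi.add_apply, riemann_eq g (hA.add hB) hU hW, riemann_eq g hA hU hW, riemann_eq g hB hU hW,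
    curvField_add_left g hA hB hW]

theorem riemann_smul_left (p : M) (c : ℝ) (a u w : TangentSpace (𝓡 n) p) :
    riemann g p (c • a) u w = c • riemann g p a u w := by
  obtain ⟨A, hA, rfl⟩ := exists_smoothVF p a
  obtain ⟨U, hU, rfl⟩ := exists_smoothVF p u
  obtain ⟨W, hW, rfl⟩ := exists_smoothVF p w
  have hc : SmoothFn n (fun _ : M => c) := contMDiff_const
  have := riemann_eq g (SmoothVF.smul hc hA) hU hW p
  rw [curvField_smul_left g hc hA hW, ← riemann_eq g hA hU hW] at this
  exact this

theorem riemann_swap (p : M) (a u w : TangentSpace (𝓡 n) p) :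
    riemann g p a u w = - riemann g p u a w := by
  obtain ⟨A, hA, rfl⟩ := exists_smoothVF p a
  obtain ⟨U, hU, rfl⟩ := exists_smoothVF p u
  obtain ⟨W, hW, rfl⟩ := exists_smoothVF p w
  rw [riemann_eq g hA hU hW, riemann_eq g hU hA hW, curvField_swap g A U]

theorem riemann_add_right (p : M) (u w a b : TangentSpace (𝓡 n) p) :
    riemann g p u w (a + b) = riemann g p u w a + riemann g p u w b := by
  obtain ⟨A, hA, rfl⟩ := exists_smoothVF p a
  obtain ⟨B, hB, rfl⟩ := exists_smoothVF p b
  obtain ⟨U, hU, rfl⟩ := exists_smoothVF p u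
  obtain ⟨W, hW, rfl⟩ := exists_smoothVF p w
  rw [← Pi.add_apply, riemann_eq g hU hW (hA.add hB), riemann_eq g hU hW hA, riemann_eq g hU hW hB,
    curvField_add_right g hU hW hA hB]

theorem riemann_smul_right (p : M) (c : ℝ) (u w a : TangentSpace (𝓡 n) p) :
    riemann g p u w (c • a) = c • riemann g p u w a := by
  obtain ⟨A, hA, rfl⟩ := exists_smoothVF p a
  obtain ⟨U, hU, rfl⟩ := exists_smoothVF p u
  obtain ⟨W, hW, rfl⟩ := exists_smoothVF p w
  have hc : SmoothFn n (fun _ : M => c) := contMDiff_const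
  have := riemann_eq g hU hW (SmoothVF.smul hc hA) p
  rw [curvField_smul_right g hc hU hW hA, ← riemann_eq g hU hW hA] at this
  exact this

theorem bilin_riemann (p : M) (u w : TangentSpace (𝓡 n) p) :
    Bilin fun a b => g.inner p (riemann g p a u w) b where
  add_left a b z := by simp [riemann_add_left]
  smul_left c a z := by simp [riemann_smul_left]
  add_right z a b := by simp
  smul_right c z a := by simp

omit [T2Space M] in
theorem metricTrace_add (p : M) (B C : TangentSpace (𝓡 n) p → TangentSpace (𝓡 n) p → ℝ) :
    metricTrace g p (fun a b => B a b + C a b) = metricTrace g p B + metricTrace g p C := by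
  simp only [metricTrace, mul_add, Finset.sum_add_distrib]

omit [T2Space M] in
theorem metricTrace_const_mul (p : M) (c : ℝ) (B : TangentSpace (𝓡 n) p → TangentSpace (𝓡 n) p → ℝ) :
    metricTrace g p (fun a b => c * B a b) = c * metricTrace g p B := by
  simp only [metricTrace, Finset.mul_sum]
  exact Finset.sum_congr rfl fun i _ => Finset.sum_congr rfl fun j _ => by ring

theorem smoothForm_ricci : SmoothForm fun p : M => ricci g p where
  bilin p :=
    { add_left := fun a b w => by
        refine Eq.trans ?_ (metricTrace_add g p _ _)
        refine congrArg (metricTrace g p) ?_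
        funext x y
        -- Linearity in the second slot of the Riemann tensor is deduced from the first slot by
        -- antisymmetry.
        rw [riemann_swap g p x, riemann_add_left, riemann_swap g p x a, riemann_swap g p x b]
        simp; ring
      smul_left := fun c a w => by
        refine Eq.trans ?_ (metricTrace_const_mul g p c _)
        refine congrArg (metricTrace g p) ?_
        funext x y
        rw [riemann_swap g p x, riemann_smul_left, riemann_swap g p x a]
        simp
      add_right := fun w a b => by
        refine Eq.trans ?_ (metricTrace_add g p _ _)
        refine congrArg (metricTrace g p) ?_
        funext x y
        rw [riemann_add_right]
        simp
      smul_right := fun c w a => by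
        refine Eq.trans ?_ (metricTrace_const_mul g p c _)
        refine congrArg (metricTrace g p) ?_
        funext x y
        rw [riemann_smul_right]
        simp }
  smooth X Y hX hY := by
    intro p
    obtain ⟨W, hW, hb⟩ := exists_smooth_frame (n := n) p
    refine contMDiffAt_metricTrace g (fun q => bilin_riemann g q (X q) (Y q)) hW hb fun i j => ?_
    simp only [riemann_eq g (hW i) hX hY]
    exact SmoothVF.inner g ((hW i).curvField g hX hY) (hW j)

theorem smoothFn_scal : SmoothFn n (scal g) := (smoothForm_ricci g).metricTrace g

theorem smoothFn_schoutenTrace : SmoothFn n (schoutenTrace g) := (smoothFn_scal g).div_const _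

end SmoothTensors
end Tractor
end

noncomputable section
namespace Tractor
variable {n : ℕ} {M : Type*} [TopologicalSpace M] [ChartedSpace (EuclideanSpace ℝ (Fin n)) M]
  [IsManifold (𝓡 n) ∞ M]

/-! ### The weighted Ricci and Schouten tensors are smooth. -/

section WeightedTensors

/-- Smooth fields of endomorphisms of the tangent bundle. -/
structure SmoothEnd (P : ∀ p : M, TangentSpace (𝓡 n) p → TangentSpace (𝓡 n) p) : Prop where
  add : ∀ p a b, P p (a + b) = P p a + P p b
  smul : ∀ p (c : ℝ) a, P p (c • a) = c • P p a
  smooth : ∀ X, SmoothVF X → SmoothVF fun p => P p (X p)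

variable [T2Space M] (g : RMetric n M)

omit [T2Space M] in
theorem SmoothForm.inner_sharp {B : ∀ p : M, TangentSpace (𝓡 n) p → TangentSpace (𝓡 n) p → ℝ}
    (hB : SmoothForm B) (p : M) (u w : TangentSpace (𝓡 n) p) :
    g.inner p (sharp g p fun z => B p u z) w = B p u w :=
  Tractor.inner_sharp g (p := p)
    { toFun := fun z => B p u z
      map_add' := fun _ _ => (hB.bilin p).add_right _ _ _
      map_smul' := fun _ _ => (hB.bilin p).smul_right _ _ _ } w

theorem SmoothForm.sharp {B : ∀ p : M, TangentSpace (𝓡 n) p → TangentSpace (𝓡 n) p → ℝ}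
    (hB : SmoothForm B) : SmoothEnd fun p u => sharp g p fun z => B p u z where
  add p a b := by simp only [(hB.bilin p).add_left, sharp_add]
  smul p c a := by simp only [(hB.bilin p).smul_left, sharp_smul]
  smooth X hX := by
    refine smoothVF_of_inner g fun W hW => ?_
    simp only [hB.inner_sharp g]
    exact hB.smooth X W hX hW

variable {v : M → ℝ} (hv : SmoothFn n v) (hpos : ∀ p, 0 < v p) (m μ : ℝ)

include hv hpos

omit [IsManifold (𝓡 n) ∞ M] [T2Space M] in
theorem SmoothFn.inv_of_pos : SmoothFn n fun p => (v p)⁻¹ := fun p =>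
  ContDiffAt.comp_contMDiffAt (g := fun x : ℝ => x⁻¹)
    (contDiffAt_inv ℝ (hpos p).ne') (hv p)

theorem smoothForm_bakryEmery : SmoothForm (bakryEmery g v m) :=
  (smoothForm_ricci g).sub (SmoothForm.smul (f := fun p => m * (v p)⁻¹)
    (contMDiff_const.mul (SmoothFn.inv_of_pos hv hpos)) (SmoothFn.hess g hv))

theorem smoothFn_weightedScal : SmoothFn n (weightedScal g v m) := by
  have hi := SmoothFn.inv_of_pos hv hpos
  refine ((smoothFn_scal g).sub ((contMDiff_const.mul hi).mul (SmoothFn.laplacian g hv))).sub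
    ((contMDiff_const.mul (hi.pow 2)).mul ?_)
  exact SmoothVF.inner g (SmoothFn.grad g hv) (SmoothFn.grad g hv)

theorem smoothFn_weightedSchoutenScalar : SmoothFn n (weightedSchoutenScalar g v m μ) :=
  ((smoothFn_weightedScal g hv hpos m).add
    (contMDiff_const.mul ((SmoothFn.inv_of_pos hv hpos).pow 2))).div_const _

theorem smoothForm_weightedSchouten : SmoothForm (weightedSchouten g v m μ) := by
  have h := SmoothForm.smul (f := fun _ => (m + n - 2 : ℝ)⁻¹) contMDiff_const
    ((smoothForm_bakryEmery g hv hpos m).sub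
      (SmoothForm.smul (smoothFn_weightedSchoutenScalar g hv hpos m μ) (smoothForm_inner g)))
  have e : weightedSchouten g v m μ = fun p a b => (m + n - 2 : ℝ)⁻¹ *
      (bakryEmery g v m p a b - weightedSchoutenScalar g v m μ p * g.inner p a b) := by
    funext p a b
    rw [weightedSchouten, div_eq_inv_mul]
  rw [e]
  exact h

theorem smoothEnd_weightedSchoutenSharp : SmoothEnd (weightedSchoutenSharp g v m μ) :=
  (smoothForm_weightedSchouten g hv hpos m μ).sharp g

theorem inner_weightedSchoutenSharp (p : M) (u w : TangentSpace (𝓡 n) p) :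
    g.inner p (weightedSchoutenSharp g v m μ p u) w = weightedSchouten g v m μ p u w :=
  (smoothForm_weightedSchouten g hv hpos m μ).inner_sharp g p u w

end WeightedTensors

/-! ### The scale tractor and its modification in components. -/

section ScaleTractor

variable [T2Space M] (S : SCMS n M) (μ : ℝ) (g : S.conf.scales)

omit [T2Space M] in
theorem SmoothComp.tractorMetric (g : RMetric n M) {I K : ∀ p : M, TractorComp n p}
    (hI : SmoothComp I) (hK : SmoothComp K) : SmoothFn n fun p => tractorMetric g p (I p) (K p) :=
  ((hI.top.mul hK.bot).add (hI.bot.mul hK.top)).add (SmoothVF.inner g hI.mid hK.mid)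

omit [T2Space M] in
theorem SmoothComp.smul {f : M → ℝ} (hf : SmoothFn n f) {I : ∀ p : M, TractorComp n p}
    (hI : SmoothComp I) : SmoothComp (f • I) :=
  ⟨hf.mul hI.top, SmoothVF.smul hf hI.mid, hf.mul hI.bot⟩

omit [T2Space M] in
-- For weight one the factor `n + 2 * w - 2` of the tractor-D operator equals `n` and cancels the
-- normalization.
theorem SCMS.scaleTractor_eq (hn : n ≠ 0) (p : M) :
    S.scaleTractor g p = (S.v.inScale g p, grad g.1 (S.v.inScale g) p,
      -(laplacian g.1 (S.v.inScale g) p + schoutenTrace g.1 p * S.v.inScale g p) / n) := by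
  have h : (n : ℝ) ≠ 0 := by exact_mod_cast hn
  refine Prod.ext ?_ (Prod.ext ?_ ?_)
  · simp [SCMS.scaleTractor, tractorD]
    field_simp
  · simp [SCMS.scaleTractor, tractorD, smul_smul, h]
  · simp [SCMS.scaleTractor, tractorD]
    field_simp

theorem SCMS.smoothComp_scaleTractor (hn : n ≠ 0) : SmoothComp (S.scaleTractor g) := by
  have : S.scaleTractor g = fun p => (S.v.inScale g p, grad g.1 (S.v.inScale g) p,
      -(laplacian g.1 (S.v.inScale g) p + schoutenTrace g.1 p * S.v.inScale g p) / n) :=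
    funext fun p => S.scaleTractor_eq g hn p
  rw [this]
  refine ⟨S.v.smooth g, SmoothFn.grad g.1 (S.v.smooth g), ?_⟩
  exact (((SmoothFn.laplacian g.1 (S.v.smooth g)).add
    ((smoothFn_schoutenTrace g.1).mul (S.v.smooth g))).neg).div_const _

/-- The coefficient of the projector in `J~ - J`. -/
def SCMS.tildeCoeff (p : M) : ℝ :=
  (S.m + 2 * n - 2) * (μ - (S.m - 1) * tractorMetric g.1 p (S.scaleTractor g p) (S.scaleTractor g p))
    / (2 * (S.m + n - 1) * (S.m + n - 2) * S.v.inScale g p)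

omit [T2Space M] in
theorem SCMS.scaleTractorTilde_eq (hn : n ≠ 0) :
    S.scaleTractorTilde μ g = S.scaleTractor g + S.tildeCoeff μ g • projector := by
  funext p
  have : Tractor.tractorMetric g.1 p (projector p) (S.scaleTractor g p) = S.v.inScale g p := by
    rw [S.scaleTractor_eq g hn]; simp [Tractor.tractorMetric, projector]
  simp only [SCMS.scaleTractorTilde, this]
  rfl

end ScaleTractor
end Tractor
end

noncomputable section
namespace Tractor
variable {n : ℕ} {M : Type*} [TopologicalSpace M] [ChartedSpace (EuclideanSpace ℝ (Fin n)) M]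
  [IsManifold (𝓡 n) ∞ M]

/-! ### The transformation law under conformal rescaling. -/

section ChangeOfScale

variable {g h k : RMetric n M} {s t : M → ℝ}

theorem IsRescaling.trans (hs : IsRescaling g h s) (ht : IsRescaling h k t) :
    IsRescaling g k (s + t) where
  smooth := hs.smooth.add ht.smooth
  eq p u w := by
    rw [ht.eq, hs.eq, ← mul_assoc, ← Real.exp_add, Pi.add_apply]
    congr 2
    ring

theorem IsRescaling.symm (hs : IsRescaling g h s) : IsRescaling h g (-s) where
  smooth := hs.smooth.neg
  eq p u w := by
    rw [hs.eq, ← mul_assoc, ← Real.exp_add, Pi.neg_apply]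
    simp

theorem IsRescaling.unique (hn : n ≠ 0) (hs : IsRescaling g h s) (ht : IsRescaling g h t) :
    s = t := by
  funext p
  have hne : (tangentBasis p : Module.Basis (Fin n) ℝ (TangentSpace (𝓡 n) p))
      ⟨0, Nat.pos_of_ne_zero hn⟩ ≠ 0 := Module.Basis.ne_zero _ _
  set u := (tangentBasis p : Module.Basis (Fin n) ℝ (TangentSpace (𝓡 n) p))
    ⟨0, Nat.pos_of_ne_zero hn⟩
  have h1 := g.pos p u hne
  have h2 := (hs.eq p u u).symm.trans (ht.eq p u u)
  have h3 := Real.exp_injective (mul_right_cancel₀ (ne_of_gt h1) h2)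
  linarith

theorem IsRescaling.grad (hs : IsRescaling g h s) (f : M → ℝ) (p : M) :
    grad h f p = Real.exp (-2 * s p) • grad g f p := by
  refine inner_ext h fun w => ?_
  rw [inner_grad, hs.eq, map_smul, _root_.smul_apply, inner_grad, smul_eq_mul, ← mul_assoc,
    ← Real.exp_add]
  simp

/-- The cocycle property. It is what makes a section given in one scale extend consistently to all
scales. -/
theorem changeScale_changeScale (hs : IsRescaling g h s) (ht : SmoothFn n t) (p : M)
    (I : TractorComp n p) :
    changeScale h t p (changeScale g s p I) = changeScale g (s + t) p I := by
  have hadd : grad g (s + t) p = grad g s p + grad g t p := by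
    refine inner_ext g fun w => ?_
    rw [map_add, _root_.add_apply, inner_grad, inner_grad, inner_grad]
    have := mvfderiv_fun_add (x := p) (SmoothFn.diffAt hs.smooth p) (SmoothFn.diffAt ht p)
    exact congrArg (fun A => A w) this
  have e1 : Real.exp (-(s p + t p)) = Real.exp (-s p) * Real.exp (-t p) := by
    rw [← Real.exp_add]; congr 1; ring
  have e2 : Real.exp (-2 * s p) = Real.exp (-s p) * Real.exp (-s p) := by
    rw [← Real.exp_add]; congr 1; ring
  have e4 : Real.exp (2 * s p) = Real.exp (s p) * Real.exp (s p) := by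
    rw [← Real.exp_add]; congr 1; ring
  have e3 : Real.exp (s p) * Real.exp (-s p) = 1 := by rw [← Real.exp_add]; simp
  simp only [changeScale, hs.grad, hadd, Pi.add_apply, e1, Real.exp_add]
  refine Prod.ext ?_ (Prod.ext ?_ ?_)
  · simp only; ring
  · have e3' : Real.exp (-s p) * Real.exp (-s p) * Real.exp (s p) = Real.exp (-s p) := by
      rw [mul_assoc, mul_comm (Real.exp (-s p)) (Real.exp (s p)), e3, mul_one]
    simp only [e2]
    have : (Real.exp (s p) * I.1) • (Real.exp (-s p) * Real.exp (-s p)) • grad g t p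
        = Real.exp (-s p) • I.1 • grad g t p := by
      rw [smul_smul, smul_smul]
      congr 1
      linear_combination (Real.exp (-s p) * I.1) * e3
    rw [this]
    module
  · simp only [hs.eq, map_add, map_smul, _root_.add_apply, _root_.smul_apply, smul_eq_mul, e2, e4,
      g.symm p (grad g t p) (grad g s p)]
    generalize Real.exp (s p) = x at *
    generalize Real.exp (-s p) = y at *
    have h2 : x * x * (y * y) = 1 := by linear_combination (x * y + 1) * e3
    have h4 : x * x * (y * y * (y * y)) = y * y := by linear_combination (y * y) * h2
    have h3 : x * (x * x * (y * y * (y * y))) = y := by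
      linear_combination x * h4 + y * e3
    have h5 : x * x * (y * y * y) = y := by linear_combination y * h2
    generalize Real.exp (-t p) = z
    generalize g.inner p (grad g t p) I.2.1 = b1
    generalize g.inner p (grad g s p) I.2.1 = b2
    generalize g.inner p (grad g t p) (grad g t p) = b3
    generalize g.inner p (grad g s p) (grad g t p) = b4
    generalize g.inner p (grad g s p) (grad g s p) = b5
    generalize I.1 = i
    linear_combination (-z * (b1 + i * b4)) * h5 - (z * b3 * i / 2) * h3

variable [T2Space M]

theorem smoothComp_changeScale (hs : SmoothFn n s) {I : ∀ p : M, TractorComp n p}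
    (hI : SmoothComp I) : SmoothComp fun p => changeScale g s p (I p) := by
  have he : SmoothFn n fun p => Real.exp (s p) := fun p =>
    ContDiffAt.comp_contMDiffAt (g := Real.exp) Real.contDiff_exp.contDiffAt (hs p)
  have he' : SmoothFn n fun p => Real.exp (-s p) := fun p =>
    ContDiffAt.comp_contMDiffAt (g := Real.exp) Real.contDiff_exp.contDiffAt (hs.neg p)
  have hg := SmoothFn.grad g hs
  refine ⟨he.mul hI.top, ?_, ?_⟩
  · exact SmoothVF.smul he' (SmoothVF.add hI.mid (SmoothVF.smul hI.top hg))
  · exact he'.mul ((hI.bot.sub (SmoothVF.inner g hg hI.mid)).sub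
      (((SmoothVF.inner g hg hg).mul hI.top).div_const 2))

end ChangeOfScale

/-! ### Tractors are determined by, and can be prescribed in, a single scale. -/

section TractorsInScale

variable (c : ConformalClass n M)

theorem ConformalClass.exists_isRescaling (g h : c.scales) : ∃ s, IsRescaling g.1 h.1 s := by
  obtain ⟨g₀, h₀⟩ := c.exists_eq
  obtain ⟨g, hg⟩ := g
  obtain ⟨h, hh⟩ := h
  rw [h₀] at hg hh
  obtain ⟨s, hs⟩ := hg
  obtain ⟨t, ht⟩ := hh
  exact ⟨_, hs.symm.trans ht⟩

variable {c}

theorem tractors_ext {I K : tractors c} {g : c.scales} (h : I.1 g = K.1 g) : I = K := by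
  refine Subtype.ext (funext fun k => funext fun p => ?_)
  obtain ⟨s, hs⟩ := c.exists_isRescaling g k
  rw [I.2.2 g k s hs, K.2.2 g k s hs, h]

/-- Every smooth section of `ℝ ⊕ TM ⊕ ℝ` is a tractor in a given scale. -/
theorem exists_tractor [T2Space M] (hn : n ≠ 0) (g : c.scales) {K : ∀ p : M, TractorComp n p}
    (hK : SmoothComp K) : ∃ I : tractors c, I.1 g = K := by
  choose s hs using c.exists_isRescaling g
  -- The rescaling functions are arbitrary choices, but in positive dimension they are unique; so
  -- the one from `g` to itself is zero and `K` is recovered in the scale `g`.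
  have h0 : s g = 0 := (hs g).unique hn ⟨contMDiff_const, fun p u w => by simp⟩
  refine ⟨⟨fun h p => changeScale g.1 (s h) p (K p),
    fun h => smoothComp_changeScale (hs h).smooth hK, fun h k t ht p => ?_⟩, ?_⟩
  · simp only [changeScale_changeScale (hs h) ht.smooth, (hs k).unique hn ((hs h).trans ht)]
  · funext p
    have hz : grad g.1 (0 : M → ℝ) p = 0 := inner_ext g.1 fun w => by
      rw [inner_grad]
      have : mvfderiv (𝓡 n) (0 : M → ℝ) p = 0 := mvfderiv_const (0 : ℝ)
      rw [this]; simp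
    simp [changeScale, h0, hz]

end TractorsInScale
end Tractor
end

noncomputable section
namespace Tractor
variable {n : ℕ} {M : Type*} [TopologicalSpace M] [ChartedSpace (EuclideanSpace ℝ (Fin n)) M]
  [IsManifold (𝓡 n) ∞ M]

/-! ### Coordinates and coordinate frames extended to the whole manifold. -/

section LocalCoordinates

open Set Filter Topology

omit [IsManifold (𝓡 n) ∞ M] in
theorem mvfderiv_comp_fderiv {E F : Type*} [NormedAddCommGroup E] [NormedSpace ℝ E]
    [NormedAddCommGroup F] [NormedSpace ℝ F] {G : E → F} {Φ : M → E} {q : M}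
    (hG : DifferentiableAt ℝ G (Φ q)) (hΦ : MDifferentiableAt (𝓡 n) 𝓘(ℝ, E) Φ q)
    (u : TangentSpace (𝓡 n) q) :
    mvfderiv (𝓡 n) (fun r => G (Φ r)) q u = fderiv ℝ G (Φ q) (mvfderiv (𝓡 n) Φ q u) := by
  have := mfderiv_comp_apply (I := 𝓡 n) (I' := 𝓘(ℝ, E)) (I'' := 𝓘(ℝ, F)) (g := G) q
    hG.mdifferentiableAt hΦ u
  refine this.trans ?_
  have h : mfderiv 𝓘(ℝ, E) 𝓘(ℝ, F) G (Φ q) = fderiv ℝ G (Φ q) := mfderiv_eq_fderiv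
  exact congrArg (fun A : E →L[ℝ] F => A (mvfderiv (𝓡 n) Φ q u)) h

/-- Coordinates near `p`, given by globally smooth functions and a frame of globally smooth
vector fields. -/
structure LocalCoord (p : M) where
  toFun : M → EuclideanSpace ℝ (Fin n)
  smooth : ContMDiff (𝓡 n) 𝓘(ℝ, EuclideanSpace ℝ (Fin n)) ∞ toFun
  frame : EuclideanSpace ℝ (Fin n) → ∀ q : M, TangentSpace (𝓡 n) q
  frame_add : ∀ u w, frame (u + w) = frame u + frame w
  frame_smul : ∀ (c : ℝ) u, frame (c • u) = c • frame u
  smooth_frame : ∀ u, SmoothVF (frame u)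
  map_nhds : map toFun (𝓝 p) = 𝓝 (toFun p)
  deriv_frame : ∀ᶠ q in 𝓝 p, ∀ u, mvfderiv (𝓡 n) toFun q (frame u q) = u
  frame_deriv : ∀ᶠ q in 𝓝 p, ∀ w, frame (mvfderiv (𝓡 n) toFun q w) q = w
  lift : ∀ f : M → ℝ, SmoothFn n f → ∃ F : EuclideanSpace ℝ (Fin n) → ℝ, ContDiff ℝ ∞ F ∧
    ∀ᶠ q in 𝓝 p, F (toFun q) = f q

variable [T2Space M]

/-- The chart at `p` and the constant fields of the tangent trivialization are multiplied by a bump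
function equal to one near `p`; the derivative of the chart is the trivialization itself, so the two
are inverse to each other there. -/
theorem exists_localCoord (p : M) : Nonempty (LocalCoord (n := n) p) := by
  let E := EuclideanSpace ℝ (Fin n)
  set t := trivializationAt E (fun p : M => TangentSpace (𝓡 n) p) p with ht
  have hbase : t.baseSet = (chartAt E p).source := TangentBundle.trivializationAt_baseSet _
  obtain ⟨χ⟩ : Nonempty (SmoothBumpFunction (𝓡 n) p) := inferInstance
  have hχ1 := χ.eventuallyEq_one
  have hsrc : ∀ᶠ q in 𝓝 p, q ∈ (chartAt E p).source := (chartAt E p).open_source.mem_nhds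
    (mem_chart_source E p)
  set Φ : M → E := fun q => χ q • extChartAt (𝓡 n) p q with hΦ
  have hΦe : Φ =ᶠ[𝓝 p] extChartAt (𝓡 n) p := by
    filter_upwards [hχ1] with q hq
    simp [hΦ, hq]
  have hΦs : ContMDiff (𝓡 n) 𝓘(ℝ, E) ∞ Φ := χ.contMDiff_smul contMDiffOn_extChartAt
  set W : E → ∀ q : M, TangentSpace (𝓡 n) q := fun u q => χ q • t.symmL ℝ q u with hW
  have hd : ∀ᶠ q in 𝓝 p, ∀ w, mvfderiv (𝓡 n) Φ q w = t.continuousLinearMapAt ℝ q w := by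
    filter_upwards [hΦe.eventuallyEq_nhds, hsrc] with q hq hqs w
    refine Eq.trans ?_ (congrArg (fun A => A w)
      (TangentBundle.continuousLinearMapAt_trivializationAt hqs)).symm
    have h := Filter.EventuallyEq.mfderiv_eq (I := 𝓡 n) (I' := 𝓘(ℝ, E)) hq
    exact congrArg (fun A : E →L[ℝ] E => A w) h
  have hWe : ∀ᶠ q in 𝓝 p, ∀ u, W u q = t.symmL ℝ q u := by
    filter_upwards [hχ1] with q hq u
    simp [hW, hq]
  refine ⟨⟨Φ, hΦs, W, ?_, ?_, ?_, ?_, ?_, ?_, ?_⟩⟩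
  · intro u w; funext q; simp [hW]
  · intro c u; funext q; simp [hW, smul_comm c]
  · intro u
    refine ContMDiffOn.smul_section_of_tsupport (u := (chartAt E p).source) χ.contMDiff.contMDiffOn
      (chartAt E p).open_source χ.tsupport_subset_chartAt_source ?_
    rw [← hbase, t.contMDiffOn_section_baseSet_iff]
    refine (contMDiffOn_const (c := u)).congr fun y hy => ?_
    rw [t.symmL_apply hy]
    exact congrArg Prod.snd (t.apply_mk_symm hy u)
  · rw [Filter.map_congr hΦe, hΦe.self_of_nhds]
    exact map_extChartAt_nhds_of_boundaryless (I := 𝓡 n) p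
  · filter_upwards [hd, hWe, hsrc] with q h1 h2 h3 u
    rw [h1, h2]
    exact t.continuousLinearMapAt_symmL (by rw [hbase]; exact h3) u
  · filter_upwards [hd, hWe, hsrc] with q h1 h2 h3 u
    rw [h1, h2]
    exact t.symmL_continuousLinearMapAt (by rw [hbase]; exact h3) u
  · intro f hf
    have h1 : ContDiffOn ℝ ∞ (f ∘ (extChartAt (𝓡 n) p).symm) (extChartAt (𝓡 n) p).target :=
      (hf.comp_contMDiffOn (contMDiffOn_extChartAt_symm p)).contDiffOn
    have hmem : (extChartAt (𝓡 n) p).target ∈ 𝓝 (extChartAt (𝓡 n) p p) :=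
      extChartAt_target_mem_nhds p
    obtain ⟨F, hF, hFe⟩ := exists_contDiff_eventuallyEq hmem h1
    refine ⟨F, hF, ?_⟩
    have hc := (continuousAt_extChartAt (I := 𝓡 n) p).eventually hFe
    filter_upwards [hc, hΦe, hsrc] with q h1 h2 h3
    rw [h2, h1]
    simp only [Function.comp_apply]
    rw [(extChartAt (𝓡 n) p).left_inv (by rwa [extChartAt_source])]

end LocalCoordinates
end Tractor
end

noncomputable section
namespace Tractor
variable {n : ℕ} {M : Type*} [TopologicalSpace M] [ChartedSpace (EuclideanSpace ℝ (Fin n)) M]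
  [IsManifold (𝓡 n) ∞ M]

/-! ### Connections of tractor type for an arbitrary endomorphism field. -/

section Connections

open Set Filter Topology

/-- The connection on `ℝ ⊕ TM ⊕ ℝ` defined by the metric `g` and the field of endomorphisms `P`. -/
def tractorConn (g : RMetric n M) (P : ∀ p : M, TangentSpace (𝓡 n) p → TangentSpace (𝓡 n) p)
    (I : ∀ p : M, TractorComp n p) (p : M) (u : TangentSpace (𝓡 n) p) : TractorComp n p :=
  (mvfderiv (𝓡 n) (fun q => (I q).1) p u - g.inner p (I p).2.1 u,
   leviCivita g (fun q => (I q).2.1) p u + (I p).1 • P p u + (I p).2.2 • u,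
   mvfderiv (𝓡 n) (fun q => (I q).2.2) p u - g.inner p (P p u) (I p).2.1)

/-- Differentiability of a section of `ℝ ⊕ TM ⊕ ℝ` at a point. -/
structure DiffCompAt (I : ∀ p : M, TractorComp n p) (p : M) : Prop where
  top : MDifferentiableAt (𝓡 n) 𝓘(ℝ) (fun q => (I q).1) p
  mid : DiffAt (fun q => (I q).2.1) p
  bot : MDifferentiableAt (𝓡 n) 𝓘(ℝ) (fun q => (I q).2.2) p

theorem SmoothComp.diffAt {I : ∀ p : M, TractorComp n p} (h : SmoothComp I) (p : M) :
    DiffCompAt I p :=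
  ⟨SmoothFn.diffAt h.top p, SmoothVF.diffAt h.mid p, SmoothFn.diffAt h.bot p⟩

variable (g : RMetric n M) {P : ∀ p : M, TangentSpace (𝓡 n) p → TangentSpace (𝓡 n) p}
  {I K : ∀ p : M, TractorComp n p} {p : M}

theorem tractorConn_add (hI : DiffCompAt I p) (hK : DiffCompAt K p) (u : TangentSpace (𝓡 n) p) :
    tractorConn g P (I + K) p u = tractorConn g P I p u + tractorConn g P K p u := by
  have h1 := mvfderiv_fun_add hI.top hK.top
  have h2 : leviCivita g (fun q => ((I + K) q).2.1) p u
      = leviCivita g (fun q => (I q).2.1) p u + leviCivita g (fun q => (K q).2.1) p u :=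
    congrArg (fun A => A u) (leviCivita_add g hI.mid hK.mid)
  have h3 := mvfderiv_fun_add hI.bot hK.bot
  refine Prod.ext ?_ (Prod.ext ?_ ?_)
  · simp [tractorConn, h1]; ring
  · simp only [tractorConn, Prod.snd_add, Prod.fst_add, h2]
    simp only [Pi.add_apply, Prod.snd_add, Prod.fst_add]
    module
  · simp [tractorConn, h3]; ring

theorem tractorConn_smul {f : M → ℝ} (hf : MDifferentiableAt (𝓡 n) 𝓘(ℝ) f p)
    (hI : DiffCompAt I p) (u : TangentSpace (𝓡 n) p) :
    tractorConn g P (f • I) p u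
      = f p • tractorConn g P I p u + mvfderiv (𝓡 n) f p u • I p := by
  have h1 := mvfderiv_fun_mul hf hI.top
  have h2 : leviCivita g (fun q => ((f • I) q).2.1) p u
      = f p • leviCivita g (fun q => (I q).2.1) p u + mvfderiv (𝓡 n) f p u • (I p).2.1 := by
    exact leviCivita_smul g hf hI.mid u
  have h3 := mvfderiv_fun_mul hf hI.bot
  refine Prod.ext ?_ (Prod.ext ?_ ?_)
  · simp [tractorConn, h1]; ring
  · simp only [tractorConn, Prod.snd_add, Prod.fst_add, h2]
    simp only [Pi.smul_apply', Prod.smul_snd, Prod.smul_fst]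
    module
  · simp [tractorConn, h3]; ring

theorem tractorConn_const_smul (c : ℝ) (hI : DiffCompAt I p) (u : TangentSpace (𝓡 n) p) :
    tractorConn g P (c • I) p u = c • tractorConn g P I p u := by
  have h := tractorConn_smul g (P := P) (f := fun _ => c) mdifferentiableAt_const hI u
  rw [mvfderiv_const] at h
  rw [_root_.zero_apply, zero_smul, add_zero] at h
  exact h

theorem tractorConn_sub (hI : DiffCompAt I p) (hK : DiffCompAt K p) (u : TangentSpace (𝓡 n) p) :
    tractorConn g P (I - K) p u = tractorConn g P I p u - tractorConn g P K p u := by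
  have hc : MDifferentiableAt (𝓡 n) 𝓘(ℝ) (fun _ : M => (-1 : ℝ)) p := mdifferentiableAt_const
  have hK' : DiffCompAt ((-1 : ℝ) • K) p :=
    ⟨hc.mul hK.top, diffAt_smul hc hK.mid, hc.mul hK.bot⟩
  rw [show I - K = I + (-1 : ℝ) • K by rw [neg_one_smul, sub_eq_add_neg],
    tractorConn_add g hI hK', tractorConn_const_smul g _ hK, neg_one_smul, sub_eq_add_neg]

theorem tractorConn_congr (hI : DiffCompAt I p) (hK : DiffCompAt K p) (h : ∀ᶠ q in 𝓝 p, I q = K q) :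
    tractorConn g P I p = tractorConn g P K p := by
  funext u
  have h1 : mvfderiv (𝓡 n) (fun q => (I q).1) p = mvfderiv (𝓡 n) (fun q => (K q).1) p :=
    Filter.EventuallyEq.mfderiv_eq (I := 𝓡 n) (I' := 𝓘(ℝ)) (h.mono fun q hq => by simp only [hq])
  have h3 : mvfderiv (𝓡 n) (fun q => (I q).2.2) p = mvfderiv (𝓡 n) (fun q => (K q).2.2) p :=
    Filter.EventuallyEq.mfderiv_eq (I := 𝓡 n) (I' := 𝓘(ℝ)) (h.mono fun q hq => by simp only [hq])
  have h2 := leviCivita_congr g hI.mid hK.mid (h.mono fun q hq => by simp only [hq])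
  simp only [tractorConn, h1, h2, h3, h.self_of_nhds]

theorem tractorConn_add_right (hP : SmoothEnd P) (u w : TangentSpace (𝓡 n) p) :
    tractorConn g P I p (u + w) = tractorConn g P I p u + tractorConn g P I p w := by
  refine Prod.ext ?_ (Prod.ext ?_ ?_)
  · simp [tractorConn]; ring
  · simp only [tractorConn, Prod.snd_add, Prod.fst_add, hP.add, map_add]
    module
  · simp [tractorConn, hP.add]; ring

theorem tractorConn_smul_right (hP : SmoothEnd P) (c : ℝ) (u : TangentSpace (𝓡 n) p) :
    tractorConn g P I p (c • u) = c • tractorConn g P I p u := by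
  refine Prod.ext ?_ (Prod.ext ?_ ?_)
  · simp [tractorConn]; ring
  · simp only [tractorConn, Prod.smul_snd, Prod.smul_fst, hP.smul, map_smul]
    module
  · simp [tractorConn, hP.smul]; ring

theorem tractorConn_zero_right (hP : SmoothEnd P) : tractorConn g P I p 0 = 0 := by
  have := tractorConn_smul_right g (I := I) (p := p) hP 0 0
  rwa [zero_smul, zero_smul] at this

/-- The connection preserves the tractor metric. -/
theorem mvfderiv_tractorMetric (hI : DiffCompAt I p) (hK : DiffCompAt K p)
    (u : TangentSpace (𝓡 n) p) :
    mvfderiv (𝓡 n) (fun q => tractorMetric g q (I q) (K q)) p u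
      = tractorMetric g p (tractorConn g P I p u) (K p)
        + tractorMetric g p (I p) (tractorConn g P K p u) := by
  have h1 := mvfderiv_fun_mul hI.top hK.bot
  have h2 := mvfderiv_fun_mul hI.bot hK.top
  have h3 := mvfderiv_inner g hI.mid hK.mid u
  have h4 := mvfderiv_fun_add (hI.top.mul hK.bot) (hI.bot.mul hK.top)
  have h5 := mvfderiv_fun_add ((hI.top.mul hK.bot).add (hI.bot.mul hK.top))
    (mdiff_inner g hI.mid hK.mid)
  have h6 := congrArg (fun A => A u) h5
  refine Eq.trans h6 ?_
  have h7 := congrArg (fun A => A u) h4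
  have h8 := congrArg (fun A => A u) h1
  have h9 := congrArg (fun A => A u) h2
  simp only [_root_.add_apply, _root_.smul_apply, smul_eq_mul] at h8 h9
  refine (congrArg₂ (· + ·) (h7.trans (congrArg₂ (· + ·) h8 h9)) h3).trans ?_
  simp only [tractorConn, tractorMetric, map_add, map_smul, _root_.add_apply, _root_.smul_apply,
    smul_eq_mul, g.symm p (I p).2.1]
  rw [g.symm p (leviCivita g (fun q => (I q).2.1) p u) (K p).2.1,
    g.symm p (K p).2.1 u, g.symm p (P p u) (K p).2.1]
  ring

variable [T2Space M]

theorem SmoothComp.tractorConn (hP : SmoothEnd P) (hI : SmoothComp I)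
    {X : ∀ p : M, TangentSpace (𝓡 n) p} (hX : SmoothVF X) :
    SmoothComp fun p => tractorConn g P I p (X p) := by
  have hPX := hP.smooth X hX
  refine ⟨?_, ?_, ?_⟩
  · exact (SmoothVF.deriv hI.top hX).sub (SmoothVF.inner g hI.mid hX)
  · exact ((SmoothVF.leviCivita g hX hI.mid).add (SmoothVF.smul hI.top hPX)).add
      (SmoothVF.smul hI.bot hX)
  · exact (SmoothVF.deriv hI.bot hX).sub (SmoothVF.inner g hPX hI.mid)

/-- The curvature of `tractorConn`. -/
def tractorCurv (g : RMetric n M) (P : ∀ p : M, TangentSpace (𝓡 n) p → TangentSpace (𝓡 n) p)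
    (X Z : ∀ p : M, TangentSpace (𝓡 n) p) (I : ∀ p : M, TractorComp n p) (p : M) :
    TractorComp n p :=
  -Tractor.tractorConn g P (fun q => Tractor.tractorConn g P I q (Z q)) p (X p)
    + Tractor.tractorConn g P (fun q => Tractor.tractorConn g P I q (X q)) p (Z p)
    + Tractor.tractorConn g P I p (VectorField.mlieBracket (𝓡 n) X Z p)

end Connections
end Tractor
end

noncomputable section
namespace Tractor
variable {n : ℕ} {M : Type*} [TopologicalSpace M] [ChartedSpace (EuclideanSpace ℝ (Fin n)) M]
  [IsManifold (𝓡 n) ∞ M]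

/-! ### Sections of `ℝ ⊕ TM ⊕ ℝ` in coordinates. -/

section CoordinateExpression

open Set Filter Topology

variable (n) in
/-- The model fibre of the tractor bundle. -/
abbrev TractorModel := ℝ × EuclideanSpace ℝ (Fin n) × ℝ

variable (g : RMetric n M) {P : ∀ p : M, TangentSpace (𝓡 n) p → TangentSpace (𝓡 n) p}
  {p : M} (C : LocalCoord (n := n) p)

namespace LocalCoord

/-- The section with constant coordinates `a`. -/
def sect (a : TractorModel n) (q : M) : TractorComp n q := (a.1, C.frame a.2.1 q, a.2.2)

/-- The coordinates of a tractor. -/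
def coeff (q : M) (I : TractorComp n q) : TractorModel n :=
  (I.1, mvfderiv (𝓡 n) C.toFun q I.2.1, I.2.2)

theorem sect_add (a b : TractorModel n) : C.sect (a + b) = C.sect a + C.sect b := by
  funext q
  simp [sect, C.frame_add]

theorem sect_smul (c : ℝ) (a : TractorModel n) : C.sect (c • a) = c • C.sect a := by
  funext q
  simp [sect, C.frame_smul]

theorem coeff_add (q : M) (I K : TractorComp n q) : C.coeff q (I + K) = C.coeff q I + C.coeff q K := by
  simp [coeff]

theorem coeff_smul (q : M) (c : ℝ) (I : TractorComp n q) : C.coeff q (c • I) = c • C.coeff q I := by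
  simp [coeff]

theorem smoothComp_sect (a : TractorModel n) : SmoothComp (C.sect a) :=
  ⟨contMDiff_const, C.smooth_frame _, contMDiff_const⟩

theorem eventually_coeff_sect : ∀ᶠ q in 𝓝 p, ∀ a, C.coeff q (C.sect a q) = a := by
  filter_upwards [C.deriv_frame] with q hq a
  simp [coeff, sect, hq]

theorem eventually_sect_coeff : ∀ᶠ q in 𝓝 p, ∀ I : TractorComp n q, C.sect (C.coeff q I) q = I := by
  filter_upwards [C.frame_deriv] with q hq I
  simp [coeff, sect, hq]

theorem frame_eq_sum (u : EuclideanSpace ℝ (Fin n)) :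
    C.frame u = ∑ i, u i • C.frame (EuclideanSpace.single i 1) := by
  let L : EuclideanSpace ℝ (Fin n) →ₗ[ℝ] (∀ q : M, TangentSpace (𝓡 n) q) :=
    { toFun := C.frame, map_add' := C.frame_add, map_smul' := C.frame_smul }
  have h : u = ∑ i, u i • EuclideanSpace.single i (1 : ℝ) := by
    have := (EuclideanSpace.basisFun (Fin n) ℝ).sum_repr u
    simpa using this.symm
  calc C.frame u = L (∑ i, u i • EuclideanSpace.single i (1 : ℝ)) := congrArg L h
    _ = _ := by rw [map_sum]; simp only [map_smul]; rfl

theorem frame_fun_eq_sum (Z : M → EuclideanSpace ℝ (Fin n)) :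
    (fun q => C.frame (Z q) q)
      = ∑ i, (fun q => Z q i) • C.frame (EuclideanSpace.single i 1) := by
  funext q
  rw [C.frame_eq_sum (Z q), Finset.sum_apply, Finset.sum_apply]
  rfl

theorem smoothVF_frame_fun {Z : M → EuclideanSpace ℝ (Fin n)}
    (hZ : ContMDiff (𝓡 n) 𝓘(ℝ, EuclideanSpace ℝ (Fin n)) ∞ Z) :
    SmoothVF fun q => C.frame (Z q) q := by
  rw [C.frame_fun_eq_sum]
  have h : ∀ i, SmoothVF ((fun q => Z q i) • C.frame (EuclideanSpace.single i 1)) := fun i =>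
    SmoothVF.smul (f := fun q => Z q i) (fun q =>
      (EuclideanSpace.proj (𝕜 := ℝ) i).contDiff.contDiffAt.comp_contMDiffAt (hZ q))
      (C.smooth_frame _)
  intro q
  have := ContMDiffAt.sum_section (I := 𝓡 n) (n := ∞) (s := Finset.univ) fun i _ => h i q
  refine this.congr_of_eventuallyEq (Eventually.of_forall fun r => ?_)
  simp only [Finset.sum_apply]

theorem smoothComp_sect_fun {Y : M → TractorModel n}
    (hY : ContMDiff (𝓡 n) 𝓘(ℝ, TractorModel n) ∞ Y) : SmoothComp fun q => C.sect (Y q) q := by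
  refine ⟨?_, C.smoothVF_frame_fun (Z := fun q => (Y q).2.1) ?_, ?_⟩
  · exact fun q => contDiff_fst.contDiffAt.comp_contMDiffAt (hY q)
  · exact fun q => (contDiff_fst.comp contDiff_snd).contDiffAt.comp_contMDiffAt (hY q)
  · exact fun q => ContDiffAt.comp_contMDiffAt (f := Y) (g := fun a : TractorModel n => a.2.2)
      (contDiff_snd.comp contDiff_snd).contDiffAt (hY q)

theorem leviCivita_frame_fun {Z : M → EuclideanSpace ℝ (Fin n)}
    (hZ : ContMDiff (𝓡 n) 𝓘(ℝ, EuclideanSpace ℝ (Fin n)) ∞ Z) (q : M)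
    (u : TangentSpace (𝓡 n) q) :
    leviCivita g (fun r => C.frame (Z r) r) q u
      = leviCivita g (C.frame (Z q)) q u + C.frame (mvfderiv (𝓡 n) Z q u) q := by
  have key : ∀ (s : Finset (Fin n)) (f : Fin n → M → ℝ), (∀ i, SmoothFn n (f i)) →
      SmoothVF (∑ i ∈ s, f i • C.frame (EuclideanSpace.single i 1)) ∧
      leviCivita g (∑ i ∈ s, f i • C.frame (EuclideanSpace.single i 1)) q u
        = ∑ i ∈ s, (f i q • leviCivita g (C.frame (EuclideanSpace.single i 1)) q u
            + mvfderiv (𝓡 n) (f i) q u • C.frame (EuclideanSpace.single i 1) q) := by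
    intro s f hf
    induction s using Finset.induction_on with
    | empty =>
      refine ⟨SmoothVF.zero, ?_⟩
      simp
    | insert i s hi ih =>
      have h1 := SmoothVF.smul (hf i) (C.smooth_frame (EuclideanSpace.single i 1))
      rw [Finset.sum_insert hi, Finset.sum_insert hi]
      refine ⟨h1.add ih.1, ?_⟩
      refine (congrArg (fun A => A u) (leviCivita_add g (h1.diffAt q) (ih.1.diffAt q))).trans ?_
      refine congrArg₂ (· + ·) (leviCivita_smul g ((hf i).diffAt q)
        ((C.smooth_frame _).diffAt q) u) ih.2
  have hZi : ∀ i, SmoothFn n (fun r => Z r i) := fun i r =>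
      (EuclideanSpace.proj (𝕜 := ℝ) i).contDiff.contDiffAt.comp_contMDiffAt (hZ r)
  have h1 := (key Finset.univ (fun i r => Z r i) hZi).2
  have h2 := (key Finset.univ (fun i _ => Z q i) (fun i => contMDiff_const)).2
  have h3 : C.frame (Z q) = ∑ i, (fun _ : M => Z q i) • C.frame (EuclideanSpace.single i 1) :=
    C.frame_eq_sum (Z q)
  rw [C.frame_fun_eq_sum, h3, h1, h2, C.frame_eq_sum (mvfderiv (𝓡 n) Z q u), Finset.sum_apply,
    ← Finset.sum_add_distrib]
  refine Finset.sum_congr rfl fun i _ => ?_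
  have h4 : mvfderiv (𝓡 n) (fun r => Z r i) q u = (mvfderiv (𝓡 n) Z q u) i := by
    have := mvfderiv_comp_fderiv (G := EuclideanSpace.proj (𝕜 := ℝ) i)
      (EuclideanSpace.proj (𝕜 := ℝ) i).differentiableAt
      (hZ.mdifferentiableAt (by simp) : MDifferentiableAt (𝓡 n) _ Z q) u
    rw [ContinuousLinearMap.fderiv] at this
    exact this
  rw [h4, mvfderiv_const]
  simp

/-- The Leibniz rule: the covariant derivative is that of the section with coordinates frozen at
`q`, plus the ordinary derivative of the coordinates. -/
theorem tractorConn_sect_fun {Y : M → TractorModel n}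
    (hY : ContMDiff (𝓡 n) 𝓘(ℝ, TractorModel n) ∞ Y) (q : M) (u : TangentSpace (𝓡 n) q) :
    tractorConn g P (fun r => C.sect (Y r) r) q u
      = tractorConn g P (C.sect (Y q)) q u + C.sect (mvfderiv (𝓡 n) Y q u) q := by
  have hL : ∀ {F : Type} [NormedAddCommGroup F] [NormedSpace ℝ F] (L : TractorModel n →L[ℝ] F),
      mvfderiv (𝓡 n) (fun r => L (Y r)) q u = L (mvfderiv (𝓡 n) Y q u) := by
    intro F _ _ L
    have := mvfderiv_comp_fderiv (G := L) L.differentiableAt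
      (hY.mdifferentiableAt (by simp) : MDifferentiableAt (𝓡 n) _ Y q) u
    rwa [ContinuousLinearMap.fderiv] at this
  have h1 := hL (ContinuousLinearMap.fst ℝ _ _)
  have h2 := hL ((ContinuousLinearMap.fst ℝ _ _).comp (ContinuousLinearMap.snd ℝ ℝ (EuclideanSpace ℝ (Fin n) × ℝ)))
  have h3 := hL ((ContinuousLinearMap.snd ℝ _ _).comp (ContinuousLinearMap.snd ℝ ℝ (EuclideanSpace ℝ (Fin n) × ℝ)))
  simp only [ContinuousLinearMap.coe_comp, ContinuousLinearMap.coe_fst', ContinuousLinearMap.coe_snd', Function.comp_apply] at h1 h2 h3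
  have h4 := C.leviCivita_frame_fun g (Z := fun q => (Y q).2.1)
    (fun q => (contDiff_fst.comp contDiff_snd).contDiffAt.comp_contMDiffAt (hY q)) q u
  rw [h2] at h4
  refine Prod.ext ?_ (Prod.ext ?_ ?_)
  · simp only [tractorConn, sect, h1, Prod.fst_add, mvfderiv_const, _root_.zero_apply]
    ring
  · simp only [tractorConn, sect, h4, Prod.fst_add, Prod.snd_add]
    abel
  · simp only [tractorConn, sect, h3, Prod.snd_add, mvfderiv_const, _root_.zero_apply]
    ring

/-- The coordinates of a smooth section are smooth functions of the coordinates. -/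
theorem exists_lift_coeff {I : ∀ q : M, TractorComp n q} (hI : SmoothComp I) :
    ∃ Y : EuclideanSpace ℝ (Fin n) → TractorModel n, ContDiff ℝ ∞ Y ∧
      ∀ᶠ q in 𝓝 p, Y (C.toFun q) = C.coeff q (I q) := by
  obtain ⟨Y₁, h₁, e₁⟩ := C.lift _ hI.top
  obtain ⟨Y₃, h₃, e₃⟩ := C.lift _ hI.bot
  have hΦ : ∀ i, SmoothFn n (fun r => C.toFun r i) := fun i r =>
      (EuclideanSpace.proj (𝕜 := ℝ) i).contDiff.contDiffAt.comp_contMDiffAt (C.smooth r)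
  have h : ∀ i, ∃ F : EuclideanSpace ℝ (Fin n) → ℝ, ContDiff ℝ ∞ F ∧ ∀ᶠ q in 𝓝 p,
      F (C.toFun q) = mvfderiv (𝓡 n) (fun r => C.toFun r i) q (I q).2.1 := fun i =>
    C.lift _ (SmoothVF.deriv (hΦ i) hI.mid)
  choose Y₂ h₂ e₂ using h
  refine ⟨fun x => (Y₁ x, WithLp.toLp 2 (fun i => Y₂ i x), Y₃ x),
    h₁.prodMk (ContDiff.prodMk (contDiff_euclidean.2 fun i => h₂ i) h₃), ?_⟩
  filter_upwards [e₁, eventually_all.2 e₂, e₃] with q q₁ q₂ q₃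
  refine Prod.ext q₁ (Prod.ext ?_ q₃)
  ext i
  refine (q₂ i).trans ?_
  have := mvfderiv_comp_fderiv (G := EuclideanSpace.proj (𝕜 := ℝ) i)
      (EuclideanSpace.proj (𝕜 := ℝ) i).differentiableAt
      (C.smooth.mdifferentiableAt (by simp) : MDifferentiableAt (𝓡 n) _ C.toFun q) (I q).2.1
  rw [ContinuousLinearMap.fderiv] at this
  exact this

end LocalCoord
end CoordinateExpression
end Tractor
end

noncomputable section
namespace Tractor
variable {n : ℕ} {M : Type*} [TopologicalSpace M] [ChartedSpace (EuclideanSpace ℝ (Fin n)) M]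
  [IsManifold (𝓡 n) ∞ M]

/-! ### The connection form and local uniqueness of parallel sections. -/

section ParallelSections

open Set Filter Topology

variable [T2Space M] (g : RMetric n M)
  {P : ∀ p : M, TangentSpace (𝓡 n) p → TangentSpace (𝓡 n) p} (hP : SmoothEnd P)
  {p : M} (C : LocalCoord (n := n) p)

namespace LocalCoord

include hP in
-- Derivatives of the constant sections along the coordinate fields have coordinates that lift to
-- smooth functions for each pair of basis vectors. Bilinearity assembles these into `Γ`, turning
-- parallelism into `dY = -Γ Y`.
theorem exists_connectionForm :
    ∃ Γ : EuclideanSpace ℝ (Fin n) → EuclideanSpace ℝ (Fin n) →L[ℝ] TractorModel n →L[ℝ]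
        TractorModel n, ContDiff ℝ ∞ Γ ∧
      ∀ᶠ q in 𝓝 p, ∀ u a, Γ (C.toFun q) u a
        = C.coeff q (tractorConn g P (C.sect a) q (C.frame u q)) := by
  let e := (EuclideanSpace.basisFun (Fin n) ℝ).toBasis
  let b := Module.finBasis ℝ (TractorModel n)
  have h : ∀ i j, ∃ Y : EuclideanSpace ℝ (Fin n) → TractorModel n, ContDiff ℝ ∞ Y ∧
      ∀ᶠ q in 𝓝 p, Y (C.toFun q)
        = C.coeff q (tractorConn g P (C.sect (b j)) q (C.frame (e i) q)) := fun i j =>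
    C.exists_lift_coeff (SmoothComp.tractorConn g hP (C.smoothComp_sect _) (C.smooth_frame _))
  choose Y hY hYe using h
  refine ⟨fun x => ∑ i, ∑ j, (e.coord i).toContinuousLinearMap.smulRight
    ((b.coord j).toContinuousLinearMap.smulRight (Y i j x)), ?_, ?_⟩
  · exact ContDiff.sum fun i _ => ContDiff.sum fun j _ =>
      contDiff_const.smulRight (contDiff_const.smulRight (hY i j))
  · filter_upwards [eventually_all.2 fun i => eventually_all.2 (hYe i)] with q hq
    let L : EuclideanSpace ℝ (Fin n) →ₗ[ℝ] TractorModel n →ₗ[ℝ] TractorModel n :=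
      LinearMap.mk₂ ℝ (fun u a => C.coeff q (tractorConn g P (C.sect a) q (C.frame u q)))
        (fun u w a => by
          rw [C.frame_add, Pi.add_apply, tractorConn_add_right g hP, coeff_add])
        (fun c u a => by
          rw [C.frame_smul, Pi.smul_apply, tractorConn_smul_right g hP, coeff_smul])
        (fun u a a' => by
          rw [C.sect_add, tractorConn_add g ((C.smoothComp_sect a).diffAt q)
            ((C.smoothComp_sect a').diffAt q), coeff_add])
        (fun c u a => by
          rw [C.sect_smul, tractorConn_const_smul g c ((C.smoothComp_sect a).diffAt q),
            coeff_smul])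
    intro u a
    change _ = L u a
    have hL : L = ∑ i, ∑ j, (e.coord i).smulRight ((b.coord j).smulRight (Y i j (C.toFun q))) := by
      refine e.ext fun i => b.ext fun j => ?_
      have : L (e i) (b j) = Y i j (C.toFun q) := (hq i j).symm
      rw [this]
      simp [Finsupp.single_apply, Module.Basis.repr_self, ite_smul]
    rw [hL]
    simp

variable {C g}
variable {Γ : EuclideanSpace ℝ (Fin n) → EuclideanSpace ℝ (Fin n) →L[ℝ] TractorModel n →L[ℝ]
  TractorModel n}
  (hΓ : ∀ᶠ q in 𝓝 p, ∀ u a, Γ (C.toFun q) u a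
        = C.coeff q (tractorConn g P (C.sect a) q (C.frame u q)))

include hΓ in
omit [T2Space M] in
theorem coeff_tractorConn : ∀ᶠ q in 𝓝 p, ∀ Y : EuclideanSpace ℝ (Fin n) → TractorModel n,
    ContDiff ℝ ∞ Y → ∀ u, C.coeff q (tractorConn g P (fun r => C.sect (Y (C.toFun r)) r) q
      (C.frame u q)) = Γ (C.toFun q) u (Y (C.toFun q)) + fderiv ℝ Y (C.toFun q) u := by
  filter_upwards [hΓ, C.deriv_frame, C.eventually_coeff_sect] with q h1 h2 h3 Y hY u
  have hYΦ : ContMDiff (𝓡 n) 𝓘(ℝ, TractorModel n) ∞ fun r => Y (C.toFun r) := fun r =>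
    hY.contDiffAt.comp_contMDiffAt (C.smooth r)
  have h4 := mvfderiv_comp_fderiv (G := Y) (hY.contDiffAt.differentiableAt (by simp))
      (C.smooth.mdifferentiableAt (by simp) : MDifferentiableAt (𝓡 n) _ C.toFun q) (C.frame u q)
  rw [C.tractorConn_sect_fun g hYΦ, coeff_add, h1, h3, h4, h2]

/-- Coordinate fields have constant derivatives on the coordinate functions, so the commutator
annihilates all coordinates and hence is zero. -/
theorem mlieBracket_frame (v w : EuclideanSpace ℝ (Fin n)) :
    ∀ᶠ q in 𝓝 p, VectorField.mlieBracket (𝓡 n) (C.frame v) (C.frame w) q = 0 := by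
  filter_upwards [C.deriv_frame.eventually_nhds, C.frame_deriv] with q h1 h2
  rw [← h2 (VectorField.mlieBracket (𝓡 n) (C.frame v) (C.frame w) q)]
  suffices H : mvfderiv (𝓡 n) C.toFun q (VectorField.mlieBracket (𝓡 n) (C.frame v) (C.frame w) q)
      = 0 by
    rw [H]
    have := C.frame_smul 0 0
    rw [zero_smul, zero_smul] at this
    exact congrFun this q
  ext i
  have hi : ∀ r X, mvfderiv (𝓡 n) (fun r => C.toFun r i) r X = (mvfderiv (𝓡 n) C.toFun r X) i := by
    intro r X
    have := mvfderiv_comp_fderiv (G := EuclideanSpace.proj (𝕜 := ℝ) i)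
        (EuclideanSpace.proj (𝕜 := ℝ) i).differentiableAt
        (C.smooth.mdifferentiableAt (by simp) : MDifferentiableAt (𝓡 n) _ C.toFun r) X
    rw [ContinuousLinearMap.fderiv] at this
    exact this
  have hs : SmoothFn n (fun r => C.toFun r i) := fun r =>
    (EuclideanSpace.proj (𝕜 := ℝ) i).contDiff.contDiffAt.comp_contMDiffAt (C.smooth r)
  have hc : ∀ u : EuclideanSpace ℝ (Fin n), mvfderiv (𝓡 n)
      (fun r => mvfderiv (𝓡 n) (fun r => C.toFun r i) r (C.frame u r)) q = 0 := by
    intro u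
    have : (fun r => mvfderiv (𝓡 n) (fun r => C.toFun r i) r (C.frame u r)) =ᶠ[𝓝 q]
        fun _ => u i := by
      filter_upwards [h1] with r hr
      rw [hi, hr]
    exact (Filter.EventuallyEq.mfderiv_eq (I := 𝓡 n) (I' := 𝓘(ℝ)) this).trans (mvfderiv_const _)
  rw [← hi, mvfderiv_mlieBracket (C.smooth_frame v) (C.smooth_frame w) hs, hc, hc]
  simp

end LocalCoord

/-- A section which is parallel near `p` and vanishes at `p` vanishes near `p`. -/
theorem eventually_eq_zero_of_parallel (hP : SmoothEnd P) {I : ∀ q : M, TractorComp n q}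
    (hI : SmoothComp I) (hpar : ∀ᶠ q in 𝓝 p, ∀ u, tractorConn g P I q u = 0) (h0 : I p = 0) :
    ∀ᶠ q in 𝓝 p, I q = 0 := by
  obtain ⟨C⟩ := exists_localCoord (n := n) p
  obtain ⟨Γ, hΓs, hΓ⟩ := C.exists_connectionForm g hP
  obtain ⟨Y, hY, hYe⟩ := C.exists_lift_coeff hI
  have hIY : ∀ᶠ q in 𝓝 p, I q = C.sect (Y (C.toFun q)) q := by
    filter_upwards [hYe, C.eventually_sect_coeff] with q h1 h2
    rw [h1, h2]
  have hYΦ : ContMDiff (𝓡 n) 𝓘(ℝ, TractorModel n) ∞ fun r => Y (C.toFun r) := fun r =>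
    hY.contDiffAt.comp_contMDiffAt (C.smooth r)
  have hode : ∀ᶠ q in 𝓝 p, HasFDerivAt Y (connForm Γ Y (C.toFun q)) (C.toFun q) := by
    filter_upwards [hpar, hIY.eventually_nhds, LocalCoord.coeff_tractorConn hΓ] with q h1 h2 h3
    have h4 : fderiv ℝ Y (C.toFun q) = connForm Γ Y (C.toFun q) := by
      ext1 u
      have h5 := h3 Y hY u
      rw [← tractorConn_congr g (hI.diffAt q) ((C.smoothComp_sect_fun hYΦ).diffAt q) h2, h1] at h5
      have h6 : C.coeff q (0 : TractorComp n q) = 0 := by simp [LocalCoord.coeff]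
      rw [h6] at h5
      rw [connForm, _root_.neg_apply, ContinuousLinearMap.flip_apply]
      exact (neg_eq_of_add_eq_zero_right h5.symm).symm
    rw [← h4]
    exact (hY.contDiffAt.differentiableAt (by simp)).hasFDerivAt
  -- The equation holds at images of points near `p`; the coordinates map neighbourhoods of `p` onto
  -- neighbourhoods, so it holds on a ball.
  rw [← Filter.eventually_map (P := fun x => HasFDerivAt Y (connForm Γ Y x) x), C.map_nhds] at hode
  obtain ⟨r, hr, hball⟩ := Metric.eventually_nhds_iff_ball.1 hode
  have hYp : Y (C.toFun p) = 0 := by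
    rw [hYe.self_of_nhds, h0]; simp [LocalCoord.coeff]
  filter_upwards [hIY, C.smooth.continuous.continuousAt.eventually (Metric.ball_mem_nhds _ hr)]
    with q h1 h2
  have := C.sect_smul 0 0
  rw [zero_smul, zero_smul] at this
  rw [h1, eq_zero_of_parallel hΓs.continuous hball hYp h2, this]
  rfl

end ParallelSections
end Tractor
end

noncomputable section
namespace Tractor
variable {n : ℕ} {M : Type*} [TopologicalSpace M] [ChartedSpace (EuclideanSpace ℝ (Fin n)) M]
  [IsManifold (𝓡 n) ∞ M]

/-! ### Flat connections: local parallel frames and global parallel sections. -/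

section FlatConnections

open Set Filter Topology

variable [T2Space M] (g : RMetric n M)
  {P : ∀ p : M, TangentSpace (𝓡 n) p → TangentSpace (𝓡 n) p} (hP : SmoothEnd P)

/-- Vanishing of the curvature of `tractorConn`. -/
def FlatConn (g : RMetric n M) (P : ∀ p : M, TangentSpace (𝓡 n) p → TangentSpace (𝓡 n) p) : Prop :=
  ∀ X Z, SmoothVF X → SmoothVF Z → ∀ I : ∀ p : M, TractorComp n p, SmoothComp I →
    ∀ p, tractorCurv g P X Z I p = 0

include hP in
-- The curvature is evaluated on coordinate fields, whose bracket vanishes near `p`, and on a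
-- section with constant coordinates; only `dΓ` and the commutator of `Γ` remain.
theorem LocalCoord.connectionForm_flat (hflat : FlatConn g P) {p : M} (C : LocalCoord (n := n) p)
    {Γ : EuclideanSpace ℝ (Fin n) → EuclideanSpace ℝ (Fin n) →L[ℝ] TractorModel n →L[ℝ]
      TractorModel n} (hΓs : ContDiff ℝ ∞ Γ)
    (hΓ : ∀ᶠ q in 𝓝 p, ∀ u a, Γ (C.toFun q) u a
        = C.coeff q (tractorConn g P (C.sect a) q (C.frame u q))) (a : TractorModel n)
    (v w : EuclideanSpace ℝ (Fin n)) :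
    ∀ᶠ x in 𝓝 (C.toFun p), fderiv ℝ Γ x v w a - fderiv ℝ Γ x w v a
      + (Γ x v (Γ x w a) - Γ x w (Γ x v a)) = 0 := by
  rw [← C.map_nhds, Filter.eventually_map]
  have hYs : ∀ u, ContDiff ℝ ∞ fun x => Γ x u a := fun u =>
    (hΓs.clm_apply contDiff_const).clm_apply contDiff_const
  have hd : ∀ x u u', fderiv ℝ (fun x => Γ x u a) x u' = fderiv ℝ Γ x u' u a := by
    intro x u u'
    have h1 := (hΓs.contDiffAt (x := x)).differentiableAt (by simp)
    have h2 := (h1.hasFDerivAt.clm_apply (hasFDerivAt_const u x)).clm_apply (hasFDerivAt_const a x)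
    rw [h2.fderiv]
    simp
  have hexp : ∀ u, ∀ᶠ q in 𝓝 p, tractorConn g P (C.sect a) q (C.frame u q)
      = C.sect (Γ (C.toFun q) u a) q := by
    intro u
    filter_upwards [hΓ, C.eventually_sect_coeff] with q h1 h2
    rw [h1, h2]
  filter_upwards [(hexp v).eventually_nhds, (hexp w).eventually_nhds,
    LocalCoord.coeff_tractorConn hΓ, C.mlieBracket_frame v w] with q h1 h2 h3 h4
  have hc := hflat _ _ (C.smooth_frame v) (C.smooth_frame w) _ (C.smoothComp_sect a) q
  have hYΦ : ∀ u, ContMDiff (𝓡 n) 𝓘(ℝ, TractorModel n) ∞ fun r => Γ (C.toFun r) u a := fun u r =>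
    (hYs u).contDiffAt.comp_contMDiffAt (C.smooth r)
  have hT := fun u => SmoothComp.tractorConn g hP (C.smoothComp_sect a) (C.smooth_frame u)
  rw [tractorCurv, h4, tractorConn_zero_right g hP,
    tractorConn_congr g ((hT w).diffAt q) ((C.smoothComp_sect_fun (hYΦ w)).diffAt q) h2,
    tractorConn_congr g ((hT v).diffAt q) ((C.smoothComp_sect_fun (hYΦ v)).diffAt q) h1,
    add_zero] at hc
  have hc' := congrArg (C.coeff q) hc
  have hn : ∀ I : TractorComp n q, C.coeff q (-I) = - C.coeff q I := fun I => by
    rw [← neg_one_smul ℝ I, C.coeff_smul, neg_one_smul]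
  rw [C.coeff_add, hn, h3 _ (hYs w), h3 _ (hYs v), hd, hd] at hc'
  have h0 : C.coeff q (0 : TractorComp n q) = 0 := by simp [LocalCoord.coeff]
  rw [h0, neg_add_eq_zero] at hc'
  have h5 := sub_eq_zero.2 hc'
  rw [← h5]
  abel

/-- A flat connection has a parallel frame near every point. -/
theorem exists_parallel_frame (hP : SmoothEnd P) (hflat : FlatConn g P) (p : M) :
    ∃ U : Set M, IsOpen U ∧ p ∈ U ∧ ∃ K : TractorModel n → ∀ q : M, TractorComp n q,
      (∀ f, SmoothComp (K f)) ∧ ∀ q ∈ U, (∀ f u, tractorConn g P (K f) q u = 0) ∧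
        Function.Bijective fun f => K f q := by
  obtain ⟨C⟩ := exists_localCoord (n := n) p
  obtain ⟨Γ, hΓs, hΓ⟩ := C.exists_connectionForm g hP
  obtain ⟨A, hAs, hAu, hAd⟩ := exists_parallel_matrix hΓs (C.toFun p) fun a v w =>
    C.connectionForm_flat g hP hflat hΓs hΓ a v w
  have hc : Tendsto C.toFun (𝓝 p) (𝓝 (C.toFun p)) := C.smooth.continuous.continuousAt
  have hAf : ∀ f, ContDiff ℝ ∞ fun x => A x f := fun f => hAs.clm_apply contDiff_const
  have key : ∀ᶠ q in 𝓝 p, (∀ f u, tractorConn g P (fun r => C.sect (A (C.toFun r) f) r) q u = 0) ∧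
        Function.Bijective fun f => C.sect (A (C.toFun q) f) q := by
    filter_upwards [hc.eventually hAu, hc.eventually hAd, C.frame_deriv, C.eventually_sect_coeff,
      C.eventually_coeff_sect, LocalCoord.coeff_tractorConn hΓ] with q h1 h2 h3 h4 h5 h6
    refine ⟨fun f u => ?_, ?_⟩
    · rw [← h3 u, ← h4 (tractorConn g P _ q _), h6 _ (hAf f), h2]
      have := C.sect_smul 0 0
      rw [zero_smul, zero_smul] at this
      exact congrFun this q
    · have hb1 : Function.Bijective (A (C.toFun q)) := by
        obtain ⟨B, hB⟩ := h1
        rw [← hB]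
        refine Function.bijective_iff_has_inverse.2 ⟨(B⁻¹ : (TractorModel n →L[ℝ] TractorModel n)ˣ).1, fun x => ?_, fun x => ?_⟩
        · exact congrArg (fun T : TractorModel n →L[ℝ] TractorModel n => T x) B.inv_mul
        · exact congrArg (fun T : TractorModel n →L[ℝ] TractorModel n => T x) B.mul_inv
      have hb2 : Function.Bijective fun a => C.sect a q :=
        Function.bijective_iff_has_inverse.2 ⟨C.coeff q, h5, h4⟩
      exact hb2.comp hb1
  obtain ⟨U, hU, hUo, hpU⟩ := eventually_nhds_iff.1 key
  exact ⟨U, hUo, hpU, fun f q => C.sect (A (C.toFun q) f) q, fun f =>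
    C.smoothComp_sect_fun fun r => (hAf f).contDiffAt.comp_contMDiffAt (C.smooth r), hU⟩

omit [T2Space M] in
theorem smoothComp_of_eventuallyEq {I : ∀ p : M, TractorComp n p}
    (h : ∀ p, ∃ K : ∀ p : M, TractorComp n p, SmoothComp K ∧ ∀ᶠ q in 𝓝 p, I q = K q) :
    SmoothComp I := by
  refine ⟨fun p => ?_, fun p => ?_, fun p => ?_⟩ <;> obtain ⟨K, hK, he⟩ := h p
  · exact (hK.top p).congr_of_eventuallyEq (he.mono fun q hq => by simp only [hq])
  · exact (hK.mid p).congr_of_eventuallyEq (he.mono fun q hq => by simp only [hq])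
  · exact (hK.bot p).congr_of_eventuallyEq (he.mono fun q hq => by simp only [hq])

omit [T2Space M] in
theorem SmoothComp.sub {I K : ∀ p : M, TractorComp n p}
    (hI : SmoothComp I) (hK : SmoothComp K) : SmoothComp (I - K) :=
  ⟨hI.top.sub hK.top, hI.mid.sub_section hK.mid, hI.bot.sub hK.bot⟩

/-- A parallel section of a connected manifold which vanishes at a point vanishes. -/
theorem eq_zero_of_parallel_of_connected [ConnectedSpace M] (hP : SmoothEnd P)
    {I : ∀ q : M, TractorComp n q} (hI : SmoothComp I)
    (hpar : ∀ q u, tractorConn g P I q u = 0) {p : M} (h0 : I p = 0) : I = 0 := by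
  have hopen : IsOpen {q | I q = 0} := isOpen_iff_mem_nhds.2 fun q hq =>
    eventually_eq_zero_of_parallel g hP hI (Eventually.of_forall hpar) hq
  -- Sections take values in varying fibres, so the zero set is rewritten by scalar equations;
  -- positivity of `g` detects vanishing of the vector component.
  have hclosed : IsClosed {q | I q = 0} := by
    have hz : {q | I q = 0} = {q | (I q).1 = 0} ∩ {q | g.inner q (I q).2.1 (I q).2.1 = 0}
        ∩ {q | (I q).2.2 = 0} := by
      ext q
      constructor
      · intro h
        have h : I q = 0 := h
        simp [h]
      · rintro ⟨⟨h1, h2⟩, h3⟩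
        refine Prod.ext h1 (Prod.ext ?_ h3)
        by_contra hne
        exact (g.pos q _ hne).ne' h2
    rw [hz]
    exact ((isClosed_eq hI.top.continuous continuous_const).inter
      (isClosed_eq (SmoothVF.inner g hI.mid hI.mid).continuous continuous_const)).inter
      (isClosed_eq hI.bot.continuous continuous_const)
  have := IsClopen.eq_univ ⟨hclosed, hopen⟩ ⟨p, h0⟩
  funext q
  exact (this ▸ mem_univ q : q ∈ {q | I q = 0})

/-- A flat connection on a simply connected manifold has global parallel sections. -/
theorem exists_parallel_of_simplyConnected [SimplyConnectedSpace M] (hP : SmoothEnd P)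
    (hflat : FlatConn g P) (p : M) (a : TractorComp n p) :
    ∃ I : ∀ q : M, TractorComp n q, SmoothComp I ∧ I p = a ∧ ∀ q u, tractorConn g P I q u = 0 := by
  have : LocallyPathConnectedSpace M :=
    ChartedSpace.locallyPathConnectedSpace (EuclideanSpace ℝ (Fin n)) M
  choose U hU hmem K hKs hK using exists_parallel_frame g hP hflat
  -- Transition functions between parallel frames are locally constant: the difference of two
  -- parallel sections that agree at a point is zero near it.
  obtain ⟨I, hIp, hI⟩ := exists_global_section U hU hmem (fun p q f => K p f q)
    (fun p q hq => (hK p q hq).2) (fun p q x hx f f' h => by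
      have h1 : ∀ᶠ y in 𝓝 x, ∀ u, tractorConn g P (K p f - K q f') y u = 0 := by
        filter_upwards [(hU p).mem_nhds hx.1, (hU q).mem_nhds hx.2] with y h1 h2 u
        rw [tractorConn_sub g ((hKs p f).diffAt y) ((hKs q f').diffAt y), (hK p y h1).1,
          (hK q y h2).1, sub_zero]
      filter_upwards [eventually_eq_zero_of_parallel g hP ((hKs p f).sub (hKs q f')) h1
        (sub_eq_zero.2 h)] with y hy
      exact sub_eq_zero.1 hy) p a
  have hIs : SmoothComp I := smoothComp_of_eventuallyEq fun q => by
    obtain ⟨f, hf⟩ := hI q q (hmem q)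
    exact ⟨K q f, hKs q f, hf⟩
  refine ⟨I, hIs, hIp, fun q u => ?_⟩
  obtain ⟨f, hf⟩ := hI q q (hmem q)
  rw [tractorConn_congr g (hIs.diffAt q) ((hKs q f).diffAt q) hf, (hK q q (hmem q)).1]

end FlatConnections
end Tractor
end

noncomputable section
namespace Tractor
variable {n : ℕ} {M : Type*} [TopologicalSpace M] [ChartedSpace (EuclideanSpace ℝ (Fin n)) M]
  [IsManifold (𝓡 n) ∞ M]

/-! ### Components of the tractor curvature. -/

section CurvatureAlgebra

variable (g : RMetric n M) {P : ∀ p : M, TangentSpace (𝓡 n) p → TangentSpace (𝓡 n) p}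
  {I K : ∀ p : M, TractorComp n p} {X Z W : ∀ p : M, TangentSpace (𝓡 n) p}

theorem smoothComp_zero : SmoothComp (0 : ∀ p : M, TractorComp n p) :=
  ⟨contMDiff_const, SmoothVF.zero, contMDiff_const⟩

theorem tractorConn_zero (p : M) (u : TangentSpace (𝓡 n) p) :
    tractorConn g P (0 : ∀ p : M, TractorComp n p) p u = 0 := by
  have := tractorConn_const_smul g (P := P) 0 (smoothComp_zero.diffAt p) u
  rwa [zero_smul, zero_smul] at this

theorem tractorCurv_eq_zero_of_parallel (hK : ∀ p u, tractorConn g P K p u = 0) (p : M) :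
    tractorCurv g P X Z K p = 0 := by
  have h : ∀ Y : ∀ p : M, TangentSpace (𝓡 n) p,
      (fun q => tractorConn g P K q (Y q)) = 0 := fun Y => funext fun q => hK q _
  rw [tractorCurv, h, h, hK, tractorConn_zero, tractorConn_zero]
  simp

theorem tractorMetric_add_left (p : M) (I I' K : TractorComp n p) :
    tractorMetric g p (I + I') K = tractorMetric g p I K + tractorMetric g p I' K := by
  simp [tractorMetric]
  ring

theorem tractorMetric_smul_left (p : M) (c : ℝ) (I K : TractorComp n p) :
    tractorMetric g p (c • I) K = c * tractorMetric g p I K := by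
  simp [tractorMetric]
  ring

/-- The pairing with a tractor, as a linear form. -/
def tractorPairing (p : M) (K : TractorComp n p) : TractorComp n p →ₗ[ℝ] ℝ where
  toFun I := tractorMetric g p I K
  map_add' I I' := tractorMetric_add_left g p I I' K
  map_smul' c I := tractorMetric_smul_left g p c I K

theorem leviCivita_zero (p : M) (u : TangentSpace (𝓡 n) p) :
    leviCivita g (0 : ∀ p : M, TangentSpace (𝓡 n) p) p u = 0 := by
  simp

variable [T2Space M]

/-- The second derivatives of `σ` cancel against the bracket and the derivatives of the fields
cancel by vanishing torsion. No symmetry of `P` is assumed, so its skew part is what survives. -/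
theorem tractorCurv_top (hI : SmoothComp I) (hX : SmoothVF X) (hZ : SmoothVF Z)
    (p : M) : (tractorCurv g P X Z I p).1
      = (I p).1 * (g.inner p (P p (Z p)) (X p) - g.inner p (P p (X p)) (Z p)) := by
  have key : ∀ {X Z : ∀ p : M, TangentSpace (𝓡 n) p}, SmoothVF X → SmoothVF Z →
      (tractorConn g P (fun q => tractorConn g P I q (Z q)) p (X p)).1
      = mvfderiv (𝓡 n) (fun q => mvfderiv (𝓡 n) (fun r => (I r).1) q (Z q)) p (X p)
        - (g.inner p (leviCivita g (fun q => (I q).2.1) p (X p)) (Z p)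
          + g.inner p (I p).2.1 (leviCivita g Z p (X p)))
        - (g.inner p (leviCivita g (fun q => (I q).2.1) p (Z p)) (X p)
          + (I p).1 * g.inner p (P p (Z p)) (X p) + (I p).2.2 * g.inner p (Z p) (X p)) := by
    intro X Z hX hZ
    have h1 := mvfderiv_fun_sub (SmoothFn.diffAt (SmoothVF.deriv hI.top hZ) p)
      (SmoothFn.diffAt (SmoothVF.inner g hI.mid hZ) p)
    have h2 := mvfderiv_inner g (SmoothVF.diffAt hI.mid p) (hZ.diffAt p) (X p)
    have h3 := congrArg (fun A => A (X p)) h1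
    have h4 := h3.trans (congrArg (fun a => mvfderiv (𝓡 n) (fun q => mvfderiv (𝓡 n)
      (fun r => (I r).1) q (Z q)) p (X p) - a) h2)
    simp only [tractorConn] at *
    rw [h4]
    simp only [map_add, map_smul, _root_.add_apply, _root_.smul_apply, smul_eq_mul]
  have hb := mvfderiv_mlieBracket hX hZ hI.top p
  have ht := leviCivita_torsion g (hX.diffAt p) (hZ.diffAt p)
  have ht' := congrArg (g.inner p (I p).2.1) ht
  simp only [map_sub] at ht'
  rw [tractorCurv, Prod.fst_add, Prod.fst_add, Prod.fst_neg, key hX hZ, key hZ hX]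
  simp only [tractorConn]
  rw [hb, g.symm p (X p) (Z p)]
  linarith

/-- The curvature is orthogonal to parallel sections. -/
theorem tractorMetric_tractorCurv (hP : SmoothEnd P) (hI : SmoothComp I) (hK : SmoothComp K)
    (hpar : ∀ p u, tractorConn g P K p u = 0) (hX : SmoothVF X) (hZ : SmoothVF Z) (p : M) :
    tractorMetric g p (tractorCurv g P X Z I p) (K p) = 0 := by
  have hm0 : ∀ q (a : TractorComp n q), tractorMetric g q a 0 = 0 := fun q a => by
    simp [tractorMetric]
  have key : ∀ {I : ∀ p : M, TractorComp n p}, SmoothComp I → ∀ q u,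
      mvfderiv (𝓡 n) (fun q => tractorMetric g q (I q) (K q)) q u
      = tractorMetric g q (tractorConn g P I q u) (K q) := by
    intro I hI q u
    rw [mvfderiv_tractorMetric g (P := P) (hI.diffAt q) (hK.diffAt q) u, hpar, hm0, add_zero]
  have hb := mvfderiv_mlieBracket hX hZ (SmoothComp.tractorMetric g hI hK) p
  simp only [key hI] at hb
  rw [key (SmoothComp.tractorConn g hP hI hZ), key (SmoothComp.tractorConn g hP hI hX)] at hb
  rw [tractorCurv, tractorMetric_add_left, tractorMetric_add_left, hb,
    ← neg_one_smul ℝ (tractorConn g P _ p (X p)), tractorMetric_smul_left]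
  ring

omit [T2Space M] in
theorem smoothComp_mid (hW : SmoothVF W) :
    SmoothComp (fun p => ((0, W p, 0) : TractorComp n p)) :=
  ⟨contMDiff_const, hW, contMDiff_const⟩

omit [T2Space M] in
theorem tractorCurv_mid (p : M) :
    (tractorCurv g P X Z (fun p => ((0, W p, 0) : TractorComp n p)) p).2.1
      = - curvField g X Z W p + g.inner p (W p) (Z p) • P p (X p) - g.inner p (W p) (X p) • P p (Z p)
        + g.inner p (P p (Z p)) (W p) • X p - g.inner p (P p (X p)) (W p) • Z p := by
  have hc : curvField g X Z W p = leviCivita g (fun q => leviCivita g W q (Z q)) p (X p)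
      - leviCivita g (fun q => leviCivita g W q (X q)) p (Z p)
      - leviCivita g W p (VectorField.mlieBracket (𝓡 n) X Z p) := rfl
  simp only [hc, tractorCurv, tractorConn, Prod.snd_add, Prod.fst_add, Prod.snd_neg,
    Prod.fst_neg, mvfderiv_const, zero_smul, add_zero, _root_.zero_apply]
  module

variable (P) in
/-- The form of the curvature tensor of `g` when `tractorConn g P` is flat. -/
theorem riemann_of_flat (hflat : FlatConn g P) (p : M) (u z w : TangentSpace (𝓡 n) p) :
    riemann g p u z w = g.inner p w z • P p u - g.inner p w u • P p z
      + g.inner p (P p z) w • u - g.inner p (P p u) w • z := by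
  obtain ⟨X, hX, rfl⟩ := exists_smoothVF p u
  obtain ⟨Z, hZ, rfl⟩ := exists_smoothVF p z
  obtain ⟨W, hW, rfl⟩ := exists_smoothVF p w
  have h := congrArg (fun I : TractorComp n p => I.2.1)
    (hflat X Z hX hZ _ (smoothComp_mid hW) p)
  simp only [tractorCurv_mid g] at h
  rw [riemann_eq g hX hZ hW]
  have h' : - curvField g X Z W p + (g.inner p (W p) (Z p) • P p (X p)
      - g.inner p (W p) (X p) • P p (Z p)
        + g.inner p (P p (Z p)) (W p) • X p - g.inner p (P p (X p)) (W p) • Z p) = 0 := by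
    refine Eq.trans ?_ h
    abel
  exact (neg_add_eq_zero.1 h')

/-- A section whose derivative has only a bottom component is parallel if the connection is
flat. -/
theorem parallel_of_flat (hn : 2 ≤ n) (hP : SmoothEnd P) (hflat : FlatConn g P) (hI : SmoothComp I)
    (h1 : ∀ p u, (tractorConn g P I p u).1 = 0) (h2 : ∀ p u, (tractorConn g P I p u).2.1 = 0)
    (p : M) (u : TangentSpace (𝓡 n) p) : tractorConn g P I p u = 0 := by
  refine Prod.ext (h1 p u) (Prod.ext (h2 p u) ?_)
  rcases eq_or_ne u 0 with rfl | hu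
  · rw [tractorConn_zero_right g hP]
  have hrank : 1 < Module.finrank ℝ (TangentSpace (𝓡 n) p) := by
    have : Module.finrank ℝ (TangentSpace (𝓡 n) p) = n := finrank_euclideanSpace_fin
    omega
  obtain ⟨w, hw⟩ := exists_linearIndependent_pair_of_one_lt_finrank hrank hu
  obtain ⟨X, hX, rfl⟩ := exists_smoothVF p u
  obtain ⟨Z, hZ, rfl⟩ := exists_smoothVF p w
  -- Let `τ` be the one-form of bottom components of the derivative. The middle component of the
  -- curvature is then `τ(X) Z - τ(Z) X`, and linear independence of `X` and `Z` at `p` gives `τ(X)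
  -- = 0`.
  have key : ∀ Z Y : ∀ p : M, TangentSpace (𝓡 n) p,
      (tractorConn g P (fun q => tractorConn g P I q (Z q)) p (Y p)).2.1
        = (tractorConn g P I p (Z p)).2.2 • Y p := by
    intro Z Y
    have e : (fun q => (tractorConn g P I q (Z q)).2.1) = 0 := funext fun q => h2 q _
    have h3 : (tractorConn g P (fun q => tractorConn g P I q (Z q)) p (Y p)).2.1
      = leviCivita g (fun q => (tractorConn g P I q (Z q)).2.1) p (Y p)
        + (tractorConn g P I p (Z p)).1 • P p (Y p) + (tractorConn g P I p (Z p)).2.2 • Y p := rfl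
    rw [h3, e, leviCivita_zero, h1, zero_smul, zero_add, zero_add]
  have hc := congrArg (fun I : TractorComp n p => I.2.1) (hflat X Z hX hZ I hI p)
  simp only [tractorCurv, Prod.snd_add, Prod.fst_add, Prod.snd_neg, Prod.fst_neg, h2, key] at hc
  have h5 := (LinearIndependent.pair_iff.1 hw (-(tractorConn g P I p (Z p)).2.2)
    ((tractorConn g P I p (X p)).2.2) (by
      rw [neg_smul]
      refine Eq.trans ?_ hc
      abel)).2
  exact h5

end CurvatureAlgebra
end Tractor
end

noncomputable section
namespace Tractor
variable {n : ℕ} {M : Type*} [TopologicalSpace M] [ChartedSpace (EuclideanSpace ℝ (Fin n)) M]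
  [IsManifold (𝓡 n) ∞ M]

/-! ### Ricci and scalar curvature of a flat tractor connection. -/

section Traces

variable (g : RMetric n M) (p : M)

theorem metricTrace_inner : metricTrace g p (fun a b => g.inner p a b) = n := by
  have h : ∀ i, ∑ j, (gram g p)⁻¹ i j * g.inner p (tangentBasis p i) (tangentBasis p j) = 1 := by
    intro i
    have h1 := congrFun (congrFun (Matrix.nonsing_inv_mul _ (isUnit_gram g p)) i) i
    rw [Matrix.mul_apply, Matrix.one_apply_eq] at h1
    rw [← h1]
    refine Finset.sum_congr rfl fun j _ => ?_
    rw [gram, Matrix.of_apply, g.symm p (tangentBasis p i)]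
  simp only [metricTrace, h]
  simp

theorem metricTrace_mul_inner (ℓ : TangentSpace (𝓡 n) p →ₗ[ℝ] ℝ) (z : TangentSpace (𝓡 n) p) :
    metricTrace g p (fun a b => ℓ a * g.inner p z b) = ℓ z := by
  rw [← inner_sharp g ℓ z, sharp, metricTrace]
  simp only [map_sum, map_smul, FunLike.coe_sum, Finset.sum_apply, FunLike.coe_smul,
    Pi.smul_apply, smul_eq_mul]
  refine Finset.sum_congr rfl fun i _ => Finset.sum_congr rfl fun j _ => ?_
  rw [g.symm p z]
  ring

variable [T2Space M] {P : ∀ p : M, TangentSpace (𝓡 n) p → TangentSpace (𝓡 n) p}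

/-- The trace of `riemann_of_flat`: its four terms contribute `(tr P) g(u, w)`, `n` times `g(P u,
w)`, and `g(P u, w)` twice with a minus sign. -/
theorem ricci_of_flat (hP : SmoothEnd P) (hflat : FlatConn g P) (u w : TangentSpace (𝓡 n) p) :
    ricci g p u w = (n - 2) * g.inner p (P p u) w
      + metricTrace g p (fun a b => g.inner p (P p a) b) * g.inner p u w := by
  let ℓ₁ : TangentSpace (𝓡 n) p →ₗ[ℝ] ℝ := (g.inner p w).toLinearMap
  let ℓ₂ : TangentSpace (𝓡 n) p →ₗ[ℝ] ℝ :=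
    { toFun := fun a => g.inner p (P p a) w
      map_add' := fun a b => by rw [hP.add]; simp
      map_smul' := fun c a => by rw [hP.smul]; simp }
  have h : (fun a b => g.inner p (riemann g p a u w) b)
      = fun a b => ((g.inner p w u * g.inner p (P p a) b + g.inner p (P p u) w * g.inner p a b)
        + (-1) * (ℓ₁ a * g.inner p (P p u) b)) + (-1) * (ℓ₂ a * g.inner p u b) := by
    funext a b
    rw [riemann_of_flat g P hflat]
    simp only [map_add, map_sub, map_smul, _root_.add_apply, _root_.sub_apply, _root_.smul_apply,
      smul_eq_mul]
    change _ = ((g.inner p w u * g.inner p (P p a) b + g.inner p (P p u) w * g.inner p a b)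
        + (-1) * (g.inner p w a * g.inner p (P p u) b)) + (-1) * (g.inner p (P p a) w * g.inner p u b)
    ring
  rw [ricci, h, metricTrace_add, metricTrace_add, metricTrace_add, metricTrace_const_mul,
    metricTrace_const_mul, metricTrace_const_mul, metricTrace_const_mul, metricTrace_mul_inner,
    metricTrace_mul_inner, metricTrace_inner]
  change _ + (-1) * g.inner p w (P p u) + (-1) * g.inner p (P p u) w = _
  rw [g.symm p w u, g.symm p w (P p u)]
  ring

theorem scal_of_flat (hP : SmoothEnd P) (hflat : FlatConn g P) :
    scal g p = (2 * n - 2) * metricTrace g p (fun a b => g.inner p (P p a) b) := by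
  have h : (fun a b => ricci g p a b) = fun a b => (n - 2) * g.inner p (P p a) b
      + metricTrace g p (fun a b => g.inner p (P p a) b) * g.inner p a b :=
    funext fun a => funext fun b => ricci_of_flat g p hP hflat a b
  rw [scal, h, metricTrace_add, metricTrace_const_mul, metricTrace_const_mul, metricTrace_inner]
  ring

end Traces

/-! ### What flatness says about the density `v`. -/

section FlatWeighted

variable [T2Space M] (g : RMetric n M) {v : M → ℝ} (hv : SmoothFn n v) (hpos : ∀ p, 0 < v p)
  {m μ : ℝ} (hflat : FlatConn g (weightedSchoutenSharp g v m μ))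

include hv hpos hflat

/-- The definition of `P^W` expresses `Ric` as `(m + n - 2) P` plus Hessian and scalar terms, and
flatness as `(n - 2) P + (tr P) g`. Equating the two and dividing by `m` isolates the Hessian. -/
theorem hess_of_flat (hm : m ≠ 0) (hmn : m + n - 2 ≠ 0) (p : M) (u w : TangentSpace (𝓡 n) p) :
    hess g v p u w + v p * g.inner p (weightedSchoutenSharp g v m μ p u) w
      = v p * (metricTrace g p (fun a b => g.inner p (weightedSchoutenSharp g v m μ p a) b)
          - weightedSchoutenScalar g v m μ p) / m * g.inner p u w := by
  have h1 := ricci_of_flat g p (smoothEnd_weightedSchoutenSharp g hv hpos m μ) hflat u w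
  have h2 := inner_weightedSchoutenSharp g hv hpos m μ p u w
  have h3 := (hpos p).ne'
  generalize metricTrace g p (fun a b => g.inner p (weightedSchoutenSharp g v m μ p a) b) = T at *
  rw [weightedSchouten, bakryEmery, h1, eq_div_iff hmn] at h2
  generalize g.inner p (weightedSchoutenSharp g v m μ p u) w = a at *
  field_simp at h2 ⊢
  linear_combination h2

theorem laplacian_of_flat (hm : m ≠ 0) (hmn : m + n - 2 ≠ 0) (p : M) :
    laplacian g v p + v p * metricTrace g p
        (fun a b => g.inner p (weightedSchoutenSharp g v m μ p a) b)
      = n * (v p * (metricTrace g p (fun a b => g.inner p (weightedSchoutenSharp g v m μ p a) b)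
          - weightedSchoutenScalar g v m μ p) / m) := by
  have h : (fun a b => hess g v p a b + v p * g.inner p (weightedSchoutenSharp g v m μ p a) b)
      = fun a b => v p * (metricTrace g p
          (fun a b => g.inner p (weightedSchoutenSharp g v m μ p a) b)
          - weightedSchoutenScalar g v m μ p) / m * g.inner p a b :=
    funext fun a => funext fun b => hess_of_flat g hv hpos hflat hm hmn p a b
  have h1 := congrArg (metricTrace g p) h
  rw [metricTrace_add, metricTrace_const_mul, metricTrace_const_mul, metricTrace_inner] at h1
  rw [laplacian, h1]
  ring

theorem schoutenTrace_of_flat (hn : n ≠ 1) (p : M) :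
    schoutenTrace g p
      = metricTrace g p (fun a b => g.inner p (weightedSchoutenSharp g v m μ p a) b) := by
  have hn' : (n : ℝ) - 1 ≠ 0 := sub_ne_zero.2 (by exact_mod_cast hn)
  rw [schoutenTrace, scal_of_flat g p (smoothEnd_weightedSchoutenSharp g hv hpos m μ) hflat]
  field_simp

/-- The definition of `J^W` has not been used up to here. Substituting the scalar curvature and the
Laplacian of the flat case into it leaves this relation, which is `μ = (m - 1) |J|²` in disguise. -/
theorem normSq_grad_of_flat (hm : m ≠ 0) (hmn : m + n - 2 ≠ 0) (hmn' : m + n - 1 ≠ 0) (p : M) :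
    -2 * (m - 1) * v p * (v p * (metricTrace g p
        (fun a b => g.inner p (weightedSchoutenSharp g v m μ p a) b)
          - weightedSchoutenScalar g v m μ p) / m)
      = μ - (m - 1) * g.inner p (grad g v p) (grad g v p) := by
  have h1 := laplacian_of_flat g hv hpos hflat hm hmn p
  have h2 := scal_of_flat g p (smoothEnd_weightedSchoutenSharp g hv hpos m μ) hflat
  have h4 := (hpos p).ne'
  have h5 : weightedSchoutenScalar g v m μ p
    = (weightedScal g v m p + m * μ * (v p)⁻¹ ^ 2) / (2 * (m + n - 1)) := rfl
  generalize metricTrace g p (fun a b => g.inner p (weightedSchoutenSharp g v m μ p a) b) = T at *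
  rw [weightedScal, h2] at h5
  generalize weightedSchoutenScalar g v m μ p = Jw at *
  generalize g.inner p (grad g v p) (grad g v p) = d at *
  rw [eq_div_iff (mul_ne_zero two_ne_zero hmn')] at h5
  generalize laplacian g v p = Δ at *
  have h6 : Δ = n * (v p * (T - Jw) / m) - v p * T := by linarith
  rw [h6] at h5
  field_simp at h5 ⊢
  linear_combination h5

end FlatWeighted

/-! ### For flat `∇^W` the scale tractor is parallel and equals its modification. -/

section ScaleTractorParallel

variable [T2Space M] (S : SCMS n M) (μ : ℝ) (g : S.conf.scales)
  (hflat : FlatConn g.1 (weightedSchoutenSharp g.1 (S.v.inScale g) S.m μ))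

include hflat

theorem SCMS.scaleTractor_eq_of_flat (hn : 2 ≤ n) (hm : S.m ≠ 0) (hmn : S.m + n - 2 ≠ 0) (p : M) :
    S.scaleTractor g p = (S.v.inScale g p, grad g.1 (S.v.inScale g) p,
      -(S.v.inScale g p * (metricTrace g.1 p (fun a b => g.1.inner p
          (weightedSchoutenSharp g.1 (S.v.inScale g) S.m μ p a) b)
          - weightedSchoutenScalar g.1 (S.v.inScale g) S.m μ p) / S.m)) := by
  have h1 := laplacian_of_flat g.1 (S.v.smooth g) (S.v_pos g) hflat hm hmn p
  have h0 : (n : ℝ) ≠ 0 := by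
    have : n ≠ 0 := by omega
    exact_mod_cast this
  rw [S.scaleTractor_eq g (by omega), schoutenTrace_of_flat g.1 (S.v.smooth g) (S.v_pos g) hflat
    (by omega)]
  refine Prod.ext rfl (Prod.ext rfl ?_)
  simp only
  rw [div_eq_iff h0, mul_comm (metricTrace _ _ _), h1]
  ring

/-- The top component vanishes because the middle of `J` is the gradient of `v`, the middle
component is the Hessian equation `hess_of_flat`, and `parallel_of_flat` takes care of the bottom.
-/
theorem SCMS.scaleTractor_parallel (hn : 2 ≤ n) (hm : S.m ≠ 0) (hmn : S.m + n - 2 ≠ 0) (p : M)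
    (u : TangentSpace (𝓡 n) p) :
    tractorConn g.1 (weightedSchoutenSharp g.1 (S.v.inScale g) S.m μ) (S.scaleTractor g) p u = 0 := by
  have hJ := S.smoothComp_scaleTractor g (by omega)
  have e := S.scaleTractor_eq_of_flat μ g hflat hn hm hmn
  refine parallel_of_flat g.1 hn
    (smoothEnd_weightedSchoutenSharp g.1 (S.v.smooth g) (S.v_pos g) S.m μ) hflat hJ
    (fun p u => ?_) (fun p u => ?_) p u
  · have h1 : (fun q => (S.scaleTractor g q).1) = S.v.inScale g := funext fun q => by rw [e]
    simp only [tractorConn, h1]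
    rw [e, inner_grad, sub_self]
  · have h1 : (fun q => (S.scaleTractor g q).2.1) = grad g.1 (S.v.inScale g) :=
      funext fun q => by rw [e]
    simp only [tractorConn, h1]
    rw [e]
    refine inner_ext g.1 fun w => ?_
    have h2 := hess_of_flat g.1 (S.v.smooth g) (S.v_pos g) hflat hm hmn p u w
    rw [hess] at h2
    simp only [map_add, map_smul, _root_.add_apply, _root_.smul_apply, smul_eq_mul]
    rw [h2]
    simp

theorem SCMS.scaleTractorTilde_eq_of_flat (hn : 2 ≤ n) (hm : S.m ≠ 0) (hmn : S.m + n - 2 ≠ 0)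
    (hmn' : S.m + n - 1 ≠ 0) : S.scaleTractorTilde μ g = S.scaleTractor g := by
  have h : S.tildeCoeff μ g = 0 := by
    funext p
    have h1 := normSq_grad_of_flat g.1 (S.v.smooth g) (S.v_pos g) hflat hm hmn hmn' p
    rw [SCMS.tildeCoeff, S.scaleTractor_eq_of_flat μ g hflat hn hm hmn]
    simp only [tractorMetric]
    have h2 : ∀ l d : ℝ, -2 * (S.m - 1) * S.v.inScale g p * l = μ - (S.m - 1) * d →
      μ - (S.m - 1) * (S.v.inScale g p * -l + -l * S.v.inScale g p + d) = 0 := by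
      intro l d h
      linear_combination -h
    rw [h2 _ _ h1]
    simp
  rw [S.scaleTractorTilde_eq μ g (by omega), h, zero_smul, add_zero]

end ScaleTractorParallel
end Tractor
end

noncomputable section
namespace Tractor
variable {n : ℕ} {M : Type*} [TopologicalSpace M] [ChartedSpace (EuclideanSpace ℝ (Fin n)) M]
  [IsManifold (𝓡 n) ∞ M]

/-! ### Evaluation of parallel sections at a point. -/

section Evaluation

variable [T2Space M] (S : SCMS n M) (μ : ℝ) (g : S.conf.scales)

/-- `nablaW` unfolds to `tractorConn`, and every smooth section is the component of a tractor in the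
scale `g`, so the two quantifiers have the same range. -/
theorem SCMS.flatConn_iff (hn : n ≠ 0) : S.IsFlatW μ g ↔
    FlatConn g.1 (weightedSchoutenSharp g.1 (S.v.inScale g) S.m μ) := by
  constructor
  · intro h X Z hX hZ K hK p
    obtain ⟨I, rfl⟩ := exists_tractor hn g hK
    exact h X Z hX hZ I.1 I.2 p
  · intro h X Z hX hZ I hI p
    exact h X Z hX hZ (I g) (hI.1 g) p

omit [T2Space M] in
theorem SCMS.tractorMetric_projector_tilde (hn : n ≠ 0) (p : M) :
    tractorMetric g.1 p (projector p) (S.scaleTractorTilde μ g p) = S.v.inScale g p := by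
  rw [S.scaleTractorTilde_eq μ g hn, Pi.add_apply, S.scaleTractor_eq g hn]
  simp [tractorMetric, projector]

/-- The fibre of `T^W` at `p`. -/
def SCMS.fibre (p : M) : Submodule ℝ (TractorComp n p) :=
  LinearMap.ker (tractorPairing g.1 p (S.scaleTractorTilde μ g p))

omit [T2Space M] in
theorem SCMS.finrank_fibre (hn : n ≠ 0) (p : M) : Module.finrank ℝ (S.fibre μ g p) = n + 1 := by
  have h0 : tractorPairing g.1 p (S.scaleTractorTilde μ g p) ≠ 0 := by
    intro h
    have h1 := S.tractorMetric_projector_tilde μ g hn p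
    have h2 := congrArg (fun L => L (projector p)) h
    exact (S.v_pos g p).ne' (h1.symm.trans h2)
  have h1 := Module.Dual.finrank_ker_add_one_of_ne_zero h0
  have h2 : Module.finrank ℝ (TractorComp n p) = n + 2 := by
    have : Module.finrank ℝ (TangentSpace (𝓡 n) p) = n := finrank_euclideanSpace_fin
    rw [Module.finrank_prod, Module.finrank_prod, this, Module.finrank_self]
    ring
  rw [h2] at h1
  exact Nat.succ_injective h1

/-- Evaluation of parallel sections of `T^W` at a point. -/
def SCMS.evalAt (p : M) : S.parallelSections μ g →ₗ[ℝ] S.fibre μ g p where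
  toFun I := ⟨I.1.1 g p, I.2.1 p⟩
  map_add' _ _ := rfl
  map_smul' _ _ := rfl

variable [ConnectedSpace M]

theorem SCMS.evalAt_injective (p : M) : Function.Injective (S.evalAt μ g p) := by
  rw [injective_iff_map_eq_zero]
  intro I hI
  have h0 : I.1.1 g p = 0 := congrArg Subtype.val hI
  have h1 := eq_zero_of_parallel_of_connected g.1
    (smoothEnd_weightedSchoutenSharp g.1 (S.v.smooth g) (S.v_pos g) S.m μ) (I.1.2.1 g) I.2.2 h0
  exact Subtype.ext (tractors_ext (K := 0) h1)

theorem SCMS.finite_parallelSections : Module.Finite ℝ (S.parallelSections μ g) :=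
  Module.Finite.of_injective (S.evalAt μ g (Classical.arbitrary M)) (S.evalAt_injective μ g _)

theorem SCMS.evalAt_surjective (hn : n ≠ 0)
    (h : Module.finrank ℝ (S.parallelSections μ g) = n + 1) (p : M) :
    Function.Surjective (S.evalAt μ g p) := by
  have := S.finite_parallelSections μ g
  refine LinearMap.range_eq_top.1 (Submodule.eq_top_of_finrank_eq ?_)
  rw [LinearMap.finrank_range_of_inj (S.evalAt_injective μ g p), h, S.finrank_fibre μ g hn]

omit [ConnectedSpace M] in
/-- If `T^W` has parallel sections through all of its points, `∇^W` is flat. -/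
theorem SCMS.flat_of_evalAt_surjective (hn : n ≠ 0)
    (h : ∀ p, Function.Surjective (S.evalAt μ g p)) :
    FlatConn g.1 (weightedSchoutenSharp g.1 (S.v.inScale g) S.m μ) := by
  intro X Z hX hZ I hI p
  have hP := smoothEnd_weightedSchoutenSharp g.1 (S.v.smooth g) (S.v_pos g) S.m μ
  set P := weightedSchoutenSharp g.1 (S.v.inScale g) S.m μ
  obtain ⟨j, hj⟩ : ∃ j, j = S.scaleTractorTilde μ g p := ⟨_, rfl⟩
  have hj1 : j.1 ≠ 0 := by
    have h1 := S.tractorMetric_projector_tilde μ g hn p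
    rw [← hj] at h1
    simp only [tractorMetric, projector, zero_mul, one_mul, map_zero, _root_.zero_apply, add_zero,
      zero_add] at h1
    rw [h1]
    exact (S.v_pos g p).ne'
  have hpar : ∀ a : TractorComp n p, tractorMetric g.1 p a j = 0 →
      ∃ K : ∀ p : M, TractorComp n p, SmoothComp K ∧ K p = a ∧
        ∀ p u, tractorConn g.1 P K p u = 0 := by
    intro a ha
    rw [hj] at ha
    obtain ⟨K, hK⟩ := h p ⟨a, ha⟩
    exact ⟨K.1.1 g, K.1.2.1 g, congrArg Subtype.val hK, K.2.2⟩
  -- The test vector has `σ = 1` and its last entry makes it orthogonal to `j`. The curvature kills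
  -- its parallel extension, so the skew part of `P` is zero.
  have hsymm : g.1.inner p (P p (Z p)) (X p) - g.1.inner p (P p (X p)) (Z p) = 0 := by
    obtain ⟨K, hK, hKp, hK0⟩ := hpar (1, 0, -j.2.2 / j.1) (by
      simp only [tractorMetric, map_zero, _root_.zero_apply]
      field_simp
      ring)
    have h1 := tractorCurv_top g.1 (P := P) hK hX hZ p
    rw [tractorCurv_eq_zero_of_parallel g.1 hK0, hKp] at h1
    simpa using h1.symm
  have htop : (tractorCurv g.1 P X Z I p).1 = 0 := by
    rw [tractorCurv_top g.1 hI hX hZ, hsymm, mul_zero]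
  have horth : ∀ a : TractorComp n p, tractorMetric g.1 p a j = 0 →
      tractorMetric g.1 p (tractorCurv g.1 P X Z I p) a = 0 := by
    intro a ha
    obtain ⟨K, hK, hKp, hK0⟩ := hpar a ha
    rw [← hKp]
    exact tractorMetric_tractorCurv g.1 hP hI hK hK0 hX hZ p
  generalize tractorCurv g.1 P X Z I p = U at *
  -- Since the top of `U` vanishes, pairing with vectors orthogonal to `j` having `σ = 0` reads off
  -- the middle component, and pairing with the one having `σ = 1`, `ω = 0` reads off the bottom.
  refine Prod.ext htop (Prod.ext (inner_ext g.1 fun w => ?_) ?_)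
  · have h1 := horth (0, w, -g.1.inner p w j.2.1 / j.1) (by
      simp only [tractorMetric]
      field_simp
      ring)
    simp only [tractorMetric, htop] at h1
    simpa using h1
  · have h1 := horth (1, 0, -j.2.2 / j.1) (by
      simp only [tractorMetric, map_zero, _root_.zero_apply]
      field_simp
      ring)
    simp only [tractorMetric, htop] at h1
    simpa using h1

/-- If `∇^W` is flat, `T^W` has parallel sections through all of its points. -/
theorem SCMS.evalAt_surjective_of_flat [SimplyConnectedSpace M] (hn : 2 ≤ n) (hm : S.m ≠ 0)
    (hmn : S.m + n - 2 ≠ 0) (hmn' : S.m + n - 1 ≠ 0)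
    (hflat : FlatConn g.1 (weightedSchoutenSharp g.1 (S.v.inScale g) S.m μ)) (p : M) :
    Function.Surjective (S.evalAt μ g p) := by
  have hn0 : n ≠ 0 := by omega
  have hP := smoothEnd_weightedSchoutenSharp g.1 (S.v.smooth g) (S.v_pos g) S.m μ
  have hJ := S.smoothComp_scaleTractor g hn0
  have hJpar := S.scaleTractor_parallel μ g hflat hn hm hmn
  have hJe := S.scaleTractorTilde_eq_of_flat μ g hflat hn hm hmn hmn'
  rintro ⟨a, ha⟩
  obtain ⟨K, hK, hKp, hK0⟩ := exists_parallel_of_simplyConnected g.1 hP hflat p a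
  obtain ⟨I, rfl⟩ := exists_tractor hn0 g hK
  set f : M → ℝ := fun q => tractorMetric g.1 q (I.1 g q) (S.scaleTractor g q)
  have hf : SmoothFn n f := SmoothComp.tractorMetric g.1 hK hJ
  have hdf : ∀ q u, mvfderiv (𝓡 n) f q u = 0 := by
    intro q u
    have := mvfderiv_tractorMetric g.1 (P := weightedSchoutenSharp g.1 (S.v.inScale g) S.m μ)
      (hK.diffAt q) (hJ.diffAt q) u
    rw [hK0, hJpar] at this
    refine this.trans ?_
    simp [tractorMetric]
  have hfp : f p = 0 := by
    have : tractorMetric g.1 p a (S.scaleTractorTilde μ g p) = 0 := ha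
    rw [hJe, ← hKp] at this
    exact this
  -- The pairing `f` has zero derivative, so `f J` is parallel and vanishes at `p`. The uniqueness
  -- theorem gives `f J = 0`, and `v > 0` gives `f = 0`.
  have hfJ := eq_zero_of_parallel_of_connected g.1 hP (SmoothComp.smul hf hJ) (fun q u => by
    rw [tractorConn_smul g.1 (hf.diffAt q) (hJ.diffAt q), hJpar, hdf, smul_zero, zero_smul,
      add_zero]) (p := p) (by rw [Pi.smul_apply', hfp, zero_smul])
  refine ⟨⟨I, fun q => ?_, hK0⟩, Subtype.ext hKp⟩
  rw [hJe]
  have h1 := congrArg Prod.fst (congrFun hfJ q)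
  rw [Pi.smul_apply', S.scaleTractor_eq g hn0] at h1
  have h2 : f q * S.v.inScale g q = 0 := h1
  exact (mul_eq_zero.1 h2).resolve_right (S.v_pos g q).ne'

end Evaluation
end Tractor
end

/-! ### The dimension count. -/

theorem mainTheorem2 {n : ℕ} (hn : 3 ≤ n) {M : Type*} [TopologicalSpace M]
    [ChartedSpace (EuclideanSpace ℝ (Fin n)) M] [IsManifold (𝓡 n) ∞ M] [T2Space M]
    [SecondCountableTopology M] [ConnectedSpace M] (S : Tractor.SCMS n M) (μ : ℝ)
    (hm : S.m ≠ -n) (hm₁ : S.m ≠ 1 - n) (hm₂ : S.m ≠ 2 - n) (g : S.conf.scales) :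
    (Module.rank ℝ (S.parallelSections μ g) ≤ n + 1 ∧
      (Module.rank ℝ (S.parallelSections μ g) = n + 1 → S.IsFlatW μ g)) ∧
    (S.m ≠ 0 → SimplyConnectedSpace M → S.IsFlatW μ g →
      Module.rank ℝ (S.parallelSections μ g) = n + 1) := by
  have hn0 : n ≠ 0 := by omega
  -- Injectivity of evaluation makes the space finite-dimensional, so the cardinal `Module.rank` can
  -- be replaced by `Module.finrank`.
  have hfin := S.finite_parallelSections μ g
  rw [← Module.finrank_eq_rank]
  have p : M := Classical.arbitrary M
  refine ⟨⟨?_, fun h => ?_⟩, fun hm0 _ hflat => ?_⟩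
  · have h := LinearMap.finrank_le_finrank_of_injective (S.evalAt_injective μ g p)
    rw [S.finrank_fibre μ g hn0] at h
    exact_mod_cast h
  · exact (S.flatConn_iff μ g hn0).2 (S.flat_of_evalAt_surjective μ g hn0
      (S.evalAt_surjective μ g hn0 (by exact_mod_cast h)))
  · have h1 : S.m + n - 1 ≠ 0 := fun h => hm₁ (by linarith)
    have h2 : S.m + n - 2 ≠ 0 := fun h => hm₂ (by linarith)
    have hs := S.evalAt_surjective_of_flat μ g (by omega) hm0 h2 h1
      ((S.flatConn_iff μ g hn0).1 hflat) p
    have := LinearEquiv.finrank_eq (LinearEquiv.ofBijective _ ⟨S.evalAt_injective μ g p, hs⟩)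
    rw [this, S.finrank_fibre μ g hn0]
    norm_cast
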